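/- \textbf{Setting.} Let $d\in\{2,3\}$, let $\Omega\subset\mathbb R^d$ be open and bounded with Lipschitz boundary, $\mathbb S=\{\mu\in\mathbb R^d:|\mu|=1\}$ with surface measure $d\mu$, $\mathbb E=[E_{\min},E_{\max}]$ with $0\le E_{\min}<E_{\max}<\infty$, and $\mathcal D=\Omega\times\mathbb S\times\mathbb E$. Let $\theta(x,\mu'\cdot\mu,E'\to E)\ge 0$ be a measurable scattering kernel that vanishes for $E'<E$, let $\alpha(x,E)\ge0$ be measurable, and put $$\beta(x,E)=\int_{\mathbb E}\int_{\mathbb S}\theta(x,\mu\cdot\mu',E\to E')\,d\mu'\,dE',\qquad \gamma(x,E)=\int_{\mathbb E}\int_{\mathbb S}\theta(x,\mu'\cdot\mu,E'\to E)\,d\mu'\,dE',$$ $$\bar\alpha=\alpha+\tfrac12(\beta-\gamma),\qquad S[u](x,\mu,E)=\int_{\mathbb E}\int_{\mathbb S}\theta(x,\mu'\cdot\mu,E'\to E)\,u(x,\mu',E')\,d\mu'\,dE'.$$ (By rotational invariance $\beta$ and $\gamma$ do not depend on $\mu$.) Assume that the integrals defining $\beta$ and $\gamma$ are finite for all $(x,E)\in\Omega\times\mathbb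 E$, that $\alpha$ and $\beta$ are bounded on $\Omega\times\mathbb E$, and that $\bar\alpha\ge\alpha_0$ on $\Omega\times\mathbb E$ for some constant $\alpha_0>0$. Let $f$ be a forcing term and $g_D$ an inflow boundary datum. \textbf{Discretisation.} Let $\mathcal T_\Omega$ be a finite family of pairwise disjoint open sets $\kappa\subset\Omega$ with Lipschitz boundary and $\overline\Omega=\bigcup_\kappa\overline\kappa$; let $n$ be the outward unit normal on $\partial\kappa$. Let $\mathcal T_{\mathbb S}$ be the image, under the radial projection $m\mapsto m/|m|$, of a mesh of axis-parallel tensor-product elements of the surface of the cube $[-1,1]^d$, and let $\mathcal T_{\mathbb E}$ consist of the intervals $(E_g,E_{g-1})$ of a partition $E_{\max}=E_0>\dots>E_N=E_{\min}$, $N\ge1$. For integers $p,q,r\ge0$ let $\mathbb V=\mathbb V_\Omega\otimes\mathbb V_{\mathbb S}\otimes\mathbb V_{\mathbb E}$, where $\mathbb V_\Omega$ consists of the functions that are polynomials of total degree at most $p$ on each $\kappa$, $\mathbb V_{\mathbb S}$ of the functions whose pull-back to each element of the cube surface is a polynomial of degree at most $q$ in each of the $d-1$ coordinates, and $\mathbb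 V_{\mathbb E}$ of the functions that are polynomials of degree at most $r$ on each interval. For $\mu\in\mathbb S$ write $\partial_-\kappa=\{x\in\partial\kappa:\mu\cdot n<0\}$, $\partial_+\kappa=\{x\in\partial\kappa:\mu\cdot n\ge0\}$, let $v^+$ and $v^-$ be the traces of $v$ on $\partial\kappa$ from inside and from outside $\kappa$, and put $\|v\|_{\Gamma}^2=\int_{\Gamma}|\mu\cdot n|\,v^2\,ds$ for $\Gamma\subset\partial\kappa$. Define $$a(w,v)=\int_{\mathbb E}\int_{\mathbb S}\sum_{\kappa\in\mathcal T_\Omega}\Big[\int_\kappa\big(-w\,\mu\cdot\nabla_x v+(\alpha+\beta)wv\big)dx+\int_{\partial_+\kappa}|\mu\cdot n|\,w^+v^+\,ds-\int_{\partial_-\kappa\setminus\partial\Omega}|\mu\cdot n|\,w^-v^+\,ds\Big]d\mu\,dE,$$ $$s(w,v)=\int_{\mathbb E}\int_{\mathbb S}\int_\Omega S[w]\,v\,dx\,d\mu\,dE,\qquad \ell(v)=\int_{\mathbb E}\int_{\mathbb S}\sum_{\kappa\in\mathcal T_\Omega}\Big[\int_\kappa fv\,dx+\int_{\partial_-\kappa\cap\partial\Omega}|\mu\cdot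 n|\,g_D\,v^+\,ds\Big]d\mu\,dE,$$ $$J(v)=\frac12\int_{\mathbb E}\int_{\mathbb S}\sum_{\kappa\in\mathcal T_\Omega}\Big(\|v^+-v^-\|^2_{\partial_-\kappa\setminus\partial\Omega}+\|v^+\|^2_{\partial\kappa\cap\partial\Omega}\Big)d\mu\,dE,$$ $$|||v|||_a^2=\|\sqrt{\alpha+\beta}\,v\|_{L_2(\mathcal D)}^2+J(v),\qquad |||v|||_{DG}^2=\|\sqrt{\bar\alpha}\,v\|_{L_2(\mathcal D)}^2+J(v).$$ \textbf{Theorem.} Let $u_h\in\mathbb V$ satisfy $a(u_h,v)=s(u_h,v)+\ell(v)$ for all $v\in\mathbb V$, and let $u_h^{(0)},u_h^{(1)},\dots\in\mathbb V$ be generated by source iteration, $$a(u_h^{(n+1)},v)=s(u_h^{(n)},v)+\ell(v)\qquad\text{for all }v\in\mathbb V,\ n\ge0 .$$ (In operator form: $Au_h^{(n+1)}=Su_h^{(n)}+F$.) Then for all $n\ge0$ $$|||u_h-u_h^{(n+1)}|||_a\le\sqrt{q_\beta q_\gamma}\;|||u_h-u_h^{(n)}|||_a,\qquad q_\beta=\sup_{\Omega\times\mathbb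 E}\frac{\beta}{\alpha+\beta},\quad q_\gamma=\sup_{\Omega\times\mathbb E}\frac{\gamma}{\alpha+\beta},$$ and for all $n\ge0$ $$|||u_h-u_h^{(n+1)}|||_{DG}\le\sqrt{r_\gamma}\;\big\|\sqrt\beta\,(u_h^{(n)}-u_h^{(n+1)})\big\|_{L_2(\mathcal D)},\qquad r_\gamma=\sup_{\Omega\times\mathbb E}\frac{\gamma}{\bar\alpha}.$$ -/

import Mathlib

open MeasureTheory Metric Set Filter Topology
open scoped NNReal RealInnerProductSpace

noncomputable section

namespace Transport

/-! ### Geometry -/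

/-- Euclidean space of dimension `d`. -/
abbrev Space (d : ℕ) : Type := EuclideanSpace ℝ (Fin d)

/-- The angular domain: the unit sphere in `ℝ^d`. -/
abbrev Dir (d : ℕ) : Type := sphere (0 : Space d) 1

/-- The surface measure on the unit sphere. -/
def dirMeasure (d : ℕ) : Measure (Dir d) := (volume : Measure (Space d)).toSphere

/-- The `(d-1)`-dimensional Hausdorff measure, normalised so that it is the usual surface area
(arc length if `d = 2`). -/
def surfaceMeasure (d : ℕ) : Measure (Space d) := Measure.euclideanHausdorffMeasure (d - 1)

/-- An open bounded set with Lipschitz boundary: near each of its boundary points the set is, in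
suitable orthonormal coordinates, the region below the graph of a Lipschitz function. Here `e`
is the vertical direction of the coordinates and `φ` is defined on the hyperplane
orthogonal to `e`. -/
structure IsLipschitzDomain {d : ℕ} (U : Set (Space d)) : Prop where
  isOpen : IsOpen U
  isBounded : Bornology.IsBounded U
  locallyGraph : ∀ x ∈ frontier U, ∃ e : Space d, ‖e‖ = 1 ∧
    ∃ (L : ℝ≥0) (φ : (ℝ ∙ e)ᗮ → ℝ), LipschitzWith L φ ∧
      ∀ᶠ y in 𝓝 x, (y ∈ U ↔ ⟪e, y⟫ < φ ((ℝ ∙ e)ᗮ.orthogonalProjectionOnto y))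

/-- `n` is the outward unit normal to `U` at the point `x`: to first order at `x`,
the set `U` is the half-space `⟪n, y - x⟫ < 0`. -/
def IsOutwardNormal {d : ℕ} (U : Set (Space d)) (x n : Space d) : Prop :=
  ‖n‖ = 1 ∧ ∀ ε : ℝ, 0 < ε → ∀ᶠ y in 𝓝 x,
    (⟪n, y - x⟫ < -(ε * ‖y - x‖) → y ∈ U) ∧ (ε * ‖y - x‖ < ⟪n, y - x⟫ → y ∉ U)

/-- Outward unit normals are unique. -/
theorem IsOutwardNormal.unique {d : ℕ} {U : Set (Space d)} {x n m : Space d}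
    (hn : IsOutwardNormal U x n) (hm : IsOutwardNormal U x m) : n = m := by
  by_contra hne
  have hnn : ⟪n, n⟫ = 1 := by rw [real_inner_self_eq_norm_sq, hn.1]; norm_num
  have hmm : ⟪m, m⟫ = 1 := by rw [real_inner_self_eq_norm_sq, hm.1]; norm_num
  have hsymm : ⟪m, n⟫ = ⟪n, m⟫ := real_inner_comm _ _
  have hlt : ⟪n, m⟫ < 1 := (inner_lt_one_iff_real_of_norm_eq_one hn.1 hm.1).2 hne
  set w : Space d := m - n with hw
  have hwpos : 0 < ‖w‖ := norm_pos_iff.2 (sub_ne_zero.2 (Ne.symm hne))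
  have hnw : ⟪n, w⟫ = ⟪n, m⟫ - 1 := by rw [hw, inner_sub_right, hnn]
  have hmw : ⟪m, w⟫ = 1 - ⟪n, m⟫ := by rw [hw, inner_sub_right, hmm, hsymm]
  set ε : ℝ := (1 - ⟪n, m⟫) / (2 * ‖w‖) with hε
  have hεpos : 0 < ε := by
    have : 0 < 1 - ⟪n, m⟫ := by linarith
    positivity
  have hεw : ε * ‖w‖ = (1 - ⟪n, m⟫) / 2 := by rw [hε]; field_simp
  have htend : Tendsto (fun t : ℝ => x + t • w) (𝓝[>] 0) (𝓝 x) := by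
    have hc : Continuous fun t : ℝ => x + t • w := by fun_prop
    have h0 := hc.tendsto 0
    simp only [zero_smul, add_zero] at h0
    exact h0.mono_left nhdsWithin_le_nhds
  obtain ⟨t, ⟨h1, h2⟩, ht⟩ := ((htend.eventually (hn.2 ε hεpos)).and
    (htend.eventually (hm.2 ε hεpos)) |>.and self_mem_nhdsWithin).exists
  have ht0 : 0 < t := ht
  have hsub : x + t • w - x = t • w := by abel
  rw [hsub, norm_smul, Real.norm_of_nonneg ht0.le, inner_smul_right] at h1 h2
  refine h2.2 ?_ (h1.1 ?_)
  · rw [hmw]; nlinarith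
  · rw [hnw]; nlinarith

open Classical in
/-- The outward unit normal to `U` at `x` (set to `0` where there is none: on a Lipschitz boundary
this is a set of zero surface measure). -/
def outwardNormal {d : ℕ} (U : Set (Space d)) (x : Space d) : Space d :=
  if h : ∃ n, IsOutwardNormal U x n then h.choose else 0

/-! ### Data of the transport problem -/

/-- The data of the linear Boltzmann transport problem, with their standing assumptions.
`θ x t E' E` is the scattering kernel `θ(x, t, E' → E)`, where `t` is the cosine of the scattering
angle. The functions are total; only their values on the physical domain matter. -/
structure Problem (d : ℕ) where
  /-- the spatial domain -/
  Ω : Set (Space d)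
  lipschitz : IsLipschitzDomain Ω
  /-- the lowest energy -/
  Emin : ℝ
  /-- the highest energy -/
  Emax : ℝ
  Emin_nonneg : 0 ≤ Emin
  Emin_lt_Emax : Emin < Emax
  /-- the scattering kernel -/
  θ : Space d → ℝ → ℝ → ℝ → ℝ
  /-- the macroscopic absorption cross-section -/
  α : Space d → ℝ → ℝ
  /-- the forcing term -/
  f : Space d → Dir d → ℝ → ℝ
  /-- the inflow boundary datum -/
  gD : Space d → Dir d → ℝ → ℝ
  θ_measurable : Measurable fun z : Space d × ℝ × ℝ × ℝ => θ z.1 z.2.1 z.2.2.1 z.2.2.2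
  θ_nonneg : ∀ x ∈ Ω, ∀ t ∈ Icc (-1 : ℝ) 1, ∀ E' ∈ Icc Emin Emax, ∀ E ∈ Icc Emin Emax,
    0 ≤ θ x t E' E
  θ_no_upscatter : ∀ x ∈ Ω, ∀ t ∈ Icc (-1 : ℝ) 1, ∀ E' ∈ Icc Emin Emax, ∀ E ∈ Icc Emin Emax,
    E' < E → θ x t E' E = 0
  /-- the integral defining `β` is finite -/
  θ_integrable_out : ∀ x ∈ Ω, ∀ μ : Dir d, ∀ E ∈ Icc Emin Emax,
    Integrable (fun z : Dir d × ℝ => θ x ⟪(μ : Space d), (z.1 : Space d)⟫ E z.2)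
      ((dirMeasure d).prod (volume.restrict (Icc Emin Emax)))
  /-- the integral defining `γ` is finite -/
  θ_integrable_in : ∀ x ∈ Ω, ∀ μ : Dir d, ∀ E ∈ Icc Emin Emax,
    Integrable (fun z : Dir d × ℝ => θ x ⟪(z.1 : Space d), (μ : Space d)⟫ z.2 E)
      ((dirMeasure d).prod (volume.restrict (Icc Emin Emax)))
  α_measurable : Measurable fun z : Space d × ℝ => α z.1 z.2
  α_nonneg : ∀ x ∈ Ω, ∀ E ∈ Icc Emin Emax, 0 ≤ α x E

/-- A reference direction: the first coordinate vector. -/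
def pole (d : ℕ) [NeZero d] : Dir d := ⟨EuclideanSpace.single 0 1, by simp⟩

namespace Problem

variable {d : ℕ} (P : Problem d)

/-- The energy domain. -/
def energy : Set ℝ := Icc P.Emin P.Emax

/-- The scattering operator `S[u](x,μ,E) = ∫∫ θ(x, μ'·μ, E' → E) u(x,μ',E') dμ' dE'`. -/
def scatter (u : Space d → Dir d → ℝ → ℝ) (x : Space d) (μ : Dir d) (E : ℝ) : ℝ :=
  ∫ E' in P.energy, ∫ μ' : Dir d,
    P.θ x ⟪(μ' : Space d), (μ : Space d)⟫ E' E * u x μ' E' ∂(dirMeasure d)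

/-- The macroscopic scattering cross-section
`β(x,E) = ∫∫ θ(x, μ·μ', E → E') dμ' dE'`. By rotational invariance the value does not depend on
`μ` (see `β_eq`), which is taken to be the reference direction. -/
def β [NeZero d] (x : Space d) (E : ℝ) : ℝ :=
  ∫ E' in P.energy, ∫ μ' : Dir d,
    P.θ x ⟪(pole d : Space d), (μ' : Space d)⟫ E E' ∂(dirMeasure d)

/-- `γ(x,E) = ∫∫ θ(x, μ'·μ, E' → E) dμ' dE'`, again independent of `μ` (see `γ_eq`). -/
def γ [NeZero d] (x : Space d) (E : ℝ) : ℝ :=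
  ∫ E' in P.energy, ∫ μ' : Dir d,
    P.θ x ⟪(μ' : Space d), (pole d : Space d)⟫ E' E ∂(dirMeasure d)

/-- `ᾱ = α + (β - γ) / 2`. -/
def αbar [NeZero d] (x : Space d) (E : ℝ) : ℝ :=
  P.α x E + 1 / 2 * (P.β x E - P.γ x E)

/-- The cross-sections `α` and `β` are bounded functions. -/
def BoundedData [NeZero d] : Prop :=
  ∃ C : ℝ, ∀ x ∈ P.Ω, ∀ E ∈ P.energy, P.α x E ≤ C ∧ P.β x E ≤ C

/-- `ᾱ` is bounded below by a positive constant. -/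
def Positivity [NeZero d] : Prop :=
  ∃ α₀ : ℝ, 0 < α₀ ∧ ∀ x ∈ P.Ω, ∀ E ∈ P.energy, α₀ ≤ P.αbar x E

/-- `q_β = sup β / (α + β)` over the spatial and the energy domain. -/
def qβ [NeZero d] : ℝ :=
  sSup ((fun z : Space d × ℝ => P.β z.1 z.2 / (P.α z.1 z.2 + P.β z.1 z.2)) '' (P.Ω ×ˢ P.energy))

/-- `q_γ = sup γ / (α + β)` over the spatial and the energy domain. -/
def qγ [NeZero d] : ℝ :=
  sSup ((fun z : Space d × ℝ => P.γ z.1 z.2 / (P.α z.1 z.2 + P.β z.1 z.2)) '' (P.Ω ×ˢ P.energy))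

/-- `r_γ = sup γ / ᾱ` over the spatial and the energy domain. -/
def rγ [NeZero d] : ℝ :=
  sSup ((fun z : Space d × ℝ => P.γ z.1 z.2 / P.αbar z.1 z.2) '' (P.Ω ×ˢ P.energy))

end Problem

open scoped Pointwise in
/-- Surface integrals over the sphere of functions of `μ·μ'` do not depend on `μ`. -/
theorem integral_inner_dir {d : ℕ} (h : ℝ → ℝ) (μ ν : Dir d) :
    ∫ μ' : Dir d, h ⟪(μ : Space d), (μ' : Space d)⟫ ∂(dirMeasure d) =
      ∫ μ' : Dir d, h ⟪(ν : Space d), (μ' : Space d)⟫ ∂(dirMeasure d) := by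
  have hnorm : ‖(μ : Space d)‖ = ‖(ν : Space d)‖ := by simp
  let R : Space d ≃ₗᵢ[ℝ] Space d := Submodule.reflection (ℝ ∙ ((μ : Space d) - ν))ᗮ
  have hR : R μ = ν := Submodule.reflection_sub hnorm
  have hmem : ∀ x : Dir d, R x ∈ sphere (0 : Space d) 1 := fun x => by simp
  have hmem' : ∀ x : Dir d, R.symm x ∈ sphere (0 : Space d) 1 := fun x => by simp
  let T : Dir d ≃ₜ Dir d :=
    { toFun := fun x => ⟨R x, hmem x⟩
      invFun := fun x => ⟨R.symm x, hmem' x⟩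
      left_inv := fun x => by simp
      right_inv := fun x => by simp
      continuous_toFun := by fun_prop
      continuous_invFun := by fun_prop }
  have hT : MeasurePreserving T (dirMeasure d) (dirMeasure d) := by
    refine ⟨T.continuous.measurable, ?_⟩
    ext s hs
    rw [Measure.map_apply T.continuous.measurable hs, dirMeasure,
      Measure.toSphere_apply' _ (T.continuous.measurable hs), Measure.toSphere_apply' _ hs]
    have hset : Ioo (0 : ℝ) 1 • ((↑) '' (T ⁻¹' s) : Set (Space d)) =
        R ⁻¹' (Ioo (0 : ℝ) 1 • ((↑) '' s : Set (Space d))) := by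
      ext y
      simp only [Set.mem_smul, Set.mem_preimage, Set.mem_image]
      constructor
      · rintro ⟨a, ha, _, ⟨x, hx, rfl⟩, rfl⟩
        exact ⟨a, ha, _, ⟨T x, hx, rfl⟩, by simp [T]⟩
      · rintro ⟨a, ha, _, ⟨x, hx, rfl⟩, hy⟩
        refine ⟨a, ha, _, ⟨T.symm x, by simpa using hx, rfl⟩, ?_⟩
        apply R.injective
        have hx' : R (T.symm x : Space d) = x := R.apply_symm_apply x
        rw [map_smul, hx', hy]
    have hvol : (volume : Measure (Space d)) (R ⁻¹' (Ioo (0 : ℝ) 1 • ((↑) '' s : Set (Space d)))) =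
        volume (Ioo (0 : ℝ) 1 • ((↑) '' s : Set (Space d))) :=
      R.measurePreserving.measure_preimage_emb R.toHomeomorph.measurableEmbedding _
    rw [hset, hvol]
  rw [← hT.integral_comp T.measurableEmbedding
    (fun x : Dir d => h ⟪(ν : Space d), (x : Space d)⟫)]
  refine integral_congr_ae (Eventually.of_forall fun x => ?_)
  change h ⟪(μ : Space d), (x : Space d)⟫ = h ⟪(ν : Space d), R x⟫
  rw [← hR, LinearIsometryEquiv.inner_map_map]

theorem Problem.β_eq {d : ℕ} [NeZero d] (P : Problem d) (μ : Dir d) (x : Space d) (E : ℝ) :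
    P.β x E = ∫ E' in P.energy, ∫ μ' : Dir d,
      P.θ x ⟪(μ : Space d), (μ' : Space d)⟫ E E' ∂(dirMeasure d) := by
  unfold Problem.β
  congr 1
  ext E'
  exact integral_inner_dir (fun t => P.θ x t E E') (pole d) μ

theorem Problem.γ_eq {d : ℕ} [NeZero d] (P : Problem d) (μ : Dir d) (x : Space d) (E : ℝ) :
    P.γ x E = ∫ E' in P.energy, ∫ μ' : Dir d,
      P.θ x ⟪(μ' : Space d), (μ : Space d)⟫ E' E ∂(dirMeasure d) := by
  unfold Problem.γ
  congr 1
  ext E'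
  have hc : ∀ ν μ' : Dir d, ⟪(μ' : Space d), (ν : Space d)⟫ = ⟪(ν : Space d), (μ' : Space d)⟫ :=
    fun ν μ' => real_inner_comm _ _
  simp only [hc (pole d), hc μ]
  exact integral_inner_dir (fun t => P.θ x t E' E) (pole d) μ

/-! ### Meshes -/

/-- A finite subdivision of `Ω` into open disjoint elements with Lipschitz boundary. -/
structure SpaceMesh {d : ℕ} (Ω : Set (Space d)) where
  /-- the number of elements -/
  card : ℕ
  /-- the elements -/
  elem : Fin card → Set (Space d)
  lipschitz : ∀ i, IsLipschitzDomain (elem i)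
  subset : ∀ i, elem i ⊆ Ω
  disjoint : Pairwise fun i j => Disjoint (elem i) (elem j)
  cover : closure Ω = ⋃ i, closure (elem i)

/-- The (relatively open) tensor-product element `{m : m_k = s, a_j < m_j < b_j for j ≠ k}` of the
face `m_k = s` of a cube. -/
def faceBox {d : ℕ} (k : Fin d) (s : ℝ) (a b : Fin d → ℝ) : Set (Fin d → ℝ) :=
  {m | m k = s ∧ ∀ j, j ≠ k → m j ∈ Ioo (a j) (b j)}

/-- A mesh of tensor-product elements on the surface of the cube `[-1,1]^d` (the unit
sphere of the maximum norm on `Fin d → ℝ`). The elements are listed without their relative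
boundaries. -/
structure CubeMesh (d : ℕ) where
  /-- the number of elements -/
  card : ℕ
  /-- the coordinate that is constant on the element -/
  axis : Fin card → Fin d
  /-- the value of that coordinate -/
  side : Fin card → ℝ
  /-- lower bounds of the other coordinates -/
  lo : Fin card → Fin d → ℝ
  /-- upper bounds of the other coordinates -/
  hi : Fin card → Fin d → ℝ
  side_eq : ∀ i, side i = 1 ∨ side i = -1
  lo_lt_hi : ∀ i j, lo i j < hi i j
  disjoint : Pairwise fun i j => Disjoint (faceBox (axis i) (side i) (lo i) (hi i))
    (faceBox (axis j) (side j) (lo j) (hi j))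
  cover : (⋃ i, closure (faceBox (axis i) (side i) (lo i) (hi i))) = sphere (0 : Fin d → ℝ) 1

/-- The `i`-th element of a mesh of the cube surface. -/
def CubeMesh.flatElem {d : ℕ} (M : CubeMesh d) (i : Fin M.card) : Set (Fin d → ℝ) :=
  faceBox (M.axis i) (M.side i) (M.lo i) (M.hi i)

/-- The inverse `μ ↦ μ / |μ|_∞` of the radial projection `m ↦ m / |m|₂` from the surface
of the cube onto the sphere. -/
def toCube {d : ℕ} (μ : Dir d) : Fin d → ℝ :=
  ‖(WithLp.ofLp (μ : Space d) : Fin d → ℝ)‖⁻¹ • (WithLp.ofLp (μ : Space d) : Fin d → ℝ)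

/-- `toCube` inverts the radial projection of the cube surface. -/
theorem toCube_radial {d : ℕ} (m : Fin d → ℝ) (hm : ‖m‖ = 1) (μ : Dir d)
    (hμ : (μ : Space d) = ‖(WithLp.toLp 2 m : Space d)‖⁻¹ • (WithLp.toLp 2 m : Space d)) :
    toCube μ = m := by
  have hne : (WithLp.toLp 2 m : Space d) ≠ 0 := by
    intro h
    have : m = 0 := by simpa using h
    simp [this] at hm
  have hpos : 0 < ‖(WithLp.toLp 2 m : Space d)‖ := norm_pos_iff.2 hne
  unfold toCube
  rw [hμ, WithLp.ofLp_smul, norm_smul, hm, norm_inv, norm_norm, mul_one, inv_inv, smul_smul,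
    mul_inv_cancel₀ hpos.ne', one_smul]

/-- The curved element of the sphere over the `i`-th element of the cube surface. -/
def CubeMesh.elem {d : ℕ} (M : CubeMesh d) (i : Fin M.card) : Set (Dir d) :=
  {μ | toCube μ ∈ M.flatElem i}

/-- A partition `Emax = E_0 > E_1 > ... > E_N = Emin`, `N ≥ 1`, of the energy domain. -/
structure EnergyMesh (Emin Emax : ℝ) where
  /-- the number of energy groups -/
  N : ℕ
  one_le : 1 ≤ N
  /-- the nodes -/
  node : Fin (N + 1) → ℝ
  anti : StrictAnti node
  first : node 0 = Emax
  last : node (Fin.last N) = Emin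

/-- The `g`-th energy group. -/
def EnergyMesh.group {Emin Emax : ℝ} (M : EnergyMesh Emin Emax) (g : Fin M.N) : Set ℝ :=
  Ioo (M.node g.succ) (M.node g.castSucc)

/-! ### Finite element spaces

Elements of the finite element spaces are classes of functions modulo null sets. Each class is
represented here by its representative that vanishes off the union of the open elements. -/

/-- Piecewise polynomials of total degree at most `p` on the spatial mesh. -/
def spaceFE {d : ℕ} {Ω : Set (Space d)} (M : SpaceMesh Ω) (p : ℕ) : Set (Space d → ℝ) :=
  {v | (∀ i, ∃ Q : MvPolynomial (Fin d) ℝ, Q.totalDegree ≤ p ∧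
      ∀ x ∈ M.elem i, v x = MvPolynomial.eval (fun j => x j) Q) ∧
    ∀ x, x ∉ (⋃ i, M.elem i) → v x = 0}

/-- Functions on the sphere that are, on each element and after pull-back to the cube surface,
polynomials of degree at most `q` in each of the coordinates. -/
def dirFE {d : ℕ} (M : CubeMesh d) (q : ℕ) : Set (Dir d → ℝ) :=
  {v | (∀ i, ∃ Q : MvPolynomial (Fin d) ℝ, (∀ j, Q.degreeOf j ≤ q) ∧
      ∀ μ ∈ M.elem i, v μ = MvPolynomial.eval (toCube μ) Q) ∧
    ∀ μ, μ ∉ (⋃ i, M.elem i) → v μ = 0}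

/-- Piecewise polynomials of degree at most `r` on the energy mesh. -/
def energyFE {Emin Emax : ℝ} (M : EnergyMesh Emin Emax) (r : ℕ) : Set (ℝ → ℝ) :=
  {v | (∀ g, ∃ Q : Polynomial ℝ, Q.natDegree ≤ r ∧ ∀ E ∈ M.group g, v E = Q.eval E) ∧
    ∀ E, E ∉ (⋃ g, M.group g) → v E = 0}

/-- The space-angle-energy finite element space: the tensor product of the three spaces,
that is, the span of the products of their members. -/
def feSpace {d : ℕ} {Ω : Set (Space d)} {Emin Emax : ℝ} (MX : SpaceMesh Ω) (MA : CubeMesh d)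
    (ME : EnergyMesh Emin Emax) (p q r : ℕ) : Submodule ℝ (Space d → Dir d → ℝ → ℝ) :=
  Submodule.span ℝ {v | ∃ a ∈ spaceFE MX p, ∃ b ∈ dirFE MA q, ∃ c ∈ energyFE ME r,
    v = fun x μ E => a x * b μ * c E}

/-! ### Traces, forms and norms -/

section Forms

variable {d : ℕ} (P : Problem d) (M : SpaceMesh P.Ω)

/-- The part `∂₋κ` of the boundary of `κ` where `μ·n < 0`. -/
def inflow (κ : Set (Space d)) (μ : Dir d) : Set (Space d) :=
  {x ∈ frontier κ | ⟪(μ : Space d), outwardNormal κ x⟫ < 0}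

/-- The part `∂₊κ` of the boundary of `κ` where `μ·n ≥ 0`. -/
def outflow (κ : Set (Space d)) (μ : Dir d) : Set (Space d) :=
  {x ∈ frontier κ | 0 ≤ ⟪(μ : Space d), outwardNormal κ x⟫}

/-- The surface integral `∫_Γ |μ·n| g ds` over a part `Γ` of the boundary of `κ`. -/
def fluxIntegral (κ : Set (Space d)) (μ : Dir d) (Γ : Set (Space d)) (g : Space d → ℝ) : ℝ :=
  ∫ x in Γ, |⟪(μ : Space d), outwardNormal κ x⟫| * g x ∂(surfaceMeasure d)

variable {P}

/-- The trace of `v` on the boundary of the `i`-th element from the interior of that element. -/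
def intTrace (i : Fin M.card) (v : Space d → Dir d → ℝ → ℝ) (μ : Dir d) (E : ℝ)
    (x : Space d) : ℝ :=
  limUnder (𝓝[M.elem i] x) fun y => v y μ E

/-- The trace of `v` on the boundary of the `i`-th element from its exterior, that is, from the
other elements. -/
def extTrace (i : Fin M.card) (v : Space d → Dir d → ℝ → ℝ) (μ : Dir d) (E : ℝ)
    (x : Space d) : ℝ :=
  limUnder (𝓝[⋃ j ∈ {j | j ≠ i}, M.elem j] x) fun y => v y μ E

variable (P)

/-- The transport form `a(w,v)`. -/
def formA [NeZero d] (w v : Space d → Dir d → ℝ → ℝ) : ℝ :=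
  ∫ E in P.energy, ∫ μ : Dir d,
    (∑ i, ((∫ x in M.elem i, (-(w x μ E * fderiv ℝ (fun y => v y μ E) x (μ : Space d))
          + (P.α x E + P.β x E) * w x μ E * v x μ E))
      + fluxIntegral (M.elem i) μ (outflow (M.elem i) μ)
          (fun x => intTrace M i w μ E x * intTrace M i v μ E x)
      - fluxIntegral (M.elem i) μ (inflow (M.elem i) μ \ frontier P.Ω)
          (fun x => extTrace M i w μ E x * intTrace M i v μ E x))) ∂(dirMeasure d)

/-- The scattering form `s(w,v)`. -/
def formS (w v : Space d → Dir d → ℝ → ℝ) : ℝ :=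
  ∫ E in P.energy, ∫ μ : Dir d, (∫ x in P.Ω, P.scatter w x μ E * v x μ E) ∂(dirMeasure d)

/-- The load functional `ℓ(v)`. -/
def load (v : Space d → Dir d → ℝ → ℝ) : ℝ :=
  ∫ E in P.energy, ∫ μ : Dir d,
    (∑ i, ((∫ x in M.elem i, P.f x μ E * v x μ E)
      + fluxIntegral (M.elem i) μ (inflow (M.elem i) μ ∩ frontier P.Ω)
          (fun x => P.gD x μ E * intTrace M i v μ E x))) ∂(dirMeasure d)

/-- The weighted norm `‖√ρ v‖` in `L²` of the space-angle-energy domain, for a weight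
`ρ(x,E)`. -/
def weightedNorm (ρ : Space d → ℝ → ℝ) (v : Space d → Dir d → ℝ → ℝ) : ℝ :=
  √(∫ E in P.energy, ∫ μ : Dir d, (∫ x in P.Ω, (√(ρ x E) * v x μ E) ^ 2) ∂(dirMeasure d))

/-- The jump and boundary terms shared by the two energy norms:
`½ ∫∫ ∑_κ (‖v⁺ - v⁻‖² on ∂₋κ \ ∂Ω  +  ‖v⁺‖² on ∂κ ∩ ∂Ω) dμ dE`. -/
def jumpTerm (v : Space d → Dir d → ℝ → ℝ) : ℝ :=
  1 / 2 * ∫ E in P.energy, ∫ μ : Dir d,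
    (∑ i, (fluxIntegral (M.elem i) μ (inflow (M.elem i) μ \ frontier P.Ω)
          (fun x => (intTrace M i v μ E x - extTrace M i v μ E x) ^ 2)
      + fluxIntegral (M.elem i) μ (frontier (M.elem i) ∩ frontier P.Ω)
          (fun x => intTrace M i v μ E x ^ 2))) ∂(dirMeasure d)

/-- The norm `|||v|||_a`. -/
def normA [NeZero d] (v : Space d → Dir d → ℝ → ℝ) : ℝ :=
  √(weightedNorm P (fun x E => P.α x E + P.β x E) v ^ 2 + jumpTerm P M v)

/-- The DGFEM-energy norm `|||v|||_DG`. -/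
def normDG [NeZero d] (v : Space d → Dir d → ℝ → ℝ) : ℝ :=
  √(weightedNorm P P.αbar v ^ 2 + jumpTerm P M v)

variable {P M}

/-- `u` is a solution, in the finite element space `V`, of the DGFEM problem
`a(u,v) = s(u,v) + ℓ(v)` for all `v ∈ V`. -/
def IsDGSolution [NeZero d] (P : Problem d) (M : SpaceMesh P.Ω)
    (V : Submodule ℝ (Space d → Dir d → ℝ → ℝ)) (u : Space d → Dir d → ℝ → ℝ) : Prop :=
  u ∈ V ∧ ∀ v ∈ V, formA P M u v = formS P u v + load P M v

/-- `u 0, u 1, ...` is a sequence of source iterates in `V`: each `u (n+1)` solves the DGFEM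
problem with the scattering term lagged,
`a(u⁽ⁿ⁺¹⁾,v) = s(u⁽ⁿ⁾,v) + ℓ(v)` for all `v ∈ V`. -/
def IsSourceIteration [NeZero d] (P : Problem d) (M : SpaceMesh P.Ω)
    (V : Submodule ℝ (Space d → Dir d → ℝ → ℝ)) (u : ℕ → Space d → Dir d → ℝ → ℝ) : Prop :=
  (∀ n, u n ∈ V) ∧
    ∀ n, ∀ v ∈ V, formA P M (u (n + 1)) v = formS P (u n) v + load P M v

end Forms

end Transport

end

open Transport

/-!
Source iteration is a fixed-point iteration for `A u = S u + F`, and its error estimates are energy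
estimates: the transport form controls the error from below, the scattering form from above.

**Lower bound.** For a finite element function `v` and a fixed direction and energy, the divergence
theorem on each element turns `-∫_κ v μ·∇v` into `-½ ∫_{∂κ} (μ·n) v²`. Summing over the elements,
the fluxes through the two sides of an interface combine, since the outward normals of the
two elements are opposite almost everywhere, and what is left is exactly
`a(v,v) = ‖√(α+β) v‖² + J(v)` (`formA_self`). So `|||·|||_a` is the energy norm of `a`.

**Upper bound.** Integrated over the incoming or over the outgoing variables, the scattering kernel
is `γ` or `β`. Cauchy-Schwarz with respect to the kernel therefore gives
`s(w,v) ≤ ‖√β w‖ ‖√γ v‖` (`formS_le`), and on the diagonal `2 s(v,v) ≤ ‖√β v‖² + ‖√γ v‖²`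
(`two_mul_formS_self_le`). As `ᾱ = α + β - ½ (β + γ)`, the latter yields the coercivity
`|||v|||_DG² ≤ a(v,v) - s(v,v)` (`normDG_sq_le`).

**Conclusion.** The new error `e` and the old error `e₀` satisfy `a(e,e) = s(e₀,e)`
(`formA_error`). The first estimate is `|||e|||_a² = s(e₀,e) ≤ ‖√β e₀‖ ‖√γ e‖`, with the weights
`β` and `γ` compared with `α + β`. The second one is
`|||e|||_DG² ≤ s(e₀,e) - s(e,e) = s(e₀-e,e)`, where `e₀ - e` is the last increment and `γ` is
compared with `ᾱ`.

The analytic work lies in the lower bound, because elements are arbitrary Lipschitz domains and the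
surface measure is a Hausdorff measure. The divergence theorem is derived from the area formula
for Lipschitz graphs (Rademacher's theorem and the linear case), from the computation of the integral
of a derivative below a graph in coordinates that flatten it, and from a smooth partition of unity
(`IsLipschitzDomain.setIntegral_fderiv`). Finite element functions are handled through
`IsPiecewiseExtension`: on each element they agree with a `C¹` function on the whole space, whose
values on the boundary are the traces.
-/

set_option linter.unusedSectionVars false

noncomputable section

namespace Transport

/-! ### Surface area of Lipschitz graphs -/

section Graph

open scoped ENNReal
open Module (finrank)

variable {E : Type*} [NormedAddCommGroup E] [InnerProductSpace ℝ E]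

/-- The parametrisation `y ↦ y + φ(y) e` of the graph of `φ` over the hyperplane orthogonal
to `e`. -/
def graphMap (e : E) (φ : (ℝ ∙ e)ᗮ → ℝ) (y : (ℝ ∙ e)ᗮ) : E := (y : E) + φ y • e

theorem inner_coe_orthogonal_eq_zero (e : E) (y : (ℝ ∙ e)ᗮ) : ⟪e, (y : E)⟫ = 0 :=
  Submodule.mem_orthogonal_singleton_iff_inner_right.1 y.2

theorem norm_sq_coe_add_smul {e : E} (he : ‖e‖ = 1) (y : (ℝ ∙ e)ᗮ) (t : ℝ) :
    ‖(y : E) + t • e‖ ^ 2 = ‖y‖ ^ 2 + t ^ 2 := by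
  have h0 : ⟪(y : E), e⟫ = 0 := by rw [real_inner_comm]; exact inner_coe_orthogonal_eq_zero e y
  rw [norm_add_sq_real, inner_smul_right, h0, norm_smul, he, Real.norm_eq_abs]
  simp [sq_abs]

theorem norm_le_norm_coe_add_smul {e : E} (he : ‖e‖ = 1) (y : (ℝ ∙ e)ᗮ) (t : ℝ) :
    ‖y‖ ≤ ‖(y : E) + t • e‖ := by
  have := norm_sq_coe_add_smul he y t
  exact abs_le_of_sq_le_sq' (by nlinarith [sq_nonneg t]) (norm_nonneg _) |>.2

theorem graphMap_sub (e : E) (φ : (ℝ ∙ e)ᗮ → ℝ) (y z : (ℝ ∙ e)ᗮ) :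
    graphMap e φ y - graphMap e φ z = ((y - z : (ℝ ∙ e)ᗮ) : E) + (φ y - φ z) • e := by
  simp only [graphMap, Submodule.coe_sub, sub_smul]; abel

theorem inner_graphMap {e : E} (he : ‖e‖ = 1) (φ : (ℝ ∙ e)ᗮ → ℝ) (y : (ℝ ∙ e)ᗮ) :
    ⟪e, graphMap e φ y⟫ = φ y := by
  rw [graphMap, inner_add_right, inner_coe_orthogonal_eq_zero, inner_smul_right,
    real_inner_self_eq_norm_sq, he]
  ring

theorem graphMap_injective {e : E} (he : ‖e‖ = 1) (φ : (ℝ ∙ e)ᗮ → ℝ) :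
    Function.Injective (graphMap e φ) := by
  intro y z h
  have h1 := norm_le_norm_coe_add_smul he (y - z) (φ y - φ z)
  rw [← graphMap_sub, h, sub_self, norm_zero] at h1
  exact sub_eq_zero.1 (norm_le_zero_iff.1 h1)

theorem lipschitzWith_graphMap {e : E} (he : ‖e‖ = 1) {φ : (ℝ ∙ e)ᗮ → ℝ} {K : ℝ≥0}
    (hφ : LipschitzWith K φ) : LipschitzWith (1 + K) (graphMap e φ) := by
  refine LipschitzWith.add (LipschitzWith.subtype_val _) ?_
  refine LipschitzWith.of_dist_le_mul fun y z => ?_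
  rw [dist_eq_norm, ← sub_smul, norm_smul, he, mul_one, ← dist_eq_norm]
  exact hφ.dist_le_mul y z

variable [FiniteDimensional ℝ E]

@[simp]
theorem proj_coe_add_smul (e : E) (y : (ℝ ∙ e)ᗮ) (t : ℝ) :
    (ℝ ∙ e)ᗮ.orthogonalProjectionOnto ((y : E) + t • e) = y := by
  have h : (ℝ ∙ e)ᗮ.orthogonalProjectionOnto (t • e) = 0 := by
    rw [Submodule.orthogonalProjectionOnto_eq_zero_iff, Submodule.orthogonal_orthogonal]
    exact Submodule.smul_mem _ _ (Submodule.mem_span_singleton_self e)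
  rw [map_add, h, add_zero, Submodule.orthogonalProjectionOnto_mem_subspace_eq_self]

theorem proj_add_inner_smul {e : E} (he : ‖e‖ = 1) (x : E) :
    ((ℝ ∙ e)ᗮ.orthogonalProjectionOnto x : E) + ⟪e, x⟫ • e = x := by
  have := Submodule.starProjection_add_starProjection_orthogonal (K := ℝ ∙ e) x
  rw [Submodule.starProjection_unit_singleton ℝ he] at this
  rw [add_comm]; exact this

/-- The linear map `y ↦ y + ℓ(y) e` whose range is the graph of the functional `ℓ`. -/
def linearGraphMap (e : E) (ℓ : (ℝ ∙ e)ᗮ →L[ℝ] ℝ) : (ℝ ∙ e)ᗮ →ₗ[ℝ] E :=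
  (ℝ ∙ e)ᗮ.subtype + (ℓ : (ℝ ∙ e)ᗮ →ₗ[ℝ] ℝ).smulRight e

theorem linearGraphMap_apply (e : E) (ℓ : (ℝ ∙ e)ᗮ →L[ℝ] ℝ) (y : (ℝ ∙ e)ᗮ) :
    linearGraphMap e ℓ y = (y : E) + ℓ y • e := rfl

/-- The area of a non-vertical hyperplane piece: since `LᵀL = 1 + ℓ ⊗ ℓ`, the determinant is given
by that of a rank-one perturbation of the identity. -/
theorem normDet_linearGraphMap {e : E} (he : ‖e‖ = 1) (ℓ : (ℝ ∙ e)ᗮ →L[ℝ] ℝ) :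
    (linearGraphMap e ℓ).normDet = √(1 + ‖ℓ‖ ^ 2) := by
  have hsq : (linearGraphMap e ℓ).normDet ^ 2 = 1 + ‖ℓ‖ ^ 2 := by
    have h := (linearGraphMap e ℓ).normDet_sq
    set g := (InnerProductSpace.toDual ℝ (ℝ ∙ e)ᗮ).symm ℓ with hg
    have hℓ : ∀ y, ⟪g, y⟫ = ℓ y := fun y => InnerProductSpace.toDual_symm_apply
    have hadj : (linearGraphMap e ℓ).adjoint ∘ₗ linearGraphMap e ℓ =
        LinearMap.transvection (ℓ : (ℝ ∙ e)ᗮ →ₗ[ℝ] ℝ) g := by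
      ext1 y
      refine ext_inner_right ℝ fun z => ?_
      rw [LinearMap.comp_apply, LinearMap.adjoint_inner_left, linearGraphMap_apply,
        linearGraphMap_apply, LinearMap.transvection.apply, inner_add_left, inner_add_left,
        inner_add_right, inner_add_right, inner_smul_left, inner_smul_left, inner_smul_right,
        inner_smul_right, inner_coe_orthogonal_eq_zero, real_inner_comm e (y : E),
        inner_coe_orthogonal_eq_zero, real_inner_self_eq_norm_sq, he, inner_smul_left, hℓ]
      simp
    rw [hadj, LinearMap.transvection.det] at h
    have hng : ℓ g = ‖ℓ‖ ^ 2 := by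
      rw [← hℓ, real_inner_self_eq_norm_sq, hg, LinearIsometryEquiv.norm_map]
    simpa [hng] using h
  rw [← hsq, Real.sqrt_sq (LinearMap.normDet_nonneg _)]

/-- The area factor `√(1 + |∇φ|²)` of the graph of `φ`. -/
def areaFactor {e : E} (φ : (ℝ ∙ e)ᗮ → ℝ) (y : (ℝ ∙ e)ᗮ) : ℝ := √(1 + ‖fderiv ℝ φ y‖ ^ 2)

theorem areaFactor_pos {e : E} (φ : (ℝ ∙ e)ᗮ → ℝ) (y : (ℝ ∙ e)ᗮ) : 0 < areaFactor φ y :=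
  Real.sqrt_pos.2 (by positivity)

theorem sqrt_one_add_sq_le {a b δ : ℝ} (ha : 0 ≤ a) (hb : 0 ≤ b) (hδ : 0 ≤ δ) (h : a ≤ b + δ) :
    √(1 + a ^ 2) ≤ (1 + δ) * √(1 + b ^ 2) := by
  have hb1 : b ≤ √(1 + b ^ 2) := Real.le_sqrt_of_sq_le (by linarith)
  have h1 : 1 ≤ √(1 + b ^ 2) := Real.one_le_sqrt.2 (by nlinarith [sq_nonneg b])
  have h2 : √(1 + b ^ 2) ^ 2 = 1 + b ^ 2 := Real.sq_sqrt (by positivity)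
  refine Real.sqrt_le_iff.2 ⟨by positivity, ?_⟩
  calc 1 + a ^ 2 ≤ 1 + (b + δ) ^ 2 := by gcongr
    _ = (1 + b ^ 2) + 2 * δ * b + δ ^ 2 := by ring
    _ ≤ √(1 + b ^ 2) ^ 2 + 2 * δ * √(1 + b ^ 2) ^ 2 + δ ^ 2 * √(1 + b ^ 2) ^ 2 := by
      gcongr
      · exact h2.ge
      · nlinarith
      · nlinarith [sq_nonneg δ]
    _ = _ := by ring

variable [MeasurableSpace E] [BorelSpace E]

/-- A map that expands distances at most `K` times as much as another one does, has at most
`K ^ n` times as large `n`-dimensional images. -/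
theorem euclideanHausdorffMeasure_image_le_of_norm_sub_le {H : Type*} {F G : H → E} {A : Set H}
    {K : ℝ≥0} (n : ℕ)
    (h : ∀ y ∈ A, ∀ z ∈ A, ‖F y - F z‖ ≤ K * ‖G y - G z‖) :
    (μHE[n] : Measure E) (F '' A) ≤ (K : ℝ≥0∞) ^ n * μHE[n] (G '' A) := by
  rcases A.eq_empty_or_nonempty with rfl | ⟨a, ha⟩
  · simp
  have : Nonempty H := ⟨a⟩
  have hinv : ∀ y ∈ A, Function.invFunOn G A (G y) ∈ A ∧ G (Function.invFunOn G A (G y)) = G y :=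
    fun y hy => ⟨Function.invFunOn_mem ⟨y, hy, rfl⟩, Function.invFunOn_eq ⟨y, hy, rfl⟩⟩
  have hL : LipschitzOnWith K (F ∘ Function.invFunOn G A) (G '' A) := by
    refine LipschitzOnWith.of_dist_le_mul ?_
    rintro _ ⟨y, hy, rfl⟩ _ ⟨z, hz, rfl⟩
    rw [dist_eq_norm, dist_eq_norm]
    have := h _ (hinv y hy).1 _ (hinv z hz).1
    rwa [(hinv y hy).2, (hinv z hz).2] at this
  have himg : (F ∘ Function.invFunOn G A) '' (G '' A) = F '' A := by
    rw [image_image]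
    refine image_congr fun y hy => ?_
    have h1 := h _ (hinv y hy).1 y hy
    rw [(hinv y hy).2, sub_self, norm_zero, mul_zero] at h1
    exact sub_eq_zero.1 (norm_le_zero_iff.1 h1)
  have h2 := hL.hausdorffMeasure_image_le (d := (n : ℝ)) (by positivity)
  rw [himg, ENNReal.rpow_natCast] at h2
  simp_rw [Measure.euclideanHausdorffMeasure_def, Measure.smul_apply, ENNReal.smul_def,
    smul_eq_mul]
  rw [mul_left_comm]
  gcongr

theorem graphMap_continuous {e : E} (he : ‖e‖ = 1) {φ : (ℝ ∙ e)ᗮ → ℝ} {K : ℝ≥0}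
    (hφ : LipschitzWith K φ) : Continuous (graphMap e φ) := (lipschitzWith_graphMap he hφ).continuous

theorem graphMap_measurableEmbedding {e : E} (he : ‖e‖ = 1) {φ : (ℝ ∙ e)ᗮ → ℝ} {K : ℝ≥0}
    (hφ : LipschitzWith K φ) : MeasurableEmbedding (graphMap e φ) :=
  (graphMap_continuous he hφ).measurableEmbedding (graphMap_injective he φ)

/-- On a set where `φ` is uniformly close to a linear functional, the area of the graph is close to
the area of a piece of a hyperplane. -/
theorem euclideanHausdorffMeasure_graphMap_image_of_approximatesLinearOn {e : E} (he : ‖e‖ = 1)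
    {φ : (ℝ ∙ e)ᗮ → ℝ} {ℓ : (ℝ ∙ e)ᗮ →L[ℝ] ℝ} {A : Set (ℝ ∙ e)ᗮ} {δ : ℝ≥0}
    (h : ApproximatesLinearOn φ ℓ A δ) :
    (μHE[finrank ℝ (ℝ ∙ e)ᗮ] : Measure E) (graphMap e φ '' A) ≤
        (1 + δ : ℝ≥0∞) ^ finrank ℝ (ℝ ∙ e)ᗮ * (ENNReal.ofReal √(1 + ‖ℓ‖ ^ 2) * volume A) ∧
      ENNReal.ofReal √(1 + ‖ℓ‖ ^ 2) * volume A ≤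
        (1 + δ : ℝ≥0∞) ^ finrank ℝ (ℝ ∙ e)ᗮ *
          (μHE[finrank ℝ (ℝ ∙ e)ᗮ] : Measure E) (graphMap e φ '' A) := by
  have hdiff : ∀ y ∈ A, ∀ z ∈ A, ‖(graphMap e φ y - graphMap e φ z) -
      (linearGraphMap e ℓ y - linearGraphMap e ℓ z)‖ ≤ δ * ‖y - z‖ := by
    intro y hy z hz
    have : (graphMap e φ y - graphMap e φ z) - (linearGraphMap e ℓ y - linearGraphMap e ℓ z) =
        (φ y - φ z - ℓ (y - z)) • e := by
      rw [graphMap_sub, ← map_sub, linearGraphMap_apply, sub_smul (φ y - φ z)]; abel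
    rw [this, norm_smul, he, mul_one]
    exact h y hy z hz
  have hG : ∀ y z, ‖y - z‖ ≤ ‖graphMap e φ y - graphMap e φ z‖ := fun y z => by
    rw [graphMap_sub]; exact norm_le_norm_coe_add_smul he _ _
  have hL : ∀ y z, ‖y - z‖ ≤ ‖linearGraphMap e ℓ y - linearGraphMap e ℓ z‖ := fun y z => by
    rw [← map_sub, linearGraphMap_apply]; exact norm_le_norm_coe_add_smul he _ _
  have hvol : (μHE[finrank ℝ (ℝ ∙ e)ᗮ] : Measure E) (linearGraphMap e ℓ '' A) =
      ENNReal.ofReal √(1 + ‖ℓ‖ ^ 2) * volume A := by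
    rw [LinearMap.euclideanHausdorffMeasure_image_eq_normDet_mul_volume,
      normDet_linearGraphMap he]
  have hK : ((1 + δ : ℝ≥0) : ℝ≥0∞) = 1 + δ := by simp
  rw [← hvol, ← hK]
  constructor
  · refine euclideanHausdorffMeasure_image_le_of_norm_sub_le _ fun y hy z hz => ?_
    have h1 := norm_sub_norm_le (graphMap e φ y - graphMap e φ z)
      (linearGraphMap e ℓ y - linearGraphMap e ℓ z)
    have h2 := mul_le_mul_of_nonneg_left (hL y z) δ.2
    have h3 := hdiff y hy z hz
    push_cast
    simp only [NNReal.val_eq_coe] at h2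
    linarith
  · refine euclideanHausdorffMeasure_image_le_of_norm_sub_le _ fun y hy z hz => ?_
    have h1 := norm_sub_norm_le (linearGraphMap e ℓ y - linearGraphMap e ℓ z)
      (graphMap e φ y - graphMap e φ z)
    have h2 := mul_le_mul_of_nonneg_left (hG y z) δ.2
    have h3 := hdiff y hy z hz
    rw [norm_sub_rev] at h3
    push_cast
    simp only [NNReal.val_eq_coe] at h2
    linarith

/-- If a function is close to a linear functional on a set, then so are its derivatives, almost
everywhere on this set. -/
theorem ae_norm_fderiv_sub_le_of_approximatesLinearOn {H : Type*} [NormedAddCommGroup H]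
    [InnerProductSpace ℝ H] [FiniteDimensional ℝ H] [MeasurableSpace H] [BorelSpace H]
    {φ : H → ℝ} {ℓ : H →L[ℝ] ℝ} {A : Set H} {δ : ℝ≥0}
    (h : ApproximatesLinearOn φ ℓ A δ) (hA : MeasurableSet A)
    (hd : ∀ y ∈ A, DifferentiableAt ℝ φ y) :
    ∀ᵐ y ∂(volume.restrict A), ‖fderiv ℝ φ y - ℓ‖ ≤ δ := by
  rcases subsingleton_or_nontrivial H with hH | hH
  · refine Eventually.of_forall fun y => ?_
    have : fderiv ℝ φ y - ℓ = 0 := by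
      ext z; rw [Subsingleton.elim z 0]; simp
    rw [this, norm_zero]; exact δ.2
  -- `φ` is made vector valued, as Mathlib's lemma concerns maps from a space to itself.
  obtain ⟨u, hu⟩ := exists_norm_eq H (zero_le_one' ℝ)
  have happ : ApproximatesLinearOn (fun y => φ y • u) (ℓ.smulRight u) A δ := by
    intro y hy z hz
    have : φ y • u - φ z • u - (ℓ.smulRight u) (y - z) = (φ y - φ z - ℓ (y - z)) • u := by
      simp [sub_smul]
    rw [this, norm_smul, hu, mul_one]
    exact h y hy z hz
  have := happ.norm_fderiv_sub_le volume hA (fun y => (fderiv ℝ φ y).smulRight u)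
    fun y hy => ((hd y hy).hasFDerivAt.smul_const u).hasFDerivWithinAt
  filter_upwards [this] with y hy
  have hs : (fderiv ℝ φ y).smulRight u - ℓ.smulRight u = (fderiv ℝ φ y - ℓ).smulRight u := by
    ext z; simp [sub_smul]
  rw [hs] at hy
  have hn : ‖(fderiv ℝ φ y - ℓ).smulRight u‖ = ‖fderiv ℝ φ y - ℓ‖ := by
    rw [ContinuousLinearMap.norm_smulRight_apply, hu, mul_one]
  rw [← hn]
  exact_mod_cast hy

theorem areaFactor_measurable {e : E} (φ : (ℝ ∙ e)ᗮ → ℝ) : Measurable (areaFactor φ) := by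
  unfold areaFactor
  exact (((measurable_fderiv ℝ φ).norm.pow_const 2).const_add 1).sqrt

/-- The area formula up to the factor `(1 + δ) ^ (n + 1)`: the set is partitioned into countably many
pieces on which `φ` is `δ`-close to a linear functional. One factor comes from the area factor, the
others from the distances on the graph. -/
theorem lintegral_areaFactor_close {e : E} (he : ‖e‖ = 1)
    {φ : (ℝ ∙ e)ᗮ → ℝ} {K : ℝ≥0} (hφ : LipschitzWith K φ) {s : Set (ℝ ∙ e)ᗮ}
    (hs : MeasurableSet s) (hd : ∀ y ∈ s, DifferentiableAt ℝ φ y) {δ : ℝ≥0} (hδ : δ ≠ 0) :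
    (μHE[finrank ℝ (ℝ ∙ e)ᗮ] : Measure E) (graphMap e φ '' s) ≤
        (1 + δ : ℝ≥0∞) ^ (finrank ℝ (ℝ ∙ e)ᗮ + 1) *
          ∫⁻ y in s, ENNReal.ofReal (areaFactor φ y) ∧
      ∫⁻ y in s, ENNReal.ofReal (areaFactor φ y) ≤
        (1 + δ : ℝ≥0∞) ^ (finrank ℝ (ℝ ∙ e)ᗮ + 1) *
          (μHE[finrank ℝ (ℝ ∙ e)ᗮ] : Measure E) (graphMap e φ '' s) := by
  obtain ⟨t, A, hdisj, hmeas, hcov, happ, -⟩ :=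
    exists_partition_approximatesLinearOn_of_hasFDerivWithinAt φ s (fderiv ℝ φ)
      (fun y hy => (hd y hy).hasFDerivAt.hasFDerivWithinAt) (fun _ => δ) (fun _ => hδ)
  have hunion : s = ⋃ n, s ∩ t n := by rw [← inter_iUnion]; exact (inter_eq_left.2 hcov).symm
  have hm : ∀ n, MeasurableSet (s ∩ t n) := fun n => hs.inter (hmeas n)
  have hdisj' : Pairwise (Function.onFun Disjoint fun n => s ∩ t n) := fun i j hij =>
    (hdisj hij).mono inter_subset_right inter_subset_right
  have hinj := graphMap_injective he φ
  have hμ : (μHE[finrank ℝ (ℝ ∙ e)ᗮ] : Measure E) (graphMap e φ '' s) =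
      ∑' n, (μHE[finrank ℝ (ℝ ∙ e)ᗮ] : Measure E) (graphMap e φ '' (s ∩ t n)) := by
    conv_lhs => rw [hunion, image_iUnion]
    refine measure_iUnion (fun i j hij => ?_) fun n =>
      (graphMap_measurableEmbedding he hφ).measurableSet_image.2 (hm n)
    exact (disjoint_image_iff hinj).2 (hdisj' hij)
  have hI : ∫⁻ y in s, ENNReal.ofReal (areaFactor φ y) =
      ∑' n, ∫⁻ y in s ∩ t n, ENNReal.ofReal (areaFactor φ y) := by
    conv_lhs => rw [hunion]
    exact lintegral_iUnion hm hdisj' _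
  have hae : ∀ n, ∀ᵐ y ∂(volume.restrict (s ∩ t n)), ‖fderiv ℝ φ y - A n‖ ≤ δ := fun n =>
    ae_norm_fderiv_sub_le_of_approximatesLinearOn (happ n) (hm n) fun y hy => hd y hy.1
  have hK : (1 + δ : ℝ≥0∞) = ENNReal.ofReal (1 + δ) := by
    rw [ENNReal.ofReal_add zero_le_one δ.coe_nonneg, ENNReal.ofReal_one, ENNReal.ofReal_coe_nnreal]
  have h1 : ∀ n, ENNReal.ofReal √(1 + ‖A n‖ ^ 2) * volume (s ∩ t n) ≤
      (1 + δ : ℝ≥0∞) * ∫⁻ y in s ∩ t n, ENNReal.ofReal (areaFactor φ y) := by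
    intro n
    rw [← lintegral_const_mul' _ _ (by simp), ← setLIntegral_const]
    refine lintegral_mono_ae ?_
    filter_upwards [hae n] with y hy
    rw [hK, ← ENNReal.ofReal_mul (by positivity)]
    refine ENNReal.ofReal_le_ofReal (sqrt_one_add_sq_le (norm_nonneg (_ : (ℝ ∙ e)ᗮ →L[ℝ] ℝ))
      (norm_nonneg (_ : (ℝ ∙ e)ᗮ →L[ℝ] ℝ)) δ.2 ?_)
    have := norm_sub_norm_le (A n) (fderiv ℝ φ y)
    rw [norm_sub_rev] at this
    change _ ≤ _ + (δ : ℝ)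
    linarith
  have h2 : ∀ n, ∫⁻ y in s ∩ t n, ENNReal.ofReal (areaFactor φ y) ≤
      (1 + δ : ℝ≥0∞) * (ENNReal.ofReal √(1 + ‖A n‖ ^ 2) * volume (s ∩ t n)) := by
    intro n
    rw [← mul_assoc, hK, ← ENNReal.ofReal_mul (by positivity), ← setLIntegral_const]
    refine lintegral_mono_ae ?_
    filter_upwards [hae n] with y hy
    refine ENNReal.ofReal_le_ofReal (sqrt_one_add_sq_le (norm_nonneg (_ : (ℝ ∙ e)ᗮ →L[ℝ] ℝ))
      (norm_nonneg (_ : (ℝ ∙ e)ᗮ →L[ℝ] ℝ)) δ.2 ?_)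
    have := norm_sub_norm_le (fderiv ℝ φ y) (A n)
    change _ ≤ _ + (δ : ℝ)
    linarith
  have h3 := fun n =>
    euclideanHausdorffMeasure_graphMap_image_of_approximatesLinearOn he (happ n)
  rw [hμ, hI, ← ENNReal.tsum_mul_left, ← ENNReal.tsum_mul_left]
  constructor
  · refine ENNReal.tsum_le_tsum fun n => (h3 n).1.trans ?_
    rw [pow_succ (1 + δ : ℝ≥0∞), mul_assoc]
    exact mul_le_mul_right (h1 n) _
  · refine ENNReal.tsum_le_tsum fun n => (h2 n).trans ?_
    rw [pow_succ (1 + δ : ℝ≥0∞), mul_comm (_ ^ _) (1 + δ : ℝ≥0∞), mul_assoc]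
    exact mul_le_mul_right (h3 n).2 _

theorem ennreal_le_of_forall_one_add_pow_mul {a b : ℝ≥0∞} (n : ℕ)
    (h : ∀ δ : ℝ≥0, δ ≠ 0 → a ≤ (1 + δ : ℝ≥0∞) ^ n * b) : a ≤ b := by
  have h1 : Tendsto (fun δ : ℝ≥0 => (1 + δ : ℝ≥0∞) ^ n) (𝓝[≠] 0) (𝓝 1) := by
    have : Continuous (fun δ : ℝ≥0 => (1 + δ : ℝ≥0∞) ^ n) := by fun_prop
    simpa using (this.tendsto 0).mono_left nhdsWithin_le_nhds
  have h2 := ENNReal.Tendsto.mul_const (b := b) h1 (Or.inl one_ne_zero)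
  rw [one_mul] at h2
  exact ge_of_tendsto h2 (eventually_nhdsWithin_of_forall fun δ hδ => h δ hδ)

theorem euclideanHausdorffMeasure_graphMap_image_null {e : E} (he : ‖e‖ = 1)
    {φ : (ℝ ∙ e)ᗮ → ℝ} {K : ℝ≥0} (hφ : LipschitzWith K φ) {s : Set (ℝ ∙ e)ᗮ}
    (hs : volume s = 0) : (μHE[finrank ℝ (ℝ ∙ e)ᗮ] : Measure E) (graphMap e φ '' s) = 0 := by
  have h1 := (lipschitzWith_graphMap he hφ).hausdorffMeasure_image_le
    (d := (finrank ℝ (ℝ ∙ e)ᗮ : ℝ)) (by positivity) s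
  have h2 : (μHE[finrank ℝ (ℝ ∙ e)ᗮ] : Measure (ℝ ∙ e)ᗮ) s = 0 := by
    rw [InnerProductSpace.euclideanHausdorffMeasure_eq_volume, hs]
  rw [Measure.euclideanHausdorffMeasure_def, Measure.smul_apply, ENNReal.smul_def, smul_eq_mul,
    mul_eq_zero] at h2 ⊢
  rcases h2 with h2 | h2
  · exact Or.inl h2
  · rw [h2, mul_zero] at h1
    exact Or.inr (le_antisymm h1 zero_le)

/-- **Area formula for Lipschitz graphs.** -/
theorem euclideanHausdorffMeasure_graphMap_image {e : E} (he : ‖e‖ = 1)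
    {φ : (ℝ ∙ e)ᗮ → ℝ} {K : ℝ≥0} (hφ : LipschitzWith K φ) {s : Set (ℝ ∙ e)ᗮ}
    (hs : MeasurableSet s) :
    (μHE[finrank ℝ (ℝ ∙ e)ᗮ] : Measure E) (graphMap e φ '' s) =
      ∫⁻ y in s, ENNReal.ofReal (areaFactor φ y) := by
  -- By Rademacher's theorem, only the points of differentiability matter.
  have hmeas : MeasurableSet {y | DifferentiableAt ℝ φ y} := measurableSet_of_differentiableAt ℝ φ
  have hae : ∀ᵐ y, y ∈ {y | DifferentiableAt ℝ φ y} := hφ.ae_differentiableAt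
  have hnull : volume (s \ {y | DifferentiableAt ℝ φ y}) = 0 :=
    measure_mono_null (fun y hy => hy.2) hae
  have hc := fun δ hδ => lintegral_areaFactor_close he hφ (hs.inter hmeas) (fun y hy => hy.2)
    (δ := δ) hδ
  have heq : (μHE[finrank ℝ (ℝ ∙ e)ᗮ] : Measure E)
      (graphMap e φ '' (s ∩ {y | DifferentiableAt ℝ φ y})) =
      ∫⁻ y in s ∩ {y | DifferentiableAt ℝ φ y}, ENNReal.ofReal (areaFactor φ y) :=
    le_antisymm (ennreal_le_of_forall_one_add_pow_mul _ fun δ hδ => (hc δ hδ).1)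
      (ennreal_le_of_forall_one_add_pow_mul _ fun δ hδ => (hc δ hδ).2)
  have hI : ∫⁻ y in s ∩ {y | DifferentiableAt ℝ φ y}, ENNReal.ofReal (areaFactor φ y) =
      ∫⁻ y in s, ENNReal.ofReal (areaFactor φ y) :=
    setLIntegral_congr (inter_ae_eq_left_of_ae_eq_univ (eventuallyEq_univ.2 hae))
  rw [← hI, ← heq]
  refine le_antisymm ?_ (measure_mono (image_mono inter_subset_left))
  conv_lhs => rw [← inter_union_sdiff s {y | DifferentiableAt ℝ φ y}, image_union]
  refine (measure_union_le _ _).trans ?_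
  rw [euclideanHausdorffMeasure_graphMap_image_null he hφ hnull, add_zero]

/-- The surface measure on a Lipschitz graph, as the image of a measure on the hyperplane. -/
theorem euclideanHausdorffMeasure_restrict_range_graphMap {e : E} (he : ‖e‖ = 1)
    {φ : (ℝ ∙ e)ᗮ → ℝ} {K : ℝ≥0} (hφ : LipschitzWith K φ) :
    (μHE[finrank ℝ (ℝ ∙ e)ᗮ] : Measure E).restrict (range (graphMap e φ)) =
      (volume.withDensity fun y => ENNReal.ofReal (areaFactor φ y)).map (graphMap e φ) := by
  ext T hT
  have hm := (graphMap_continuous he hφ).measurable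
  rw [Measure.restrict_apply hT, Measure.map_apply hm hT, withDensity_apply _ (hm hT),
    ← euclideanHausdorffMeasure_graphMap_image he hφ (hm hT), image_preimage_eq_inter_range]

end Graph

/-! ### The divergence theorem below a Lipschitz graph -/

section Subgraph

open scoped ENNReal
open Module (finrank)

variable {E : Type*} [NormedAddCommGroup E] [InnerProductSpace ℝ E] [FiniteDimensional ℝ E]

/-- The region below the graph of `φ`, in the direction `e`. -/
def subgraph (e : E) (φ : (ℝ ∙ e)ᗮ → ℝ) : Set E :=
  {x | ⟪e, x⟫ < φ ((ℝ ∙ e)ᗮ.orthogonalProjectionOnto x)}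

/-- Coordinates in which the region below the graph of `φ` is the half-space `τ < 0`. -/
def graphCoord (e : E) (φ : (ℝ ∙ e)ᗮ → ℝ) (z : (ℝ ∙ e)ᗮ × ℝ) : E :=
  (z.1 : E) + (z.2 + φ z.1) • e

theorem graphCoord_mem_subgraph {e : E} (he : ‖e‖ = 1) (φ : (ℝ ∙ e)ᗮ → ℝ) (z : (ℝ ∙ e)ᗮ × ℝ) :
    graphCoord e φ z ∈ subgraph e φ ↔ z.2 < 0 := by
  rw [subgraph, mem_ofPred_eq, graphCoord, proj_coe_add_smul, inner_add_right,
    inner_coe_orthogonal_eq_zero, inner_smul_right, real_inner_self_eq_norm_sq, he]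
  constructor <;> intro h <;> linarith

theorem graphCoord_injective {e : E} (he : ‖e‖ = 1) (φ : (ℝ ∙ e)ᗮ → ℝ) :
    Function.Injective (graphCoord e φ) := by
  rintro ⟨y, s⟩ ⟨z, t⟩ h
  have h1 : y = z := by
    have := congrArg (ℝ ∙ e)ᗮ.orthogonalProjectionOnto h
    simpa [graphCoord] using this
  subst h1
  have he0 : e ≠ 0 := by rintro rfl; simp at he
  have h2 : (s + φ y) • e = (t + φ y) • e := add_left_cancel h
  have h3 := smul_left_injective ℝ he0 h2
  have : s = t := by linarith
  rw [this]

theorem graphCoord_continuous {e : E} {φ : (ℝ ∙ e)ᗮ → ℝ} (hφ : Continuous φ) :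
    Continuous (graphCoord e φ) := by
  unfold graphCoord; fun_prop

variable [MeasurableSpace E] [BorelSpace E]

theorem measurePreserving_coe_add_smul {e : E} (he : ‖e‖ = 1) :
    MeasurePreserving (fun z : (ℝ ∙ e)ᗮ × ℝ => (z.1 : E) + z.2 • e) := by
  have h1 := ((ℝ ∙ e).measurePreserving_measurableEquivProd (0 : E)).symm
  rw [InnerProductSpace.euclideanHausdorffMeasure_eq_volume] at h1
  have h2 := (LinearIsometryEquiv.toSpanUnitSingleton (𝕜 := ℝ) e he).measurePreserving
  have h3 := h2.prod (MeasurePreserving.id (volume : Measure (ℝ ∙ e)ᗮ))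
  have h4 := h1.comp (h3.comp Measure.measurePreserving_swap)
  have hfun : (fun z : (ℝ ∙ e)ᗮ × ℝ => (z.1 : E) + z.2 • e) =
      ((ℝ ∙ e).measurableEquivProd (0 : E)).symm ∘
        Prod.map (LinearIsometryEquiv.toSpanUnitSingleton (𝕜 := ℝ) e he) id ∘ Prod.swap := by
    ext z
    simp [add_comm]
  rw [hfun]
  exact h4

theorem graphCoord_measurePreserving {e : E} (he : ‖e‖ = 1) {φ : (ℝ ∙ e)ᗮ → ℝ}
    (hφ : Continuous φ) : MeasurePreserving (graphCoord e φ) := by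
  have hsk : MeasurePreserving (fun z : (ℝ ∙ e)ᗮ × ℝ => (z.1, z.2 + φ z.1))
      (volume.prod volume) (volume.prod volume) :=
    (MeasurePreserving.id (volume : Measure (ℝ ∙ e)ᗮ)).skew_product
      (g := fun y t => t + φ y) (by have := hφ.measurable; fun_prop)
      (Eventually.of_forall fun y => (measurePreserving_add_right volume (φ y)).map_eq)
  exact (measurePreserving_coe_add_smul he).comp hsk

theorem graphCoord_measurableEmbedding {e : E} (he : ‖e‖ = 1) {φ : (ℝ ∙ e)ᗮ → ℝ}
    (hφ : Continuous φ) : MeasurableEmbedding (graphCoord e φ) :=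
  (graphCoord_continuous hφ).measurableEmbedding (graphCoord_injective he φ)

/-- Integration over the region below a graph, in the volume-preserving coordinates that flatten
it. -/
theorem setIntegral_subgraph {e : E} (he : ‖e‖ = 1) {φ : (ℝ ∙ e)ᗮ → ℝ} (hφ : Continuous φ)
    (f : E → ℝ) :
    ∫ x in subgraph e φ, f x =
      ∫ z, f (graphCoord e φ z) ∂((volume : Measure (ℝ ∙ e)ᗮ).prod (volume.restrict (Iio 0))) := by
  rw [← (graphCoord_measurePreserving he hφ).setIntegral_preimage_emb
    (graphCoord_measurableEmbedding he hφ)]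
  have : graphCoord e φ ⁻¹' subgraph e φ = univ ×ˢ Iio 0 := by
    ext z; simp [graphCoord_mem_subgraph he]
  rw [this, Measure.volume_eq_prod, ← Measure.prod_restrict, Measure.restrict_univ]

theorem integrable_comp_graphCoord {e : E} (he : ‖e‖ = 1) {φ : (ℝ ∙ e)ᗮ → ℝ} (hφ : Continuous φ)
    {f : E → ℝ} (hf : Integrable f) :
    Integrable (fun z => f (graphCoord e φ z))
      ((volume : Measure (ℝ ∙ e)ᗮ).prod (volume.restrict (Iio 0))) := by
  have h1 := ((graphCoord_measurePreserving he hφ).integrable_comp_emb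
    (graphCoord_measurableEmbedding he hφ)).2 hf
  have h2 := h1.restrict (s := univ ×ˢ Iio 0)
  rwa [Measure.volume_eq_prod, ← Measure.prod_restrict, Measure.restrict_univ] at h2

/-- Vertical derivatives: the fundamental theorem of calculus on the half-line below a point of the
graph. -/
theorem integral_vertical_fderiv {e : E} (he : ‖e‖ = 1) (φ : (ℝ ∙ e)ᗮ → ℝ) {ψ : E → ℝ}
    (hψ : ContDiff ℝ 1 ψ) (hc : HasCompactSupport ψ) (y : (ℝ ∙ e)ᗮ) :
    ∫ τ in Iio 0, fderiv ℝ ψ (graphCoord e φ (y, τ)) e = ψ (graphMap e φ y) := by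
  have he0 : e ≠ 0 := by rintro rfl; simp at he
  have hline : ∀ τ : ℝ, HasDerivAt (fun τ : ℝ => graphCoord e φ (y, τ)) e τ := by
    intro τ
    unfold graphCoord
    simpa using (((hasDerivAt_id τ).add_const (φ y)).smul_const e).const_add (y : E)
  have hsm : ContDiff ℝ 1 fun τ : ℝ => graphCoord e φ (y, τ) := by
    change ContDiff ℝ 1 fun τ : ℝ => (y : E) + (τ + φ y) • e
    exact contDiff_const.add
      (ContDiff.smul (f := fun τ : ℝ => τ + φ y) (contDiff_id.add contDiff_const) contDiff_const)
  have hanti : AntilipschitzWith 1 fun τ : ℝ => graphCoord e φ (y, τ) := by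
    refine AntilipschitzWith.of_le_mul_dist fun s t => ?_
    rw [dist_eq_norm, dist_eq_norm]
    have : graphCoord e φ (y, s) - graphCoord e φ (y, t) = (s - t) • e := by
      simp only [graphCoord, add_smul, sub_smul]; abel
    rw [this, norm_smul, he]; simp
  have hlip : UniformContinuous fun τ : ℝ => graphCoord e φ (y, τ) := by
    refine (LipschitzWith.of_dist_le_mul (K := 1) fun s t => ?_).uniformContinuous
    rw [dist_eq_norm, dist_eq_norm]
    have : graphCoord e φ (y, s) - graphCoord e φ (y, t) = (s - t) • e := by
      simp only [graphCoord, add_smul, sub_smul]; abel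
    rw [this, norm_smul, he]; simp
  have h := HasCompactSupport.integral_Iic_deriv_eq (hψ.comp hsm)
    (hc.comp_isClosedEmbedding (hanti.isClosedEmbedding hlip)) 0
  rw [integral_Iic_eq_integral_Iio] at h
  have hd : ∀ τ, deriv (ψ ∘ fun τ : ℝ => graphCoord e φ (y, τ)) τ =
      fderiv ℝ ψ (graphCoord e φ (y, τ)) e := fun τ =>
    ((hψ.differentiable one_ne_zero _).hasFDerivAt.comp_hasDerivAt τ (hline τ)).deriv
  simp only [hd] at h
  rw [h]
  simp [graphCoord, graphMap]

theorem integral_lineDeriv_eq_zero {H : Type*} [NormedAddCommGroup H] [InnerProductSpace ℝ H]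
    [FiniteDimensional ℝ H] [MeasurableSpace H] [BorelSpace H] {g : H → ℝ} {K : ℝ≥0}
    (hg : LipschitzWith K g) (hc : HasCompactSupport g) (v : H) : ∫ y, lineDeriv ℝ g y v = 0 := by
  have h := LipschitzWith.integral_lineDeriv_mul_eq (μ := volume)
    (LipschitzWith.const (α := H) (1 : ℝ)) hg hc (-v)
  simp only [neg_neg, mul_one] at h
  rw [← h]
  have : ∀ y, lineDeriv ℝ (fun _ : H => (1 : ℝ)) y (-v) = 0 := fun y => by
    simp [lineDeriv]
  simp [this]

theorem integrable_fderiv_apply {ψ : E → ℝ} (hψ : ContDiff ℝ 1 ψ) (hc : HasCompactSupport ψ)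
    (v : E) : Integrable fun x => fderiv ℝ ψ x v :=
  Continuous.integrable_of_hasCompactSupport
    ((hψ.continuous_fderiv one_ne_zero).clm_apply continuous_const) (hc.fderiv_apply (𝕜 := ℝ) v)

/-- Horizontal derivatives: their integral over a translate of the graph is computed from the
integral of the derivative of a compactly supported Lipschitz function, which vanishes. -/
theorem integral_horizontal_fderiv {e : E} (he : ‖e‖ = 1) {φ : (ℝ ∙ e)ᗮ → ℝ} {K : ℝ≥0}
    (hφ : LipschitzWith K φ) {ψ : E → ℝ} (hψ : ContDiff ℝ 1 ψ) (hc : HasCompactSupport ψ)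
    (v : (ℝ ∙ e)ᗮ) (τ : ℝ)
    (h1 : Integrable fun y => fderiv ℝ ψ (graphCoord e φ (y, τ)) (v : E))
    (h2 : Integrable fun y => fderiv ℝ φ y v * fderiv ℝ ψ (graphCoord e φ (y, τ)) e) :
    ∫ y, fderiv ℝ ψ (graphCoord e φ (y, τ)) (v : E) =
      -∫ y, fderiv ℝ φ y v * fderiv ℝ ψ (graphCoord e φ (y, τ)) e := by
  have hG : (fun y => graphCoord e φ (y, τ)) = graphMap e (fun y => τ + φ y) := rfl
  have hφτ : LipschitzWith K fun y => τ + φ y := by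
    simpa using (LipschitzWith.const τ).add hφ
  have hGl : LipschitzWith (1 + K) fun y => graphCoord e φ (y, τ) :=
    hG ▸ lipschitzWith_graphMap he hφτ
  have hanti : AntilipschitzWith 1 fun y => graphCoord e φ (y, τ) := by
    refine AntilipschitzWith.of_le_mul_dist fun y z => ?_
    change _ ≤ _ * dist (graphMap e (fun y => τ + φ y) y) (graphMap e (fun y => τ + φ y) z)
    rw [dist_eq_norm, dist_eq_norm, graphMap_sub]
    simpa using norm_le_norm_coe_add_smul he (y - z) _
  obtain ⟨C, hC⟩ := hψ.lipschitzWith_of_hasCompactSupport hc one_ne_zero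
  have h0 := integral_lineDeriv_eq_zero (hC.comp hGl)
    (hc.comp_isClosedEmbedding (hanti.isClosedEmbedding hGl.uniformContinuous)) v
  have hd : ∀ᵐ y, lineDeriv ℝ (ψ ∘ fun y => graphCoord e φ (y, τ)) y v =
      fderiv ℝ ψ (graphCoord e φ (y, τ)) (v : E) +
        fderiv ℝ φ y v * fderiv ℝ ψ (graphCoord e φ (y, τ)) e := by
    filter_upwards [hφ.ae_differentiableAt] with y hy
    have hg : HasFDerivAt (fun y => graphCoord e φ (y, τ))
        ((ℝ ∙ e)ᗮ.subtypeL + (fderiv ℝ φ y).smulRight e) y := by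
      unfold graphCoord
      exact (ℝ ∙ e)ᗮ.subtypeL.hasFDerivAt.add ((hy.hasFDerivAt.const_add τ).smul_const e)
    have hcomp := (hψ.differentiable one_ne_zero (graphCoord e φ (y, τ))).hasFDerivAt.comp y hg
    rw [hcomp.differentiableAt.lineDeriv_eq_fderiv, hcomp.fderiv]
    simp
  rw [integral_congr_ae hd, integral_add h1 h2] at h0
  linarith

/-- The integral of a derivative over the region below a Lipschitz graph, in graph coordinates. -/
theorem setIntegral_subgraph_fderiv {e : E} (he : ‖e‖ = 1) {φ : (ℝ ∙ e)ᗮ → ℝ} {K : ℝ≥0}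
    (hφ : LipschitzWith K φ) {ψ : E → ℝ} (hψ : ContDiff ℝ 1 ψ) (hc : HasCompactSupport ψ) (v : E) :
    ∫ x in subgraph e φ, fderiv ℝ ψ x v =
      ∫ y, (⟪e, v⟫ - fderiv ℝ φ y ((ℝ ∙ e)ᗮ.orthogonalProjectionOnto v)) * ψ (graphMap e φ y) := by
  set w := (ℝ ∙ e)ᗮ.orthogonalProjectionOnto v with hw
  set ν := (volume : Measure ℝ).restrict (Iio 0) with hν
  have hφc := hφ.continuous
  have hv : ∀ x, fderiv ℝ ψ x v = fderiv ℝ ψ x (w : E) + ⟪e, v⟫ * fderiv ℝ ψ x e := by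
    intro x
    conv_lhs => rw [← proj_add_inner_smul he v, map_add, map_smul, smul_eq_mul]
  have hIw := integrable_comp_graphCoord he hφc (integrable_fderiv_apply hψ hc (w : E))
  have hIe := integrable_comp_graphCoord he hφc (integrable_fderiv_apply hψ hc e)
  have hmeas : Measurable fun y => fderiv ℝ φ y w := measurable_fderiv_apply_const ℝ φ w
  have hbd : ∀ y, ‖fderiv ℝ φ y w‖ ≤ K * ‖w‖ := fun y =>
    ((fderiv ℝ φ y).le_opNorm w).trans
      (mul_le_mul_of_nonneg_right (norm_fderiv_le_of_lipschitz ℝ hφ) (norm_nonneg _))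
  have hIφ : Integrable (fun z : (ℝ ∙ e)ᗮ × ℝ =>
      fderiv ℝ φ z.1 w * fderiv ℝ ψ (graphCoord e φ z) e) (volume.prod ν) :=
    hIe.bdd_mul (hmeas.comp measurable_fst).aestronglyMeasurable
      (Eventually.of_forall fun z => hbd z.1)
  have hA : ∫ z, fderiv ℝ ψ (graphCoord e φ z) (w : E) ∂(volume.prod ν) =
      -∫ z, fderiv ℝ φ z.1 w * fderiv ℝ ψ (graphCoord e φ z) e ∂(volume.prod ν) := by
    rw [integral_prod_symm _ hIw, integral_prod_symm _ hIφ, ← integral_neg]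
    refine integral_congr_ae ?_
    filter_upwards [hIw.prod_left_ae, hIφ.prod_left_ae] with τ h1 h2
    exact integral_horizontal_fderiv he hφ hψ hc w τ h1 h2
  rw [setIntegral_subgraph he hφc]
  simp_rw [hv]
  rw [integral_add hIw (hIe.const_mul _), hA, ← integral_neg,
    ← integral_add (f := fun z : (ℝ ∙ e)ᗮ × ℝ =>
      -(fderiv ℝ φ z.1 w * fderiv ℝ ψ (graphCoord e φ z) e)) hIφ.neg (hIe.const_mul _),
    integral_prod (fun z : (ℝ ∙ e)ᗮ × ℝ => -(fderiv ℝ φ z.1 w * fderiv ℝ ψ (graphCoord e φ z) e) +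
      ⟪e, v⟫ * fderiv ℝ ψ (graphCoord e φ z) e) (hIφ.neg.add (hIe.const_mul _))]
  refine integral_congr_ae (Eventually.of_forall fun y => ?_)
  beta_reduce
  rw [← integral_vertical_fderiv he φ hψ hc y, ← integral_const_mul]
  refine integral_congr_ae (Eventually.of_forall fun τ => ?_)
  ring

/-- The upward unit normal to the graph of `φ` over the point `y`. Where `φ` is not differentiable,
this is `e`. -/
def graphNormal (e : E) (φ : (ℝ ∙ e)ᗮ → ℝ) (y : (ℝ ∙ e)ᗮ) : E :=
  (areaFactor φ y)⁻¹ • (e - ((InnerProductSpace.toDual ℝ (ℝ ∙ e)ᗮ).symm (fderiv ℝ φ y) : E))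

theorem areaFactor_mul_inner_graphNormal (e : E) (φ : (ℝ ∙ e)ᗮ → ℝ) (y : (ℝ ∙ e)ᗮ) (v : E) :
    areaFactor φ y * ⟪graphNormal e φ y, v⟫ =
      ⟪e, v⟫ - fderiv ℝ φ y ((ℝ ∙ e)ᗮ.orthogonalProjectionOnto v) := by
  rw [graphNormal, inner_smul_left, inner_sub_left]
  have h : ⟪((InnerProductSpace.toDual ℝ (ℝ ∙ e)ᗮ).symm (fderiv ℝ φ y) : E), v⟫ =
      fderiv ℝ φ y ((ℝ ∙ e)ᗮ.orthogonalProjectionOnto v) := by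
    rw [← InnerProductSpace.toDual_symm_apply, Submodule.inner_orthogonalProjectionOnto_eq_of_mem_left]
  rw [h]
  have := (areaFactor_pos φ y).ne'
  simp
  field_simp

theorem norm_graphNormal {e : E} (he : ‖e‖ = 1) (φ : (ℝ ∙ e)ᗮ → ℝ) (y : (ℝ ∙ e)ᗮ) :
    ‖graphNormal e φ y‖ = 1 := by
  set g := (InnerProductSpace.toDual ℝ (ℝ ∙ e)ᗮ).symm (fderiv ℝ φ y) with hg
  have h1 : e - (g : E) = ((-g : (ℝ ∙ e)ᗮ) : E) + (1 : ℝ) • e := by simp; abel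
  have h2 : ‖e - (g : E)‖ = areaFactor φ y := by
    have h3 := norm_sq_coe_add_smul he (-g) 1
    rw [← h1, norm_neg, hg, LinearIsometryEquiv.norm_map] at h3
    rw [areaFactor, ← Real.sqrt_sq (norm_nonneg (e - (g : E))), h3]
    congr 1; ring
  rw [graphNormal, norm_smul, h2, norm_inv, Real.norm_of_nonneg (areaFactor_pos φ y).le,
    inv_mul_cancel₀ (areaFactor_pos φ y).ne']

theorem graphNormal_measurable (e : E) (φ : (ℝ ∙ e)ᗮ → ℝ) : Measurable (graphNormal e φ) := by
  unfold graphNormal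
  refine (areaFactor_measurable φ).inv.smul (measurable_const.sub ?_)
  exact measurable_subtype_coe.comp
    ((InnerProductSpace.toDual ℝ (ℝ ∙ e)ᗮ).symm.continuous.measurable.comp (measurable_fderiv ℝ φ))

theorem one_le_areaFactor {e : E} (φ : (ℝ ∙ e)ᗮ → ℝ) (y : (ℝ ∙ e)ᗮ) : 1 ≤ areaFactor φ y :=
  Real.one_le_sqrt.2 (by nlinarith [sq_nonneg ‖fderiv ℝ φ y‖])

theorem areaFactor_le {e : E} {φ : (ℝ ∙ e)ᗮ → ℝ} {K : ℝ≥0} (hφ : LipschitzWith K φ)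
    (y : (ℝ ∙ e)ᗮ) : areaFactor φ y ≤ √(1 + K ^ 2) := by
  unfold areaFactor
  have := norm_fderiv_le_of_lipschitz ℝ hφ (x₀ := y)
  gcongr

/-- Surface integrals over a Lipschitz graph. -/
theorem setIntegral_range_graphMap {e : E} (he : ‖e‖ = 1)
    {φ : (ℝ ∙ e)ᗮ → ℝ} {K : ℝ≥0} (hφ : LipschitzWith K φ) (f : E → ℝ) :
    ∫ x in range (graphMap e φ), f x ∂(μHE[finrank ℝ (ℝ ∙ e)ᗮ] : Measure E) =
      ∫ y, areaFactor φ y * f (graphMap e φ y) := by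
  rw [euclideanHausdorffMeasure_restrict_range_graphMap he hφ,
    (graphMap_measurableEmbedding he hφ).integral_map,
    integral_withDensity_eq_integral_toReal_smul (areaFactor_measurable φ).ennreal_ofReal
      (Eventually.of_forall fun _ => ENNReal.ofReal_lt_top)]
  refine integral_congr_ae (Eventually.of_forall fun y => ?_)
  simp only [ENNReal.toReal_ofReal (areaFactor_pos φ y).le, smul_eq_mul]

/-- **Divergence theorem below a Lipschitz graph**, for compactly supported functions. -/
theorem setIntegral_subgraph_fderiv_eq_surface {e : E} (he : ‖e‖ = 1) {φ : (ℝ ∙ e)ᗮ → ℝ} {K : ℝ≥0}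
    (hφ : LipschitzWith K φ) {ψ : E → ℝ} (hψ : ContDiff ℝ 1 ψ) (hc : HasCompactSupport ψ) (v : E) :
    ∫ x in subgraph e φ, fderiv ℝ ψ x v =
      ∫ x in range (graphMap e φ),
        ⟪graphNormal e φ ((ℝ ∙ e)ᗮ.orthogonalProjectionOnto x), v⟫ * ψ x
          ∂(μHE[finrank ℝ (ℝ ∙ e)ᗮ] : Measure E) := by
  rw [setIntegral_range_graphMap he hφ, setIntegral_subgraph_fderiv he hφ hψ hc]
  refine integral_congr_ae (Eventually.of_forall fun y => ?_)
  have : (ℝ ∙ e)ᗮ.orthogonalProjectionOnto (graphMap e φ y) = y := proj_coe_add_smul e y _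
  simp only [this]
  rw [← mul_assoc, areaFactor_mul_inner_graphNormal]

/-- To first order, a Lipschitz subgraph is a half-space at each point over which `φ` is
differentiable. -/
theorem subgraph_halfspace {e : E} (he : ‖e‖ = 1) {φ : (ℝ ∙ e)ᗮ → ℝ} {y : (ℝ ∙ e)ᗮ}
    (hy : DifferentiableAt ℝ φ y) {ε : ℝ} (hε : 0 < ε) :
    ∀ᶠ x in 𝓝 (graphMap e φ y),
      (⟪graphNormal e φ y, x - graphMap e φ y⟫ < -(ε * ‖x - graphMap e φ y‖) →
        x ∈ subgraph e φ) ∧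
      (ε * ‖x - graphMap e φ y‖ < ⟪graphNormal e φ y, x - graphMap e φ y⟫ →
        x ∉ subgraph e φ) := by
  have hproj : Tendsto (ℝ ∙ e)ᗮ.orthogonalProjectionOnto (𝓝 (graphMap e φ y)) (𝓝 y) := by
    have h := (ℝ ∙ e)ᗮ.orthogonalProjectionOnto.continuous.tendsto (graphMap e φ y)
    have h' : (ℝ ∙ e)ᗮ.orthogonalProjectionOnto (graphMap e φ y) = y := proj_coe_add_smul e y _
    rwa [h'] at h
  have hlin := hproj.eventually ((hy.hasFDerivAt.isLittleO).def hε)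
  filter_upwards [hlin] with x hx
  set w := (ℝ ∙ e)ᗮ.orthogonalProjectionOnto x with hw
  have hwy : (ℝ ∙ e)ᗮ.orthogonalProjectionOnto (x - graphMap e φ y) = w - y := by
    rw [map_sub, ← hw, graphMap, proj_coe_add_smul]
  have hle : ‖w - y‖ ≤ ‖x - graphMap e φ y‖ := by
    rw [← hwy]
    exact Submodule.norm_orthogonalProjectionOnto_apply_le _ _
  have key := areaFactor_mul_inner_graphNormal e φ y (x - graphMap e φ y)
  rw [hwy, inner_sub_right e, inner_graphMap he] at key
  have hJ := one_le_areaFactor φ y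
  have hR := (Real.norm_eq_abs _ ▸ hx).trans (mul_le_mul_of_nonneg_left hle hε.le)
  have hpos : 0 ≤ ε * ‖x - graphMap e φ y‖ := by positivity
  obtain ⟨hR1, hR2⟩ := abs_le.1 hR
  set I := ⟪graphNormal e φ y, x - graphMap e φ y⟫
  set N := ε * ‖x - graphMap e φ y‖
  simp only [subgraph, mem_ofPred_eq, ← hw]
  constructor
  · intro h; nlinarith
  · intro h; rw [not_lt]; nlinarith

end Subgraph

/-! ### The divergence theorem on Lipschitz domains -/

section LipschitzDomain

open Module (finrank)
open scoped Manifold ContDiff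

variable {d : ℕ} {U B : Set (Space d)}

theorem outwardNormal_eq {x n : Space d} (h : IsOutwardNormal U x n) : outwardNormal U x = n := by
  have hex : ∃ n, IsOutwardNormal U x n := ⟨n, h⟩
  rw [outwardNormal, dif_pos hex]
  exact hex.choose_spec.unique h

theorem norm_outwardNormal_le (U : Set (Space d)) (x : Space d) : ‖outwardNormal U x‖ ≤ 1 := by
  unfold outwardNormal
  split_ifs with h
  · exact h.choose_spec.1.le
  · simp

theorem abs_inner_outwardNormal_le (U : Set (Space d)) (x : Space d) (μ : Dir d) :
    |⟪(μ : Space d), outwardNormal U x⟫| ≤ 1 := by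
  refine (abs_real_inner_le_norm _ _).trans ?_
  have h1 : ‖(μ : Space d)‖ = 1 := by simp
  rw [h1, one_mul]
  exact norm_outwardNormal_le U x

theorem subgraph_isOpen {e : Space d} {φ : (ℝ ∙ e)ᗮ → ℝ} (hφ : Continuous φ) :
    IsOpen (subgraph e φ) := by
  unfold subgraph
  exact isOpen_lt (by fun_prop) (by fun_prop)

theorem frontier_subgraph {e : Space d} (he : ‖e‖ = 1) {φ : (ℝ ∙ e)ᗮ → ℝ} (hφ : Continuous φ) :
    frontier (subgraph e φ) = range (graphMap e φ) := by
  refine Subset.antisymm (fun x hx => ?_) ?_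
  · have h1 : ⟪e, x⟫ = φ ((ℝ ∙ e)ᗮ.orthogonalProjectionOnto x) :=
      frontier_lt_subset_eq (f := fun x : Space d => ⟪e, x⟫)
        (g := fun x => φ ((ℝ ∙ e)ᗮ.orthogonalProjectionOnto x)) (by fun_prop) (by fun_prop) hx
    exact ⟨_, by rw [graphMap, ← h1, proj_add_inner_smul he]⟩
  · rintro _ ⟨y, rfl⟩
    have h0 : graphMap e φ y = graphCoord e φ (y, 0) := by simp [graphMap, graphCoord]
    rw [(subgraph_isOpen hφ).frontier_eq, h0]
    refine ⟨?_, fun h => lt_irrefl _ ((graphCoord_mem_subgraph he φ _).1 h)⟩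
    have hc : Continuous fun τ : ℝ => graphCoord e φ (y, τ) :=
      (graphCoord_continuous hφ).comp (by fun_prop)
    refine mem_closure_of_tendsto ((hc.tendsto 0).mono_left (nhdsWithin_le_nhds (s := Iio 0))) ?_
    filter_upwards [self_mem_nhdsWithin] with τ hτ
    exact (graphCoord_mem_subgraph he φ _).2 hτ

/-- On the bounded open set `B`, the set `U` is the region below the graph of the Lipschitz
function `φ` over the hyperplane orthogonal to `e`. -/
structure IsGraphChart (U B : Set (Space d)) (e : Space d) (φ : (ℝ ∙ e)ᗮ → ℝ) (K : ℝ≥0) : Prop where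
  norm_eq : ‖e‖ = 1
  lipschitz : LipschitzWith K φ
  isOpen : IsOpen B
  isBounded : Bornology.IsBounded B
  mem_iff : ∀ y ∈ B, (y ∈ U ↔ y ∈ subgraph e φ)

theorem IsLipschitzDomain.exists_chart (hU : IsLipschitzDomain U) {x : Space d}
    (hx : x ∈ frontier U) : ∃ B e φ K, x ∈ B ∧ IsGraphChart U B e φ K := by
  obtain ⟨e, he, K, φ, hφ, h⟩ := hU.locallyGraph x hx
  obtain ⟨ε, hε, hb⟩ := Metric.eventually_nhds_iff_ball.1 h
  exact ⟨ball x ε, e, φ, K, mem_ball_self hε, he, hφ, isOpen_ball, isBounded_ball, hb⟩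

variable {e : Space d} {φ : (ℝ ∙ e)ᗮ → ℝ} {K : ℝ≥0}

theorem IsGraphChart.frontier_inter (h : IsGraphChart U B e φ K) :
    frontier U ∩ B = range (graphMap e φ) ∩ B := by
  rw [← frontier_subgraph h.norm_eq h.lipschitz.continuous, ← frontier_inter_open_inter h.isOpen,
    ← frontier_inter_open_inter (s := subgraph e φ) h.isOpen]
  have : U ∩ B = subgraph e φ ∩ B := by
    ext y; exact ⟨fun hy => ⟨(h.mem_iff y hy.2).1 hy.1, hy.2⟩,
      fun hy => ⟨(h.mem_iff y hy.2).2 hy.1, hy.2⟩⟩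
  rw [this]

theorem surfaceMeasure_eq (he : ‖e‖ = 1) : surfaceMeasure d = μHE[finrank ℝ (ℝ ∙ e)ᗮ] := by
  have he0 : e ≠ 0 := by rintro rfl; simp at he
  have h := (ℝ ∙ e).finrank_add_finrank_orthogonal
  rw [finrank_span_singleton he0, finrank_euclideanSpace_fin] at h
  rw [surfaceMeasure]
  congr 1
  omega

theorem IsGraphChart.ae_isOutwardNormal (h : IsGraphChart U B e φ K) :
    ∀ᵐ x ∂surfaceMeasure d, x ∈ frontier U ∩ B →
      IsOutwardNormal U x (graphNormal e φ ((ℝ ∙ e)ᗮ.orthogonalProjectionOnto x)) := by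
  have hnull : surfaceMeasure d (graphMap e φ '' {y | ¬ DifferentiableAt ℝ φ y}) = 0 := by
    rw [surfaceMeasure_eq h.norm_eq]
    exact euclideanHausdorffMeasure_graphMap_image_null h.norm_eq h.lipschitz
      h.lipschitz.ae_differentiableAt
  filter_upwards [measure_eq_zero_iff_ae_notMem.1 hnull] with x hx hxB
  have hxB' := hxB
  rw [h.frontier_inter] at hxB'
  obtain ⟨⟨y, rfl⟩, hy⟩ := hxB'
  have hd : DifferentiableAt ℝ φ y := by
    by_contra hc
    exact hx ⟨y, hc, rfl⟩
  have hp : (ℝ ∙ e)ᗮ.orthogonalProjectionOnto (graphMap e φ y) = y := proj_coe_add_smul e y _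
  rw [hp]
  refine ⟨norm_graphNormal h.norm_eq φ y, fun ε hε => ?_⟩
  filter_upwards [subgraph_halfspace h.norm_eq hd hε, h.isOpen.mem_nhds hy] with z hz hzB
  rw [h.mem_iff z hzB]
  exact hz

theorem IsGraphChart.measure_lt_top (h : IsGraphChart U B e φ K) :
    surfaceMeasure d (frontier U ∩ B) < ⊤ := by
  have hm : MeasurableSet (graphMap e φ ⁻¹' B) :=
    (graphMap_continuous h.norm_eq h.lipschitz).measurable h.isOpen.measurableSet
  rw [h.frontier_inter, inter_comm, ← image_preimage_eq_inter_range, surfaceMeasure_eq h.norm_eq,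
    euclideanHausdorffMeasure_graphMap_image h.norm_eq h.lipschitz hm]
  have hb : Bornology.IsBounded (graphMap e φ ⁻¹' B) := by
    have hanti : AntilipschitzWith 1 (graphMap e φ) := by
      refine AntilipschitzWith.of_le_mul_dist fun y z => ?_
      rw [dist_eq_norm, dist_eq_norm, graphMap_sub]
      simpa using norm_le_norm_coe_add_smul h.norm_eq (y - z) _
    exact hanti.isBounded_preimage h.isBounded
  calc ∫⁻ y in graphMap e φ ⁻¹' B, ENNReal.ofReal (areaFactor φ y)
      ≤ ∫⁻ _ in graphMap e φ ⁻¹' B, ENNReal.ofReal √(1 + K ^ 2) :=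
        lintegral_mono fun y => ENNReal.ofReal_le_ofReal (areaFactor_le h.lipschitz y)
    _ = ENNReal.ofReal √(1 + K ^ 2) * volume (graphMap e φ ⁻¹' B) := setLIntegral_const _ _
    _ < ⊤ := ENNReal.mul_lt_top ENNReal.ofReal_lt_top hb.measure_lt_top

/-- Divergence theorem for functions supported in the domain of a graph chart. -/
theorem IsGraphChart.setIntegral_fderiv (h : IsGraphChart U B e φ K) {ψ : Space d → ℝ}
    (hψ : ContDiff ℝ 1 ψ) (hc : HasCompactSupport ψ) (hB : tsupport ψ ⊆ B) (hU : IsOpen U)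
    (v : Space d) :
    ∫ x in U, fderiv ℝ ψ x v =
      ∫ x in frontier U, ⟪v, outwardNormal U x⟫ * ψ x ∂surfaceMeasure d := by
  have h0 : ∀ x ∉ B, ψ x = 0 := fun x hx => image_eq_zero_of_notMem_tsupport fun hx' => hx (hB hx')
  have h1 : ∀ x ∉ B, fderiv ℝ ψ x v = 0 := fun x hx => by
    rw [fderiv_of_notMem_tsupport (𝕜 := ℝ) fun hx' => hx (hB hx')]; simp
  have hl : ∫ x in U, fderiv ℝ ψ x v = ∫ x in subgraph e φ, fderiv ℝ ψ x v := by
    rw [← integral_indicator hU.measurableSet,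
      ← integral_indicator (subgraph_isOpen h.lipschitz.continuous).measurableSet]
    congr 1
    ext x
    by_cases hx : x ∈ B
    · by_cases hxU : x ∈ U
      · rw [indicator_of_mem hxU, indicator_of_mem ((h.mem_iff x hx).1 hxU)]
      · rw [indicator_of_notMem hxU, indicator_of_notMem (mt (h.mem_iff x hx).2 hxU)]
    · simp [indicator, h1 x hx]
  have hmr : MeasurableSet (range (graphMap e φ)) :=
    (graphMap_measurableEmbedding h.norm_eq h.lipschitz).measurableSet_range
  rw [hl, setIntegral_subgraph_fderiv_eq_surface h.norm_eq h.lipschitz hψ hc,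
    ← surfaceMeasure_eq h.norm_eq, ← integral_indicator hmr,
    ← integral_indicator isClosed_frontier.measurableSet]
  refine integral_congr_ae ?_
  filter_upwards [h.ae_isOutwardNormal] with x hx
  by_cases hxB : x ∈ B
  · have hiff : x ∈ frontier U ↔ x ∈ range (graphMap e φ) := by
      have := Set.ext_iff.1 h.frontier_inter x
      simpa [hxB] using this
    by_cases hxf : x ∈ frontier U
    · rw [indicator_of_mem hxf, indicator_of_mem (hiff.1 hxf),
        outwardNormal_eq (hx ⟨hxf, hxB⟩), real_inner_comm]
    · rw [indicator_of_notMem hxf, indicator_of_notMem (mt hiff.2 hxf)]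
  · simp [indicator, h0 x hxB]

theorem isCompact_frontier_of_isBounded (hU : Bornology.IsBounded U) : IsCompact (frontier U) :=
  Metric.isCompact_of_isClosed_isBounded isClosed_frontier
    (hU.closure.subset frontier_subset_closure)

theorem IsLipschitzDomain.isCompact_frontier (hU : IsLipschitzDomain U) : IsCompact (frontier U) :=
  isCompact_frontier_of_isBounded hU.isBounded

/-- The outward normal exists almost everywhere on a Lipschitz boundary. -/
theorem IsLipschitzDomain.ae_isOutwardNormal (hU : IsLipschitzDomain U) :
    ∀ᵐ x ∂surfaceMeasure d, x ∈ frontier U → IsOutwardNormal U x (outwardNormal U x) := by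
  refine hU.isCompact_frontier.induction_on
    (p := fun s => ∀ᵐ x ∂surfaceMeasure d, x ∈ s → IsOutwardNormal U x (outwardNormal U x))
    (Eventually.of_forall fun x hx => hx.elim) ?_ ?_ ?_
  · intro s t hst ht
    filter_upwards [ht] with x hx hxs using hx (hst hxs)
  · intro s t hs ht
    filter_upwards [hs, ht] with x h1 h2 hx using hx.elim h1 h2
  · intro x hx
    obtain ⟨B, e, φ, K, hxB, h⟩ := hU.exists_chart hx
    refine ⟨frontier U ∩ B, inter_mem_nhdsWithin _ (h.isOpen.mem_nhds hxB), ?_⟩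
    filter_upwards [h.ae_isOutwardNormal] with y hy hyB
    have := hy hyB
    rwa [outwardNormal_eq this]

theorem IsLipschitzDomain.surfaceMeasure_frontier_lt_top (hU : IsLipschitzDomain U) :
    surfaceMeasure d (frontier U) < ⊤ := by
  refine hU.isCompact_frontier.measure_lt_top_of_nhdsWithin fun x hx => ?_
  obtain ⟨B, e, φ, K, hxB, h⟩ := hU.exists_chart hx
  exact ⟨frontier U ∩ B, inter_mem_nhdsWithin _ (h.isOpen.mem_nhds hxB), h.measure_lt_top⟩

theorem IsLipschitzDomain.aemeasurable_outwardNormal (hU : IsLipschitzDomain U) :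
    AEMeasurable (outwardNormal U) ((surfaceMeasure d).restrict (frontier U)) := by
  refine hU.isCompact_frontier.induction_on
    (p := fun s => AEMeasurable (outwardNormal U) ((surfaceMeasure d).restrict s)) (by simp)
    (fun s t hst ht => ht.mono_set hst) (fun s t hs ht => aemeasurable_union_iff.2 ⟨hs, ht⟩) ?_
  intro x hx
  obtain ⟨B, e, φ, K, hxB, h⟩ := hU.exists_chart hx
  refine ⟨frontier U ∩ B, inter_mem_nhdsWithin _ (h.isOpen.mem_nhds hxB), ?_⟩
  refine ⟨fun x => graphNormal e φ ((ℝ ∙ e)ᗮ.orthogonalProjectionOnto x),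
    (graphNormal_measurable e φ).comp (by fun_prop), ?_⟩
  refine (ae_restrict_iff' (isClosed_frontier.measurableSet.inter h.isOpen.measurableSet)).2 ?_
  filter_upwards [h.ae_isOutwardNormal] with y hy hyB using outwardNormal_eq (hy hyB)

theorem IsLipschitzDomain.isFiniteMeasure (hU : IsLipschitzDomain U) :
    IsFiniteMeasure ((surfaceMeasure d).restrict (frontier U)) :=
  ⟨by rw [Measure.restrict_apply_univ]; exact hU.surfaceMeasure_frontier_lt_top⟩

theorem IsLipschitzDomain.integrableOn_frontier (hU : IsLipschitzDomain U) {g : Space d → ℝ}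
    (hg : Continuous g) (v : Space d) :
    IntegrableOn (fun x => ⟪v, outwardNormal U x⟫ * g x) (frontier U) (surfaceMeasure d) := by
  have := hU.isFiniteMeasure
  obtain ⟨C, hC⟩ := hU.isCompact_frontier.exists_bound_of_continuousOn hg.continuousOn
  refine Integrable.of_bound (C := ‖v‖ * C) ?_ ?_
  · exact ((aemeasurable_const.inner hU.aemeasurable_outwardNormal).mul
      hg.measurable.aemeasurable).aestronglyMeasurable
  · refine (ae_restrict_iff' isClosed_frontier.measurableSet).2 (Eventually.of_forall fun x hx => ?_)
    rw [norm_mul]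
    refine mul_le_mul ?_ (hC x hx) (norm_nonneg _) (norm_nonneg _)
    refine (norm_inner_le_norm _ _).trans ?_
    exact mul_le_of_le_one_right (norm_nonneg _) (norm_outwardNormal_le U x)

theorem integrableOn_fderiv_of_isBounded (hU : Bornology.IsBounded U) {g : Space d → ℝ}
    (hg : ContDiff ℝ 1 g) (v : Space d) : IntegrableOn (fun x => fderiv ℝ g x v) U :=
  (((hg.continuous_fderiv one_ne_zero).clm_apply continuous_const).continuousOn.integrableOn_compact
    hU.isCompact_closure).mono_set subset_closure

theorem setIntegral_fderiv_of_tsupport_subset (hU : IsOpen U) {ψ : Space d → ℝ}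
    (hψ : ContDiff ℝ 1 ψ) (hc : HasCompactSupport ψ) (hs : tsupport ψ ⊆ U) (v : Space d) :
    ∫ x in U, fderiv ℝ ψ x v =
      ∫ x in frontier U, ⟪v, outwardNormal U x⟫ * ψ x ∂surfaceMeasure d := by
  have hr : ∫ x in frontier U, ⟪v, outwardNormal U x⟫ * ψ x ∂surfaceMeasure d = 0 := by
    refine setIntegral_eq_zero_of_forall_eq_zero fun x hx => ?_
    have hxU : x ∉ U := by rw [hU.frontier_eq] at hx; exact hx.2
    rw [image_eq_zero_of_notMem_tsupport fun h => hxU (hs h), mul_zero]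
  rw [hr, setIntegral_eq_integral_of_forall_compl_eq_zero]
  · obtain ⟨C, hC⟩ := hψ.lipschitzWith_of_hasCompactSupport hc one_ne_zero
    rw [← integral_lineDeriv_eq_zero hC hc v]
    refine integral_congr_ae (Eventually.of_forall fun x => ?_)
    exact ((hψ.differentiable one_ne_zero x).lineDeriv_eq_fderiv).symm
  · intro x hx
    rw [fderiv_of_notMem_tsupport (𝕜 := ℝ) fun h => hx (hs h)]; simp

/-- **Divergence theorem on Lipschitz domains**: a partition of unity reduces it to graph charts. -/
theorem IsLipschitzDomain.setIntegral_fderiv (hU : IsLipschitzDomain U) {g : Space d → ℝ}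
    (hg : ContDiff ℝ 1 g) (v : Space d) :
    ∫ x in U, fderiv ℝ g x v =
      ∫ x in frontier U, ⟪v, outwardNormal U x⟫ * g x ∂surfaceMeasure d := by
  choose! B e φ K hxB hchart using fun x (hx : x ∈ frontier U) => hU.exists_chart hx
  obtain ⟨t, htU, hcov⟩ := hU.isCompact_frontier.elim_nhds_subcover B
    fun x hx => (hchart x hx).isOpen.mem_nhds (hxB x hx)
  -- `none` stands for the interior, `some x` for the graph chart at the boundary point `x`.
  let W : Option t → Set (Space d) := fun i => i.elim U fun x => B x
  have hWo : ∀ i, IsOpen (W i) := by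
    rintro (_ | ⟨x, hx⟩)
    · exact hU.isOpen
    · exact (hchart x (htU x hx)).isOpen
  have hWb : ∀ i, Bornology.IsBounded (W i) := by
    rintro (_ | ⟨x, hx⟩)
    · exact hU.isBounded
    · exact (hchart x (htU x hx)).isBounded
  have hWc : closure U ⊆ ⋃ i, W i := by
    intro x hx
    by_cases hxU : x ∈ U
    · exact mem_iUnion.2 ⟨none, hxU⟩
    · have hxf : x ∈ frontier U := by rw [hU.isOpen.frontier_eq]; exact ⟨hx, hxU⟩
      obtain ⟨y, hy, hxy⟩ := mem_iUnion₂.1 (hcov hxf)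
      exact mem_iUnion.2 ⟨some ⟨y, hy⟩, hxy⟩
  obtain ⟨f, hf⟩ := SmoothPartitionOfUnity.exists_isSubordinate 𝓘(ℝ, Space d)
    (isClosed_closure (s := U)) W hWo hWc
  have hsum : ∀ x ∈ closure U, ∑ i, f i x * g x = g x := by
    intro x hx
    have h1 := f.sum_eq_one hx
    rw [finsum_eq_sum_of_fintype] at h1
    rw [← Finset.sum_mul, h1, one_mul]
  have hsm : ∀ i, ContDiff ℝ 1 fun x => f i x * g x := fun i =>
    (((f i).contMDiff.contDiff).of_le (by exact_mod_cast le_top)).mul hg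
  have hts : ∀ i, tsupport (fun x => f i x * g x) ⊆ W i := fun i =>
    (tsupport_mul_subset_left (f := f i) (g := g)).trans (hf i)
  have hcs : ∀ i, HasCompactSupport fun x => f i x * g x := fun i =>
    Metric.isCompact_of_isClosed_isBounded (isClosed_tsupport _) ((hWb i).subset (hts i))
  have hpiece : ∀ i, ∫ x in U, fderiv ℝ (fun x => f i x * g x) x v =
      ∫ x in frontier U, ⟪v, outwardNormal U x⟫ * (f i x * g x) ∂surfaceMeasure d := by
    rintro (_ | ⟨x, hx⟩)
    · exact setIntegral_fderiv_of_tsupport_subset hU.isOpen (hsm _) (hcs _) (hts _) v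
    · exact (hchart x (htU x hx)).setIntegral_fderiv (hsm _) (hcs _) (hts _) hU.isOpen v
  have hl : ∫ x in U, fderiv ℝ g x v =
      ∫ x in U, ∑ i, fderiv ℝ (fun x => f i x * g x) x v := by
    refine setIntegral_congr_fun hU.isOpen.measurableSet fun x hx => ?_
    have h1 : g =ᶠ[𝓝 x] fun x => ∑ i, f i x * g x := by
      filter_upwards [hU.isOpen.mem_nhds hx] with y hy using (hsum y (subset_closure hy)).symm
    beta_reduce
    rw [h1.fderiv_eq, fderiv_fun_sum fun i _ => (hsm i).differentiable one_ne_zero x]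
    simp
  have hr : ∫ x in frontier U, ⟪v, outwardNormal U x⟫ * g x ∂surfaceMeasure d =
      ∫ x in frontier U, ∑ i, ⟪v, outwardNormal U x⟫ * (f i x * g x) ∂surfaceMeasure d := by
    refine setIntegral_congr_fun isClosed_frontier.measurableSet fun x hx => ?_
    beta_reduce
    rw [← Finset.mul_sum, hsum x (frontier_subset_closure hx)]
  rw [hl, hr, integral_finsetSum _ fun i _ => integrableOn_fderiv_of_isBounded hU.isBounded (hsm i) v,
    integral_finsetSum _ fun i _ => hU.integrableOn_frontier (hsm i).continuous v]
  exact Finset.sum_congr rfl fun i _ => hpiece i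

end LipschitzDomain

/-! ### Interfaces between mesh elements -/

section Faces

variable {d : ℕ}

/-- Two disjoint sets with outward normals at a common point touch there along a common
tangent plane. -/
theorem IsOutwardNormal.eq_neg_of_disjoint {U V : Set (Space d)} {x n m : Space d}
    (hn : IsOutwardNormal U x n) (hm : IsOutwardNormal V x m) (hd : Disjoint U V) : m = -n := by
  by_contra hne
  have hm1 : ‖-m‖ = 1 := by rw [norm_neg, hm.1]
  have hlt : ⟪n, -m⟫ < 1 := by
    refine (inner_lt_one_iff_real_of_norm_eq_one hn.1 hm1).2 fun h => hne ?_
    rw [h, neg_neg]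
  rw [inner_neg_right] at hlt
  -- Otherwise the direction `w` points into both of the tangent half-spaces.
  set w : Space d := -(n + m) with hw
  have hnw : ⟪n, w⟫ = -(1 + ⟪n, m⟫) := by
    rw [hw, inner_neg_right, inner_add_right, real_inner_self_eq_norm_sq, hn.1]; ring
  have hmw : ⟪m, w⟫ = -(1 + ⟪n, m⟫) := by
    rw [hw, inner_neg_right, inner_add_right, real_inner_self_eq_norm_sq, hm.1,
      real_inner_comm n m]
    ring
  have hc : 0 < 1 + ⟪n, m⟫ := by linarith
  have hwpos : 0 < ‖w‖ := by
    rw [norm_pos_iff]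
    rintro h0
    rw [h0, inner_zero_right] at hnw
    linarith
  set ε : ℝ := (1 + ⟪n, m⟫) / (2 * ‖w‖) with hε
  have hεpos : 0 < ε := by positivity
  have hεw : ε * ‖w‖ = (1 + ⟪n, m⟫) / 2 := by rw [hε]; field_simp
  have htend : Tendsto (fun t : ℝ => x + t • w) (𝓝[>] 0) (𝓝 x) := by
    have hcont : Continuous fun t : ℝ => x + t • w := by fun_prop
    have h0 := hcont.tendsto 0
    simp only [zero_smul, add_zero] at h0
    exact h0.mono_left nhdsWithin_le_nhds
  obtain ⟨t, ⟨h1, h2⟩, ht⟩ := ((htend.eventually (hn.2 ε hεpos)).and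
    (htend.eventually (hm.2 ε hεpos)) |>.and self_mem_nhdsWithin).exists
  have ht0 : 0 < t := ht
  have hsub : x + t • w - x = t • w := by abel
  rw [hsub, norm_smul, Real.norm_of_nonneg ht0.le, inner_smul_right] at h1 h2
  refine disjoint_left.1 hd (h1.1 ?_) (h2.1 ?_)
  · rw [hnw]; nlinarith
  · rw [hmw]; nlinarith

/-- A point with an outward normal is not interior to the closure. -/
theorem IsOutwardNormal.notMem_interior_closure {U : Set (Space d)} {x n : Space d}
    (hn : IsOutwardNormal U x n) : x ∉ interior (closure U) := by
  intro hx
  have h1 := (hn.2 (1 / 2) (by norm_num)).eventually_nhds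
  have htend : Tendsto (fun t : ℝ => x + t • n) (𝓝[>] 0) (𝓝 x) := by
    have hcont : Continuous fun t : ℝ => x + t • n := by fun_prop
    have h0 := hcont.tendsto 0
    simp only [zero_smul, add_zero] at h0
    exact h0.mono_left nhdsWithin_le_nhds
  obtain ⟨t, ⟨h2, h3⟩, ht⟩ := ((htend.eventually h1).and
    (htend.eventually (mem_interior_iff_mem_nhds.1 hx)) |>.and self_mem_nhdsWithin).exists
  have ht0 : 0 < t := ht
  have hopen : ∀ᶠ z in 𝓝 (x + t • n), 1 / 2 * ‖z - x‖ < ⟪n, z - x⟫ := by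
    refine ContinuousAt.eventually_lt (by fun_prop) (by fun_prop) ?_
    have hsub : x + t • n - x = t • n := by abel
    rw [hsub, norm_smul, Real.norm_of_nonneg ht0.le, inner_smul_right, real_inner_self_eq_norm_sq,
      hn.1]
    linarith
  obtain ⟨z, hzU, hz⟩ := ((mem_closure_iff_frequently.1 h3).and_eventually (h2.and hopen)).exists
  exact hz.1.2 hz.2 hzU

variable {Ω : Set (Space d)} (M : SpaceMesh Ω)

theorem SpaceMesh.notMem_elem_of_mem_frontier {i : Fin M.card} {x : Space d}
    (hx : x ∈ frontier (M.elem i)) (j : Fin M.card) : x ∉ M.elem j := by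
  by_cases hij : i = j
  · subst hij
    rw [(M.lipschitz i).isOpen.frontier_eq] at hx
    exact hx.2
  · exact disjoint_left.1 (((M.disjoint hij).closure_left (M.lipschitz j).isOpen))
      (frontier_subset_closure hx)

theorem SpaceMesh.mem_frontier_of_mem_closure {i j : Fin M.card} {x : Space d}
    (hx : x ∈ frontier (M.elem i)) (hj : x ∈ closure (M.elem j)) : x ∈ frontier (M.elem j) := by
  rw [(M.lipschitz j).isOpen.frontier_eq]
  exact ⟨hj, M.notMem_elem_of_mem_frontier hx j⟩

theorem SpaceMesh.frontier_subset (i : Fin M.card) : frontier (M.elem i) ⊆ closure Ω :=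
  frontier_subset_closure.trans (closure_mono (M.subset i))

/-- A boundary point of an element in the interior of the domain belongs to exactly one other
element, on the opposite side of the common tangent plane. -/
theorem SpaceMesh.exists_neighbour (hΩ : IsOpen Ω) {i : Fin M.card} {x : Space d}
    (hx : x ∈ frontier (M.elem i)) (hxΩ : x ∉ frontier Ω)
    (hn : ∀ k, x ∈ frontier (M.elem k) →
      IsOutwardNormal (M.elem k) x (outwardNormal (M.elem k) x)) :
    ∃ j, j ≠ i ∧ x ∈ frontier (M.elem j) ∧
      outwardNormal (M.elem j) x = -outwardNormal (M.elem i) x ∧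
      ∀ k, x ∈ frontier (M.elem k) → k = i ∨ k = j := by
  have hxm : x ∈ Ω := by
    by_contra h
    exact hxΩ (by rw [hΩ.frontier_eq]; exact ⟨M.frontier_subset i hx, h⟩)
  -- Without a neighbour, `closure (M.elem i)` would fill a whole neighbourhood of `x`.
  have hex : ∃ j, j ≠ i ∧ x ∈ frontier (M.elem j) := by
    by_contra! hno
    refine (hn i hx).notMem_interior_closure (mem_interior_iff_mem_nhds.2 ?_)
    have h1 : ∀ᶠ y in 𝓝 x, ∀ j, j ≠ i → y ∉ closure (M.elem j) := by
      refine eventually_all.2 fun j => ?_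
      by_cases hj : j = i
      · exact Eventually.of_forall fun y h => absurd hj h
      · filter_upwards [isClosed_closure.isOpen_compl.mem_nhds
          fun h => hno j hj (M.mem_frontier_of_mem_closure hx h)] with y hy _ using hy
    filter_upwards [h1, hΩ.mem_nhds hxm] with y hy hyΩ
    have := subset_closure hyΩ
    rw [M.cover] at this
    obtain ⟨j, hj⟩ := mem_iUnion.1 this
    by_cases hji : j = i
    · exact hji ▸ hj
    · exact absurd hj (hy j hji)
  obtain ⟨j, hji, hj⟩ := hex
  have hneg := fun k l (hk : x ∈ frontier (M.elem k)) (hl : x ∈ frontier (M.elem l)) (hkl : k ≠ l) =>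
    (hn k hk).eq_neg_of_disjoint (hn l hl) (M.disjoint hkl)
  refine ⟨j, hji, hj, hneg i j hx hj hji.symm, fun k hk => ?_⟩
  by_contra! hkij
  -- Three pairwise opposite unit normals cannot exist.
  have h1 := hneg i k hx hk hkij.1.symm
  have h2 := hneg j k hj hk hkij.2.symm
  have h3 := hneg i j hx hj hji.symm
  rw [h2, h3, neg_neg] at h1
  have h2n : (2 : ℝ) • outwardNormal (M.elem i) x = 0 := by
    rw [two_smul]; exact eq_neg_iff_add_eq_zero.1 h1
  have h0 : outwardNormal (M.elem i) x = 0 := (smul_eq_zero.1 h2n).resolve_left two_ne_zero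
  have := (hn i hx).1
  rw [h0, norm_zero] at this
  exact zero_ne_one this

/-- Near an interface point, the union of the elements other than `i` is the neighbour `j`. -/
theorem SpaceMesh.nhdsWithin_others {i j : Fin M.card} {x : Space d}
    (hx : x ∈ frontier (M.elem i)) (hji : j ≠ i)
    (huniq : ∀ k, x ∈ frontier (M.elem k) → k = i ∨ k = j) :
    𝓝[⋃ k ∈ {k | k ≠ i}, M.elem k] x = 𝓝[M.elem j] x := by
  rw [nhdsWithin_eq_iff_eventuallyEq]
  have h1 : ∀ᶠ y in 𝓝 x, ∀ k, k ≠ i → k ≠ j → y ∉ closure (M.elem k) := by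
    refine eventually_all.2 fun k => ?_
    by_cases hk : k = i ∨ k = j
    · exact Eventually.of_forall fun y h1 h2 => (hk.elim h1 h2).elim
    · filter_upwards [isClosed_closure.isOpen_compl.mem_nhds
          fun h => hk (huniq k (M.mem_frontier_of_mem_closure hx h))] with y hy _ _ using hy
  filter_upwards [h1] with y hy
  refine propext ⟨fun h => ?_, fun h => mem_iUnion₂.2 ⟨j, hji, h⟩⟩
  obtain ⟨k, hk, hyk⟩ := mem_iUnion₂.1 h
  by_cases hkj : k = j
  · exact hkj ▸ hyk
  · exact absurd (subset_closure hyk) (hy k hk hkj)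

theorem SpaceMesh.ae_isOutwardNormal :
    ∀ᵐ x ∂surfaceMeasure d, ∀ k, x ∈ frontier (M.elem k) →
      IsOutwardNormal (M.elem k) x (outwardNormal (M.elem k) x) :=
  ae_all_iff.2 fun k => (M.lipschitz k).ae_isOutwardNormal

end Faces

/-! ### Regularity of finite element functions -/

section PiecewiseSmooth

variable {d : ℕ} {Ω : Set (Space d)}

/-- The family `V` consists of extensions of the restrictions of `v` to the mesh elements to
functions that are of class `C¹` in space on the whole space, and that are measurable and bounded
on the closure of the domain, together with their derivatives along the direction `μ`. -/
structure IsPiecewiseExtension (M : SpaceMesh Ω) (V : Fin M.card → Space d → Dir d → ℝ → ℝ)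
    (v : Space d → Dir d → ℝ → ℝ) : Prop where
  contDiff : ∀ i μ E, ContDiff ℝ 1 fun x => V i x μ E
  measurable : ∀ i, Measurable fun z : Space d × Dir d × ℝ => V i z.1 z.2.1 z.2.2
  measurable_deriv : ∀ i, Measurable fun z : Space d × Dir d × ℝ =>
    fderiv ℝ (fun y => V i y z.2.1 z.2.2) z.1 (z.2.1 : Space d)
  bounded : ∃ C, ∀ i, ∀ x ∈ closure Ω, ∀ μ E, |V i x μ E| ≤ C
  bounded_deriv : ∃ C, ∀ i, ∀ x ∈ closure Ω, ∀ (μ : Dir d) E,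
    |fderiv ℝ (fun y => V i y μ E) x (μ : Space d)| ≤ C
  eq_on : ∀ i, ∀ x ∈ M.elem i, ∀ μ E, v x μ E = V i x μ E
  eq_zero : ∀ x, x ∉ (⋃ i, M.elem i) → ∀ μ E, v x μ E = 0

theorem measurable_of_finite_cover {α : Type*} [MeasurableSpace α] {n : ℕ} {s : Fin n → Set α}
    (hs : ∀ i, MeasurableSet (s i)) {g : Fin n → α → ℝ} (hg : ∀ i, Measurable (g i)) {f : α → ℝ}
    (hfg : ∀ i, ∀ x ∈ s i, f x = g i x) (h0 : ∀ x, x ∉ (⋃ i, s i) → f x = 0) : Measurable f := by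
  intro T hT
  have : f ⁻¹' T = (⋃ i, s i ∩ g i ⁻¹' T) ∪ ((⋃ i, s i)ᶜ ∩ (fun _ => (0 : ℝ)) ⁻¹' T) := by
    ext x
    by_cases hx : x ∈ ⋃ i, s i
    · obtain ⟨i, hi⟩ := mem_iUnion.1 hx
      constructor
      · intro h
        exact Or.inl (mem_iUnion.2 ⟨i, hi, by rw [mem_preimage, ← hfg i x hi]; exact h⟩)
      · rintro (h | h)
        · obtain ⟨j, hj, h⟩ := mem_iUnion.1 h
          rw [mem_preimage, hfg j x hj]; exact h
        · exact absurd hx h.1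
    · constructor
      · intro h
        exact Or.inr ⟨hx, by rw [mem_preimage, ← h0 x hx]; exact h⟩
      · rintro (h | h)
        · obtain ⟨j, hj, h⟩ := mem_iUnion.1 h
          exact absurd (mem_iUnion.2 ⟨j, hj⟩) hx
        · rw [mem_preimage, h0 x hx]; exact h.2
  rw [this]
  exact (MeasurableSet.iUnion fun i => (hs i).inter (hg i hT)).union
    ((MeasurableSet.iUnion hs).compl.inter (measurable_const hT))

theorem bounded_of_finite_cover {α : Type*} {n : ℕ} {s : Fin n → Set α} {f : α → ℝ}
    (hb : ∀ i, ∃ C, ∀ x ∈ s i, |f x| ≤ C) (h0 : ∀ x, x ∉ (⋃ i, s i) → f x = 0) :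
    ∃ C, ∀ x, |f x| ≤ C := by
  choose C hC using hb
  refine ⟨∑ i, |C i|, fun x => ?_⟩
  by_cases hx : x ∈ ⋃ i, s i
  · obtain ⟨i, hi⟩ := mem_iUnion.1 hx
    exact ((hC i x hi).trans (le_abs_self _)).trans
      (Finset.single_le_sum (f := fun i => |C i|) (fun j _ => abs_nonneg _) (Finset.mem_univ i))
  · rw [h0 x hx, abs_zero]
    exact Finset.sum_nonneg fun j _ => abs_nonneg _

theorem IsPiecewiseExtension.measurable_fun {M : SpaceMesh Ω}
    {V : Fin M.card → Space d → Dir d → ℝ → ℝ} {v : Space d → Dir d → ℝ → ℝ}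
    (h : IsPiecewiseExtension M V v) :
    Measurable fun z : Space d × Dir d × ℝ => v z.1 z.2.1 z.2.2 := by
  refine measurable_of_finite_cover (s := fun i => M.elem i ×ˢ univ)
    (fun i => (M.lipschitz i).isOpen.measurableSet.prod MeasurableSet.univ)
    h.measurable (fun i z hz => h.eq_on i z.1 hz.1 _ _) fun z hz => h.eq_zero _ ?_ _ _
  intro hz'
  obtain ⟨i, hi⟩ := mem_iUnion.1 hz'
  exact hz (mem_iUnion.2 ⟨i, hi, mem_univ _⟩)

theorem IsPiecewiseExtension.bounded_fun {M : SpaceMesh Ω}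
    {V : Fin M.card → Space d → Dir d → ℝ → ℝ} {v : Space d → Dir d → ℝ → ℝ}
    (h : IsPiecewiseExtension M V v) : ∃ C, 0 ≤ C ∧ ∀ x μ E, |v x μ E| ≤ C := by
  obtain ⟨C, hC⟩ := h.bounded
  refine ⟨|C|, abs_nonneg _, fun x μ E => ?_⟩
  by_cases hx : x ∈ ⋃ i, M.elem i
  · obtain ⟨i, hi⟩ := mem_iUnion.1 hx
    rw [h.eq_on i x hi]
    exact (hC i x (subset_closure (M.subset i hi)) μ E).trans (le_abs_self _)
  · rw [h.eq_zero x hx, abs_zero]; exact abs_nonneg _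

theorem IsPiecewiseExtension.zero (M : SpaceMesh Ω) : IsPiecewiseExtension M 0 0 where
  contDiff _ _ _ := contDiff_const
  measurable _ := measurable_const
  measurable_deriv i := by simp
  bounded := ⟨0, by simp⟩
  bounded_deriv := ⟨0, by simp⟩
  eq_on _ _ _ _ _ := rfl
  eq_zero _ _ _ _ := rfl

theorem IsPiecewiseExtension.add {M : SpaceMesh Ω}
    {V W : Fin M.card → Space d → Dir d → ℝ → ℝ} {v w : Space d → Dir d → ℝ → ℝ}
    (hv : IsPiecewiseExtension M V v) (hw : IsPiecewiseExtension M W w) :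
    IsPiecewiseExtension M (V + W) (v + w) := by
  have hder : ∀ i x (μ : Dir d) E, fderiv ℝ (fun y => (V + W) i y μ E) x (μ : Space d) =
      fderiv ℝ (fun y => V i y μ E) x (μ : Space d) +
        fderiv ℝ (fun y => W i y μ E) x (μ : Space d) := by
    intro i x μ E
    have := fderiv_fun_add ((hv.contDiff i μ E).differentiable one_ne_zero x)
      ((hw.contDiff i μ E).differentiable one_ne_zero x)
    simp only [Pi.add_apply]
    rw [this]; rfl
  obtain ⟨C, hC⟩ := hv.bounded
  obtain ⟨D, hD⟩ := hw.bounded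
  obtain ⟨C', hC'⟩ := hv.bounded_deriv
  obtain ⟨D', hD'⟩ := hw.bounded_deriv
  refine ⟨fun i μ E => (hv.contDiff i μ E).add (hw.contDiff i μ E),
    fun i => (hv.measurable i).add (hw.measurable i), fun i => ?_,
    ⟨C + D, fun i x hx μ E => (abs_add_le _ _).trans (add_le_add (hC i x hx μ E) (hD i x hx μ E))⟩,
    ⟨C' + D', fun i x hx μ E => ?_⟩, fun i x hx μ E => ?_, fun x hx μ E => ?_⟩
  · simp only [hder]
    exact (hv.measurable_deriv i).add (hw.measurable_deriv i)
  · rw [hder]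
    exact (abs_add_le _ _).trans (add_le_add (hC' i x hx μ E) (hD' i x hx μ E))
  · simp only [Pi.add_apply, hv.eq_on i x hx, hw.eq_on i x hx]
  · simp only [Pi.add_apply, hv.eq_zero x hx, hw.eq_zero x hx, add_zero]

theorem IsPiecewiseExtension.smul {M : SpaceMesh Ω} (c : ℝ)
    {V : Fin M.card → Space d → Dir d → ℝ → ℝ} {v : Space d → Dir d → ℝ → ℝ}
    (hv : IsPiecewiseExtension M V v) : IsPiecewiseExtension M (c • V) (c • v) := by
  have hder : ∀ i x (μ : Dir d) E, fderiv ℝ (fun y => (c • V) i y μ E) x (μ : Space d) =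
      c * fderiv ℝ (fun y => V i y μ E) x (μ : Space d) := by
    intro i x μ E
    have := fderiv_fun_const_smul ((hv.contDiff i μ E).differentiable one_ne_zero x) c
    simp only [Pi.smul_apply]
    rw [this]; rfl
  obtain ⟨C, hC⟩ := hv.bounded
  obtain ⟨C', hC'⟩ := hv.bounded_deriv
  refine ⟨fun i μ E => (hv.contDiff i μ E).const_smul c,
    fun i => (hv.measurable i).const_smul c, fun i => ?_,
    ⟨|c| * C, fun i x hx μ E => ?_⟩, ⟨|c| * C', fun i x hx μ E => ?_⟩,
    fun i x hx μ E => ?_, fun x hx μ E => ?_⟩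
  · simp only [hder]
    exact (hv.measurable_deriv i).const_mul c
  · simp only [Pi.smul_apply, smul_eq_mul, abs_mul]
    exact mul_le_mul_of_nonneg_left (hC i x hx μ E) (abs_nonneg c)
  · rw [hder, abs_mul]
    exact mul_le_mul_of_nonneg_left (hC' i x hx μ E) (abs_nonneg c)
  · simp only [Pi.smul_apply, hv.eq_on i x hx]
  · simp only [Pi.smul_apply, hv.eq_zero x hx, smul_zero]

theorem IsPiecewiseExtension.sub {M : SpaceMesh Ω}
    {V W : Fin M.card → Space d → Dir d → ℝ → ℝ} {v w : Space d → Dir d → ℝ → ℝ}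
    (hv : IsPiecewiseExtension M V v) (hw : IsPiecewiseExtension M W w) :
    IsPiecewiseExtension M (V - W) (v - w) := by
  simpa [sub_eq_add_neg] using hv.add (hw.smul (-1))

theorem contDiff_mvPolynomial_eval (Q : MvPolynomial (Fin d) ℝ) :
    ContDiff ℝ 1 fun x : Space d => MvPolynomial.eval (fun j => x j) Q := by
  induction Q using MvPolynomial.induction_on with
  | C a => simpa using contDiff_const
  | add p q hp hq => simpa using hp.add hq
  | mul_X p j hp =>
    simp only [map_mul, MvPolynomial.eval_X]
    exact hp.mul (by fun_prop)

theorem toCube_measurable : Measurable (toCube (d := d)) := by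
  unfold toCube
  have h : Measurable fun μ : Dir d => (WithLp.ofLp (μ : Space d) : Fin d → ℝ) := by fun_prop
  exact h.norm.inv.smul h

theorem norm_toCube_le (μ : Dir d) : ‖toCube μ‖ ≤ 1 := by
  rw [toCube, norm_smul, norm_inv, norm_norm]
  exact inv_mul_le_one

theorem CubeMesh.elem_measurableSet (M : CubeMesh d) (i : Fin M.card) :
    MeasurableSet (M.elem i) := by
  refine toCube_measurable (t := M.flatElem i) ?_
  have : M.flatElem i = {m | m (M.axis i) = M.side i} ∩
      ⋂ j, {m | j ≠ M.axis i → m j ∈ Ioo (M.lo i j) (M.hi i j)} := by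
    ext m; simp [CubeMesh.flatElem, faceBox]
  rw [this]
  refine (measurableSet_eq_fun (by fun_prop) (by fun_prop)).inter (MeasurableSet.iInter fun j => ?_)
  by_cases hj : j = M.axis i
  · simp [hj]
  · simp only [ne_eq, hj, not_false_eq_true, forall_const]
    exact measurableSet_Ioo.preimage (measurable_pi_apply j)

theorem measurable_of_mem_dirFE {M : CubeMesh d} {q : ℕ} {b : Dir d → ℝ} (hb : b ∈ dirFE M q) :
    Measurable b := by
  choose Q hQ using hb.1
  refine measurable_of_finite_cover M.elem_measurableSet
    (g := fun i μ => MvPolynomial.eval (toCube μ) (Q i)) (fun i => ?_) (fun i => (hQ i).2) hb.2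
  exact (MvPolynomial.continuous_eval (Q i)).measurable.comp toCube_measurable

theorem bounded_of_mem_dirFE {M : CubeMesh d} {q : ℕ} {b : Dir d → ℝ} (hb : b ∈ dirFE M q) :
    ∃ C, ∀ μ, |b μ| ≤ C := by
  refine bounded_of_finite_cover (s := M.elem) (fun i => ?_) hb.2
  obtain ⟨Q, -, hQ⟩ := hb.1 i
  obtain ⟨C, hC⟩ := (isCompact_closedBall (0 : Fin d → ℝ) 1).exists_bound_of_continuousOn
    (MvPolynomial.continuous_eval Q).continuousOn
  exact ⟨C, fun μ hμ => by
    rw [hQ μ hμ]; exact hC _ (mem_closedBall_zero_iff.2 (norm_toCube_le μ))⟩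

theorem measurable_of_mem_energyFE {Emin Emax : ℝ} {M : EnergyMesh Emin Emax} {r : ℕ} {c : ℝ → ℝ}
    (hc : c ∈ energyFE M r) : Measurable c := by
  choose Q hQ using hc.1
  exact measurable_of_finite_cover (s := M.group) (fun i => measurableSet_Ioo)
    (fun i => (Q i).continuous.measurable) (fun i => (hQ i).2) hc.2

theorem bounded_of_mem_energyFE {Emin Emax : ℝ} {M : EnergyMesh Emin Emax} {r : ℕ} {c : ℝ → ℝ}
    (hc : c ∈ energyFE M r) : ∃ C, ∀ E, |c E| ≤ C := by
  refine bounded_of_finite_cover (s := M.group) (fun g => ?_) hc.2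
  obtain ⟨Q, -, hQ⟩ := hc.1 g
  obtain ⟨C, hC⟩ := (isCompact_Icc (a := M.node g.succ) (b := M.node g.castSucc)).exists_bound_of_continuousOn
    Q.continuous.continuousOn
  exact ⟨C, fun E hE => by rw [hQ E hE]; exact hC _ (Ioo_subset_Icc_self hE)⟩

/-- A product of a piecewise polynomial in space and bounded functions of direction and energy: on
each element, the polynomial itself is the extension. -/
theorem isPiecewiseExtension_product {M : SpaceMesh Ω} (hΩ : Bornology.IsBounded Ω) {p : ℕ}
    {a : Space d → ℝ} (ha : a ∈ spaceFE M p) {b : Dir d → ℝ} (hb : Measurable b)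
    (hb' : ∃ C, ∀ μ, |b μ| ≤ C) {c : ℝ → ℝ} (hc : Measurable c) (hc' : ∃ C, ∀ E, |c E| ≤ C) :
    ∃ V, IsPiecewiseExtension M V fun x μ E => a x * b μ * c E := by
  choose Q hQ using ha.1
  set A : Fin M.card → Space d → ℝ := fun i x => MvPolynomial.eval (fun j => x j) (Q i) with hA
  have hAs : ∀ i, ContDiff ℝ 1 (A i) := fun i => contDiff_mvPolynomial_eval (Q i)
  obtain ⟨B, hB⟩ := hb'
  obtain ⟨C, hC⟩ := hc'
  have hK := hΩ.isCompact_closure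
  choose D hD using fun i => hK.exists_bound_of_continuousOn (hAs i).continuous.continuousOn
  choose D' hD' using fun i => hK.exists_bound_of_continuousOn
    ((hAs i).continuous_fderiv one_ne_zero).continuousOn
  have hle : ∀ (D : Fin M.card → ℝ) i, D i ≤ ∑ i, |D i| := fun D i => (le_abs_self _).trans
    (Finset.single_le_sum (f := fun i => |D i|) (fun j _ => abs_nonneg _) (Finset.mem_univ i))
  have hder : ∀ i x (μ : Dir d) E, fderiv ℝ (fun y => A i y * b μ * c E) x (μ : Space d) =
      fderiv ℝ (A i) x (μ : Space d) * b μ * c E := by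
    intro i x μ E
    have h1 := ((hAs i).differentiable one_ne_zero x).hasFDerivAt.mul_const (b μ * c E)
    simp only [mul_assoc]
    rw [h1.fderiv]
    simp; ring
  have hprod : ∀ {s t : ℝ} (μ : Dir d) (E : ℝ), |s| ≤ t → |s * b μ * c E| ≤ t * |B| * |C| := by
    intro s t μ E hs
    rw [abs_mul, abs_mul]
    have h1 := (hB μ).trans (le_abs_self B)
    have h2 := (hC E).trans (le_abs_self C)
    have h3 := (abs_nonneg s).trans hs
    gcongr
  refine ⟨fun i x μ E => A i x * b μ * c E,
    fun i μ E => ((hAs i).mul contDiff_const).mul contDiff_const, fun i => ?_, fun i => ?_,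
    ⟨(∑ i, |D i|) * |B| * |C|, fun i x hx μ E => hprod μ E ((hD i x hx).trans (hle D i))⟩,
    ⟨(∑ i, |D' i|) * |B| * |C|, fun i x hx μ E => ?_⟩, fun i x hx μ E => ?_, fun x hx μ E => ?_⟩
  · have := (hAs i).continuous.measurable
    exact ((this.comp measurable_fst).mul (hb.comp (measurable_fst.comp measurable_snd))).mul
      (hc.comp (measurable_snd.comp measurable_snd))
  · simp only [hder]
    have h1 : Measurable fun z : Space d × Dir d × ℝ => fderiv ℝ (A i) z.1 (z.2.1 : Space d) := by
      have h2 : Continuous fun z : Space d × Dir d × ℝ => fderiv ℝ (A i) z.1 (z.2.1 : Space d) :=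
        (((hAs i).continuous_fderiv one_ne_zero).comp continuous_fst).clm_apply
          (continuous_subtype_val.comp (continuous_fst.comp continuous_snd))
      exact h2.measurable
    exact (h1.mul (hb.comp (measurable_fst.comp measurable_snd))).mul
      (hc.comp (measurable_snd.comp measurable_snd))
  · rw [hder]
    refine hprod μ E ?_
    refine ((fderiv ℝ (A i) x).le_opNorm _).trans ?_
    have h1 : ‖(μ : Space d)‖ = 1 := by simp
    rw [h1, mul_one]
    exact (hD' i x hx).trans (hle D' i)
  · rw [(hQ i).2 x hx]
  · rw [ha.2 x hx]; ring

/-- Finite element functions are piecewise smooth. -/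
theorem exists_isPiecewiseExtension {Emin Emax : ℝ} {M : SpaceMesh Ω} (hΩ : Bornology.IsBounded Ω)
    {MA : CubeMesh d} {ME : EnergyMesh Emin Emax} {p q r : ℕ} {v : Space d → Dir d → ℝ → ℝ}
    (hv : v ∈ feSpace M MA ME p q r) : ∃ V, IsPiecewiseExtension M V v := by
  refine Submodule.span_induction (p := fun v _ => ∃ V, IsPiecewiseExtension M V v) ?_ ?_ ?_ ?_ hv
  · rintro _ ⟨a, ha, b, hb, c, hc, rfl⟩
    exact isPiecewiseExtension_product hΩ ha (measurable_of_mem_dirFE hb) (bounded_of_mem_dirFE hb)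
      (measurable_of_mem_energyFE hc) (bounded_of_mem_energyFE hc)
  · exact ⟨0, .zero M⟩
  · rintro v w _ _ ⟨V, hV⟩ ⟨W, hW⟩
    exact ⟨V + W, hV.add hW⟩
  · rintro c v _ ⟨V, hV⟩
    exact ⟨c • V, hV.smul c⟩

end PiecewiseSmooth

/-! ### Integrals over the space-angle-energy domain -/

section Measures

variable {d : ℕ} (P : Problem d)

theorem inner_dir_mem_Icc (μ ν : Dir d) : ⟪(μ : Space d), (ν : Space d)⟫ ∈ Icc (-1 : ℝ) 1 := by
  have h := abs_real_inner_le_norm (μ : Space d) (ν : Space d)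
  have h1 : ‖(μ : Space d)‖ = 1 := by simp
  have h2 : ‖(ν : Space d)‖ = 1 := by simp
  rw [h1, h2, mul_one] at h
  exact abs_le.1 h

instance : IsFiniteMeasure (dirMeasure d) := by unfold dirMeasure; infer_instance

/-- The measure `dE dμ` on the energy-angle domain. -/
def Problem.energyDirMeasure : Measure (ℝ × Dir d) :=
  (volume.restrict P.energy).prod (dirMeasure d)

/-- The measure `dx dE dμ` on the space-energy-angle domain. -/
def Problem.phaseMeasure : Measure (Space d × ℝ × Dir d) :=
  (volume.restrict P.Ω).prod P.energyDirMeasure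

instance : IsFiniteMeasure (volume.restrict P.energy) := by
  unfold Problem.energy; infer_instance

instance : IsFiniteMeasure P.energyDirMeasure := by unfold Problem.energyDirMeasure; infer_instance

instance : IsFiniteMeasure (volume.restrict P.Ω) :=
  ⟨by rw [Measure.restrict_apply_univ]; exact P.lipschitz.isBounded.measure_lt_top⟩

instance : IsFiniteMeasure P.phaseMeasure := by unfold Problem.phaseMeasure; infer_instance

theorem Problem.measurableSet_energy : MeasurableSet P.energy := measurableSet_Icc

theorem Problem.ae_energyDirMeasure : ∀ᵐ z ∂P.energyDirMeasure, z.1 ∈ P.energy :=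
  Measure.quasiMeasurePreserving_fst.ae (ae_restrict_mem P.measurableSet_energy)

theorem Problem.ae_phaseMeasure : ∀ᵐ z ∂P.phaseMeasure, z.1 ∈ P.Ω ∧ z.2.1 ∈ P.energy :=
  (Measure.quasiMeasurePreserving_fst.ae (ae_restrict_mem P.lipschitz.isOpen.measurableSet)).and
    (Measure.quasiMeasurePreserving_snd.ae P.ae_energyDirMeasure)

theorem Problem.integral_energy_dir {F : Dir d → ℝ → ℝ}
    (hF : Integrable (fun z => F z.2 z.1) P.energyDirMeasure) :
    ∫ E in P.energy, ∫ μ : Dir d, F μ E ∂(dirMeasure d) = ∫ z, F z.2 z.1 ∂P.energyDirMeasure :=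
  (integral_prod _ hF).symm

theorem Problem.integral_phase {F : Space d → Dir d → ℝ → ℝ}
    (hF : Integrable (fun z => F z.1 z.2.2 z.2.1) P.phaseMeasure) :
    ∫ E in P.energy, ∫ μ : Dir d, (∫ x in P.Ω, F x μ E) ∂(dirMeasure d) =
      ∫ z, F z.1 z.2.2 z.2.1 ∂P.phaseMeasure := by
  rw [P.integral_energy_dir (F := fun μ E => ∫ x in P.Ω, F x μ E) hF.integral_prod_right]
  exact (integral_prod_symm _ hF).symm

/-- A measurable function that is bounded over the spatial and the energy domain. -/
structure Problem.BoundedMeasurable (F : Space d → Dir d → ℝ → ℝ) : Prop where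
  measurable : Measurable fun z : Space d × Dir d × ℝ => F z.1 z.2.1 z.2.2
  bounded : ∃ C, 0 ≤ C ∧ ∀ x ∈ P.Ω, ∀ μ, ∀ E ∈ P.energy, |F x μ E| ≤ C

variable {P} {F G : Space d → Dir d → ℝ → ℝ}

namespace Problem.BoundedMeasurable

theorem add (hF : P.BoundedMeasurable F) (hG : P.BoundedMeasurable G) :
    P.BoundedMeasurable fun x μ E => F x μ E + G x μ E := by
  obtain ⟨C, hC0, hC⟩ := hF.bounded
  obtain ⟨D, hD0, hD⟩ := hG.bounded
  exact ⟨hF.measurable.add hG.measurable, C + D, by positivity, fun x hx μ E hE =>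
    (abs_add_le _ _).trans (add_le_add (hC x hx μ E hE) (hD x hx μ E hE))⟩

theorem mul (hF : P.BoundedMeasurable F) (hG : P.BoundedMeasurable G) :
    P.BoundedMeasurable fun x μ E => F x μ E * G x μ E := by
  obtain ⟨C, hC0, hC⟩ := hF.bounded
  obtain ⟨D, hD0, hD⟩ := hG.bounded
  exact ⟨hF.measurable.mul hG.measurable, C * D, by positivity, fun x hx μ E hE => by
    rw [abs_mul]; exact mul_le_mul (hC x hx μ E hE) (hD x hx μ E hE) (abs_nonneg _) hC0⟩

theorem neg (hF : P.BoundedMeasurable F) : P.BoundedMeasurable fun x μ E => -F x μ E := by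
  obtain ⟨C, hC0, hC⟩ := hF.bounded
  exact ⟨hF.measurable.neg, C, hC0, fun x hx μ E hE => by rw [abs_neg]; exact hC x hx μ E hE⟩

theorem integrable (hF : P.BoundedMeasurable F) :
    Integrable (fun z => F z.1 z.2.2 z.2.1) P.phaseMeasure := by
  obtain ⟨C, hC0, hC⟩ := hF.bounded
  refine Integrable.of_bound (C := C) ?_ ?_
  · have h : Measurable fun z : Space d × ℝ × Dir d => (z.1, z.2.2, z.2.1) := by fun_prop
    exact (hF.measurable.comp h).aestronglyMeasurable
  · filter_upwards [P.ae_phaseMeasure] with z hz using hC _ hz.1 _ _ hz.2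

theorem integrableOn (hF : P.BoundedMeasurable F) {A : Set (Space d)} (hA : A ⊆ P.Ω)
    (hAm : MeasurableSet A) (μ : Dir d) {E : ℝ} (hE : E ∈ P.energy) :
    IntegrableOn (fun x => F x μ E) A := by
  obtain ⟨C, hC0, hC⟩ := hF.bounded
  have hfin : volume A < ⊤ := (P.lipschitz.isBounded.subset hA).measure_lt_top
  refine Measure.integrableOn_of_bounded (M := C) hfin.ne ?_ ?_
  · have h : Measurable fun x : Space d => (x, μ, E) := by fun_prop
    exact (hF.measurable.comp h).aestronglyMeasurable
  · exact (ae_restrict_iff' hAm).2 (Eventually.of_forall fun x hx => hC x (hA hx) μ E hE)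

theorem measurable_setIntegral (hF : P.BoundedMeasurable F) (A : Set (Space d)) :
    Measurable fun z : ℝ × Dir d => ∫ x in A, F x z.2 z.1 := by
  have h : Measurable fun z : (ℝ × Dir d) × Space d => (z.2, z.1.2, z.1.1) := by fun_prop
  exact ((hF.measurable.comp h).stronglyMeasurable.integral_prod_right').measurable

theorem integrable_setIntegral (hF : P.BoundedMeasurable F) {A : Set (Space d)} (hA : A ⊆ P.Ω) :
    Integrable (fun z => ∫ x in A, F x z.2 z.1) P.energyDirMeasure := by
  obtain ⟨C, hC0, hC⟩ := hF.bounded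
  have hfin : volume A < ⊤ := (P.lipschitz.isBounded.subset hA).measure_lt_top
  refine Integrable.of_bound (C := C * volume.real A)
    (hF.measurable_setIntegral A).aestronglyMeasurable ?_
  filter_upwards [P.ae_energyDirMeasure] with z hz
  exact norm_setIntegral_le_of_norm_le_const hfin fun x hx => hC x (hA hx) _ _ hz

end Problem.BoundedMeasurable

theorem IsPiecewiseExtension.boundedMeasurable {M : SpaceMesh P.Ω}
    {V : Fin M.card → Space d → Dir d → ℝ → ℝ} {v : Space d → Dir d → ℝ → ℝ}
    (h : IsPiecewiseExtension M V v) (i : Fin M.card) : P.BoundedMeasurable (V i) := by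
  obtain ⟨C, hC⟩ := h.bounded
  exact ⟨h.measurable i, |C|, abs_nonneg _, fun x hx μ E _ =>
    (hC i x (subset_closure hx) μ E).trans (le_abs_self C)⟩

theorem IsPiecewiseExtension.boundedMeasurable_deriv {M : SpaceMesh P.Ω}
    {V : Fin M.card → Space d → Dir d → ℝ → ℝ} {v : Space d → Dir d → ℝ → ℝ}
    (h : IsPiecewiseExtension M V v) (i : Fin M.card) :
    P.BoundedMeasurable fun x μ E => fderiv ℝ (fun y => V i y μ E) x (μ : Space d) := by
  obtain ⟨C, hC⟩ := h.bounded_deriv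
  exact ⟨h.measurable_deriv i, |C|, abs_nonneg _, fun x hx μ E _ =>
    (hC i x (subset_closure hx) μ E).trans (le_abs_self C)⟩

theorem IsPiecewiseExtension.boundedMeasurable_fun {M : SpaceMesh P.Ω}
    {V : Fin M.card → Space d → Dir d → ℝ → ℝ} {v : Space d → Dir d → ℝ → ℝ}
    (h : IsPiecewiseExtension M V v) : P.BoundedMeasurable v := by
  obtain ⟨C, hC0, hC⟩ := h.bounded_fun
  exact ⟨h.measurable_fun, C, hC0, fun x _ μ E _ => hC x μ E⟩

end Measures

/-! ### Cross-sections -/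

section CrossSections

variable {d : ℕ} [NeZero d] {P : Problem d}

theorem Problem.β_measurable : Measurable fun z : Space d × ℝ => P.β z.1 z.2 := by
  unfold Problem.β
  refine StronglyMeasurable.measurable ?_
  refine StronglyMeasurable.integral_prod_right' (f := fun w : (Space d × ℝ) × ℝ =>
    ∫ μ' : Dir d, P.θ w.1.1 ⟪(pole d : Space d), (μ' : Space d)⟫ w.1.2 w.2 ∂(dirMeasure d)) ?_
  refine StronglyMeasurable.integral_prod_right' (f := fun w : ((Space d × ℝ) × ℝ) × Dir d =>
    P.θ w.1.1.1 ⟪(pole d : Space d), (w.2 : Space d)⟫ w.1.1.2 w.1.2) ?_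
  have h : Measurable fun w : ((Space d × ℝ) × ℝ) × Dir d =>
    (w.1.1.1, ⟪(pole d : Space d), (w.2 : Space d)⟫, w.1.1.2, w.1.2) := by fun_prop
  exact (P.θ_measurable.comp h).stronglyMeasurable

theorem Problem.γ_measurable : Measurable fun z : Space d × ℝ => P.γ z.1 z.2 := by
  unfold Problem.γ
  refine StronglyMeasurable.measurable ?_
  refine StronglyMeasurable.integral_prod_right' (f := fun w : (Space d × ℝ) × ℝ =>
    ∫ μ' : Dir d, P.θ w.1.1 ⟪(μ' : Space d), (pole d : Space d)⟫ w.2 w.1.2 ∂(dirMeasure d)) ?_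
  refine StronglyMeasurable.integral_prod_right' (f := fun w : ((Space d × ℝ) × ℝ) × Dir d =>
    P.θ w.1.1.1 ⟪(w.2 : Space d), (pole d : Space d)⟫ w.1.2 w.1.1.2) ?_
  have h : Measurable fun w : ((Space d × ℝ) × ℝ) × Dir d =>
    (w.1.1.1, ⟪(w.2 : Space d), (pole d : Space d)⟫, w.1.2, w.1.1.2) := by fun_prop
  exact (P.θ_measurable.comp h).stronglyMeasurable

theorem Problem.β_nonneg {x : Space d} (hx : x ∈ P.Ω) {E : ℝ} (hE : E ∈ P.energy) :
    0 ≤ P.β x E :=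
  setIntegral_nonneg P.measurableSet_energy fun E' hE' => integral_nonneg fun _ =>
    P.θ_nonneg x hx _ (inner_dir_mem_Icc _ _) E hE E' hE'

theorem Problem.γ_nonneg {x : Space d} (hx : x ∈ P.Ω) {E : ℝ} (hE : E ∈ P.energy) :
    0 ≤ P.γ x E :=
  setIntegral_nonneg P.measurableSet_energy fun E' hE' => integral_nonneg fun _ =>
    P.θ_nonneg x hx _ (inner_dir_mem_Icc _ _) E' hE' E hE

/-- Positivity of `ᾱ`, solved for `γ`. It bounds `γ` by `2 (α + β)`, so that the ratios of the
cross-sections are bounded and their suprema are not junk values. -/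
theorem Problem.γ_lt (hpos : P.Positivity) {x : Space d} (hx : x ∈ P.Ω) {E : ℝ}
    (hE : E ∈ P.energy) : P.γ x E < 2 * P.α x E + P.β x E := by
  obtain ⟨α₀, h0, h⟩ := hpos
  have := h x hx E hE
  rw [Problem.αbar] at this
  linarith

theorem Problem.αbar_pos (hpos : P.Positivity) {x : Space d} (hx : x ∈ P.Ω) {E : ℝ}
    (hE : E ∈ P.energy) : 0 < P.αbar x E := by
  obtain ⟨α₀, h0, h⟩ := hpos
  exact h0.trans_le (h x hx E hE)

theorem Problem.α_add_β_pos (hpos : P.Positivity) {x : Space d} (hx : x ∈ P.Ω) {E : ℝ}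
    (hE : E ∈ P.energy) : 0 < P.α x E + P.β x E := by
  have h1 := Problem.γ_lt hpos hx hE
  have h2 := Problem.γ_nonneg hx hE
  have h3 := P.α_nonneg x hx E hE
  have h4 := Problem.β_nonneg hx hE
  linarith

theorem Problem.β_le_qβ (hpos : P.Positivity) {x : Space d} (hx : x ∈ P.Ω) {E : ℝ}
    (hE : E ∈ P.energy) : P.β x E ≤ P.qβ * (P.α x E + P.β x E) := by
  rw [← div_le_iff₀ (Problem.α_add_β_pos hpos hx hE)]
  refine le_csSup ⟨1, ?_⟩ ⟨(x, E), ⟨hx, hE⟩, rfl⟩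
  rintro _ ⟨⟨y, F⟩, ⟨hy, hF⟩, rfl⟩
  refine div_le_one_of_le₀ ?_ (Problem.α_add_β_pos hpos hy hF).le
  have := P.α_nonneg y hy F hF
  simp only
  linarith

theorem Problem.γ_le_qγ (hpos : P.Positivity) {x : Space d} (hx : x ∈ P.Ω) {E : ℝ}
    (hE : E ∈ P.energy) : P.γ x E ≤ P.qγ * (P.α x E + P.β x E) := by
  rw [← div_le_iff₀ (Problem.α_add_β_pos hpos hx hE)]
  refine le_csSup ⟨2, ?_⟩ ⟨(x, E), ⟨hx, hE⟩, rfl⟩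
  rintro _ ⟨⟨y, F⟩, ⟨hy, hF⟩, rfl⟩
  simp only
  rw [div_le_iff₀ (Problem.α_add_β_pos hpos hy hF)]
  have h1 := Problem.γ_lt hpos hy hF
  have h2 := Problem.β_nonneg hy hF
  linarith

theorem Problem.γ_le_rγ (hbdd : P.BoundedData) (hpos : P.Positivity) {x : Space d} (hx : x ∈ P.Ω)
    {E : ℝ} (hE : E ∈ P.energy) : P.γ x E ≤ P.rγ * P.αbar x E := by
  rw [← div_le_iff₀ (Problem.αbar_pos hpos hx hE)]
  obtain ⟨C, hC⟩ := hbdd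
  obtain ⟨α₀, h0, hα⟩ := id hpos
  refine le_csSup ⟨3 * C / α₀, ?_⟩ ⟨(x, E), ⟨hx, hE⟩, rfl⟩
  rintro _ ⟨⟨y, F⟩, ⟨hy, hF⟩, rfl⟩
  have h1 := Problem.γ_lt hpos hy hF
  have h2 := Problem.γ_nonneg hy hF
  have h3 := hC y hy F hF
  simp only
  gcongr
  · linarith
  · linarith
  · exact hα y hy F hF

theorem Problem.qβ_nonneg (hpos : P.Positivity) : 0 ≤ P.qβ := by
  refine Real.sSup_nonneg ?_
  rintro _ ⟨⟨y, F⟩, ⟨hy, hF⟩, rfl⟩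
  exact div_nonneg (Problem.β_nonneg hy hF) (Problem.α_add_β_pos hpos hy hF).le

theorem Problem.qγ_nonneg (hpos : P.Positivity) : 0 ≤ P.qγ := by
  refine Real.sSup_nonneg ?_
  rintro _ ⟨⟨y, F⟩, ⟨hy, hF⟩, rfl⟩
  exact div_nonneg (Problem.γ_nonneg hy hF) (Problem.α_add_β_pos hpos hy hF).le

theorem Problem.rγ_nonneg (hpos : P.Positivity) : 0 ≤ P.rγ := by
  refine Real.sSup_nonneg ?_
  rintro _ ⟨⟨y, F⟩, ⟨hy, hF⟩, rfl⟩
  exact div_nonneg (Problem.γ_nonneg hy hF) (Problem.αbar_pos hpos hy hF).le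

theorem Problem.boundedMeasurable_of_le {ρ : Space d → ℝ → ℝ} {C : ℝ}
    (hm : Measurable fun z : Space d × ℝ => ρ z.1 z.2)
    (h0 : ∀ x ∈ P.Ω, ∀ E ∈ P.energy, 0 ≤ ρ x E) (hC : ∀ x ∈ P.Ω, ∀ E ∈ P.energy, ρ x E ≤ C) :
    P.BoundedMeasurable fun x _ E => ρ x E := by
  have h : Measurable fun z : Space d × Dir d × ℝ => (z.1, z.2.2) := by fun_prop
  refine ⟨hm.comp h, |C|, abs_nonneg _, fun x hx μ E hE => ?_⟩
  rw [abs_of_nonneg (h0 x hx E hE)]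
  exact (hC x hx E hE).trans (le_abs_self C)

theorem Problem.boundedMeasurable_β (hbdd : P.BoundedData) :
    P.BoundedMeasurable fun x _ E => P.β x E := by
  obtain ⟨C, hC⟩ := hbdd
  exact boundedMeasurable_of_le P.β_measurable (fun x hx E hE => Problem.β_nonneg hx hE)
    fun x hx E hE => (hC x hx E hE).2

theorem Problem.boundedMeasurable_α (hbdd : P.BoundedData) :
    P.BoundedMeasurable fun x _ E => P.α x E := by
  obtain ⟨C, hC⟩ := hbdd
  exact boundedMeasurable_of_le P.α_measurable P.α_nonneg fun x hx E hE => (hC x hx E hE).1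

theorem Problem.boundedMeasurable_γ (hbdd : P.BoundedData) (hpos : P.Positivity) :
    P.BoundedMeasurable fun x _ E => P.γ x E := by
  obtain ⟨C, hC⟩ := hbdd
  refine boundedMeasurable_of_le (C := 3 * C) P.γ_measurable
    (fun x hx E hE => Problem.γ_nonneg hx hE) fun x hx E hE => ?_
  have h1 := Problem.γ_lt hpos hx hE
  have h2 := hC x hx E hE
  linarith

/-- The squared weighted norm as an integral over the phase space. -/
theorem weightedNorm_sq {ρ : Space d → ℝ → ℝ} {v : Space d → Dir d → ℝ → ℝ}
    (hρ : P.BoundedMeasurable fun x _ E => ρ x E) (hv : P.BoundedMeasurable v)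
    (h0 : ∀ x ∈ P.Ω, ∀ E ∈ P.energy, 0 ≤ ρ x E) :
    weightedNorm P ρ v ^ 2 = ∫ z, ρ z.1 z.2.1 * v z.1 z.2.2 z.2.1 ^ 2 ∂P.phaseMeasure := by
  have hint : Integrable (fun z => (√(ρ z.1 z.2.1) * v z.1 z.2.2 z.2.1) ^ 2) P.phaseMeasure := by
    refine (hρ.mul (hv.mul hv)).integrable.congr ?_
    filter_upwards [P.ae_phaseMeasure] with z hz
    rw [mul_pow, Real.sq_sqrt (h0 _ hz.1 _ hz.2)]; ring
  rw [weightedNorm, Real.sq_sqrt, P.integral_phase (F := fun x μ E => (√(ρ x E) * v x μ E) ^ 2) hint]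
  · refine integral_congr_ae ?_
    filter_upwards [P.ae_phaseMeasure] with z hz
    rw [mul_pow, Real.sq_sqrt (h0 _ hz.1 _ hz.2)]
  · exact integral_nonneg fun E => integral_nonneg fun μ => integral_nonneg fun x => sq_nonneg _

end CrossSections

/-! ### The scattering form -/

section Scattering

variable {d : ℕ} {P : Problem d}

variable (P) in
/-- The kernel `θ(x, μ'·μ, E' → E)`, as a function of `((x, E, μ), (E', μ'))`. -/
def Problem.kernel (p : (Space d × ℝ × Dir d) × ℝ × Dir d) : ℝ :=
  P.θ p.1.1 ⟪(p.2.2 : Space d), (p.1.2.2 : Space d)⟫ p.2.1 p.1.2.1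

variable (P) in
/-- The measure `dx dE dμ dE' dμ'`. -/
def Problem.scatterMeasure : Measure ((Space d × ℝ × Dir d) × ℝ × Dir d) :=
  P.phaseMeasure.prod P.energyDirMeasure

/-- Exchange of the states before and after a scattering event. -/
def exchange (p : (Space d × ℝ × Dir d) × ℝ × Dir d) : (Space d × ℝ × Dir d) × ℝ × Dir d :=
  ((p.1.1, p.2), p.1.2)

theorem exchange_measurable : Measurable (exchange (d := d)) := by unfold exchange; fun_prop

theorem exchange_measurableEmbedding : MeasurableEmbedding (exchange (d := d)) :=
  MeasurableEquiv.measurableEmbedding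
    ⟨⟨exchange, exchange, fun _ => rfl, fun _ => rfl⟩, exchange_measurable, exchange_measurable⟩

theorem exchange_measurePreserving :
    MeasurePreserving exchange P.scatterMeasure P.scatterMeasure := by
  have h1 := measurePreserving_prodAssoc (volume.restrict P.Ω) P.energyDirMeasure P.energyDirMeasure
  have h2 : MeasurePreserving (Prod.map id Prod.swap)
      ((volume.restrict P.Ω).prod (P.energyDirMeasure.prod P.energyDirMeasure))
      ((volume.restrict P.Ω).prod (P.energyDirMeasure.prod P.energyDirMeasure)) :=
    (MeasurePreserving.id _).prod Measure.measurePreserving_swap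
  exact (h1.symm _).comp (h2.comp h1)

theorem Problem.kernel_measurable : Measurable P.kernel := by
  have h : Measurable fun p : (Space d × ℝ × Dir d) × ℝ × Dir d =>
    (p.1.1, ⟪(p.2.2 : Space d), (p.1.2.2 : Space d)⟫, p.2.1, p.1.2.1) := by fun_prop
  exact P.θ_measurable.comp h

theorem Problem.ae_scatterMeasure :
    ∀ᵐ p ∂P.scatterMeasure, p.1.1 ∈ P.Ω ∧ p.1.2.1 ∈ P.energy ∧ p.2.1 ∈ P.energy := by
  filter_upwards [Measure.quasiMeasurePreserving_fst.ae P.ae_phaseMeasure,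
    Measure.quasiMeasurePreserving_snd.ae P.ae_energyDirMeasure] with p h1 h2
  exact ⟨h1.1, h1.2, h2⟩

theorem Problem.kernel_nonneg : ∀ᵐ p ∂P.scatterMeasure, 0 ≤ P.kernel p := by
  filter_upwards [P.ae_scatterMeasure] with p hp
  exact P.θ_nonneg _ hp.1 _ (inner_dir_mem_Icc _ _) _ hp.2.2 _ hp.2.1

theorem Problem.integrable_kernel_in {z : Space d × ℝ × Dir d} (hx : z.1 ∈ P.Ω)
    (hE : z.2.1 ∈ P.energy) : Integrable (fun b => P.kernel (z, b)) P.energyDirMeasure :=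
  (P.θ_integrable_in z.1 hx z.2.2 z.2.1 hE).swap

theorem Problem.integrable_kernel_out {z : Space d × ℝ × Dir d} (hx : z.1 ∈ P.Ω)
    (hE : z.2.1 ∈ P.energy) :
    Integrable (fun b => P.kernel (exchange (z, b))) P.energyDirMeasure :=
  (P.θ_integrable_out z.1 hx z.2.2 z.2.1 hE).swap

variable [NeZero d]

theorem Problem.integral_kernel_in {z : Space d × ℝ × Dir d} (hx : z.1 ∈ P.Ω)
    (hE : z.2.1 ∈ P.energy) :
    ∫ b, P.kernel (z, b) ∂P.energyDirMeasure = P.γ z.1 z.2.1 := by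
  rw [P.γ_eq z.2.2]
  exact integral_prod _ (P.integrable_kernel_in hx hE)

theorem Problem.integral_kernel_out {z : Space d × ℝ × Dir d} (hx : z.1 ∈ P.Ω)
    (hE : z.2.1 ∈ P.energy) :
    ∫ b, P.kernel (exchange (z, b)) ∂P.energyDirMeasure = P.β z.1 z.2.1 := by
  rw [P.β_eq z.2.2]
  exact integral_prod _ (P.integrable_kernel_out hx hE)

theorem Problem.integrable_kernel (hbdd : P.BoundedData) (hpos : P.Positivity) :
    Integrable P.kernel P.scatterMeasure := by
  refine (integrable_prod_iff P.kernel_measurable.aestronglyMeasurable).2 ⟨?_, ?_⟩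
  · filter_upwards [P.ae_phaseMeasure] with z hz using P.integrable_kernel_in hz.1 hz.2
  · refine ((P.boundedMeasurable_γ hbdd hpos).integrable).congr ?_
    filter_upwards [P.ae_phaseMeasure] with z hz
    rw [← P.integral_kernel_in hz.1 hz.2]
    refine integral_congr_ae ?_
    filter_upwards [P.ae_energyDirMeasure] with b hb
    exact (Real.norm_of_nonneg (P.θ_nonneg _ hz.1 _ (inner_dir_mem_Icc _ _) _ hb _ hz.2)).symm

section

variable {v w : Space d → Dir d → ℝ → ℝ}

theorem Problem.BoundedMeasurable.aestronglyMeasurable_after (hv : P.BoundedMeasurable v) :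
    AEStronglyMeasurable (fun p : (Space d × ℝ × Dir d) × ℝ × Dir d => v p.1.1 p.1.2.2 p.1.2.1)
      P.scatterMeasure := by
  have h : Measurable fun p : (Space d × ℝ × Dir d) × ℝ × Dir d =>
    (p.1.1, p.1.2.2, p.1.2.1) := by fun_prop
  exact (hv.measurable.comp h).aestronglyMeasurable

theorem Problem.BoundedMeasurable.aestronglyMeasurable_before (hv : P.BoundedMeasurable v) :
    AEStronglyMeasurable (fun p : (Space d × ℝ × Dir d) × ℝ × Dir d => v p.1.1 p.2.2 p.2.1)
      P.scatterMeasure := by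
  have h : Measurable fun p : (Space d × ℝ × Dir d) × ℝ × Dir d =>
    (p.1.1, p.2.2, p.2.1) := by fun_prop
  exact (hv.measurable.comp h).aestronglyMeasurable

theorem Problem.integrable_mul_after {f : (Space d × ℝ × Dir d) × ℝ × Dir d → ℝ}
    (hf : Integrable f P.scatterMeasure) (hv : P.BoundedMeasurable v) :
    Integrable (fun p => v p.1.1 p.1.2.2 p.1.2.1 * f p) P.scatterMeasure := by
  obtain ⟨C, hC0, hC⟩ := hv.bounded
  refine hf.bdd_mul (c := C) hv.aestronglyMeasurable_after ?_
  filter_upwards [P.ae_scatterMeasure] with p hp using hC _ hp.1 _ _ hp.2.1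

theorem Problem.integrable_mul_before {f : (Space d × ℝ × Dir d) × ℝ × Dir d → ℝ}
    (hf : Integrable f P.scatterMeasure) (hv : P.BoundedMeasurable v) :
    Integrable (fun p => v p.1.1 p.2.2 p.2.1 * f p) P.scatterMeasure := by
  obtain ⟨C, hC0, hC⟩ := hv.bounded
  refine hf.bdd_mul (c := C) hv.aestronglyMeasurable_before ?_
  filter_upwards [P.ae_scatterMeasure] with p hp using hC _ hp.1 _ _ hp.2.2

/-- The scattering form as one integral over the states before and after scattering. -/
theorem formS_eq_integral (hbdd : P.BoundedData) (hpos : P.Positivity)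
    (hw : P.BoundedMeasurable w) (hv : P.BoundedMeasurable v) :
    formS P w v = ∫ p, v p.1.1 p.1.2.2 p.1.2.1 * (w p.1.1 p.2.2 p.2.1 * P.kernel p)
      ∂P.scatterMeasure := by
  have hf := P.integrable_mul_before (P.integrable_kernel hbdd hpos) hw
  have hfv := P.integrable_mul_after hf hv
  have hae : ∀ᵐ z ∂P.phaseMeasure,
      ∫ b, v z.1 z.2.2 z.2.1 * (w z.1 b.2 b.1 * P.kernel (z, b)) ∂P.energyDirMeasure =
        P.scatter w z.1 z.2.2 z.2.1 * v z.1 z.2.2 z.2.1 := by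
    filter_upwards [hf.prod_right_ae] with z hz
    rw [integral_const_mul, mul_comm]
    congr 1
    refine (integral_prod _ hz).trans ?_
    unfold Problem.scatter
    simp only [Problem.kernel, mul_comm]
  have hint : Integrable (fun z => P.scatter w z.1 z.2.2 z.2.1 * v z.1 z.2.2 z.2.1)
      P.phaseMeasure := (hfv.integral_prod_left).congr hae
  rw [formS, P.integral_phase (F := fun x μ E => P.scatter w x μ E * v x μ E) hint,
    Problem.scatterMeasure, integral_prod _ hfv]
  exact (integral_congr_ae hae).symm

theorem formS_sub (hbdd : P.BoundedData) (hpos : P.Positivity) {w₁ w₂ : Space d → Dir d → ℝ → ℝ}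
    (hw₁ : P.BoundedMeasurable w₁) (hw₂ : P.BoundedMeasurable w₂)
    (hw : P.BoundedMeasurable (w₁ - w₂)) (hv : P.BoundedMeasurable v) :
    formS P (w₁ - w₂) v = formS P w₁ v - formS P w₂ v := by
  have hK := P.integrable_kernel hbdd hpos
  rw [formS_eq_integral hbdd hpos hw hv, formS_eq_integral hbdd hpos hw₁ hv,
    formS_eq_integral hbdd hpos hw₂ hv,
    ← integral_sub (P.integrable_mul_after (P.integrable_mul_before hK hw₁) hv)
      (P.integrable_mul_after (P.integrable_mul_before hK hw₂) hv)]
  refine integral_congr_ae (Eventually.of_forall fun p => ?_)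
  simp only [Pi.sub_apply]
  ring

/-- Integrating out the state before scattering leaves the weight `γ`. -/
theorem integral_kernel_after (hbdd : P.BoundedData) (hpos : P.Positivity)
    (hv : P.BoundedMeasurable v) :
    ∫ p, v p.1.1 p.1.2.2 p.1.2.1 * P.kernel p ∂P.scatterMeasure =
      ∫ z, P.γ z.1 z.2.1 * v z.1 z.2.2 z.2.1 ∂P.phaseMeasure := by
  rw [Problem.scatterMeasure,
    integral_prod _ (P.integrable_mul_after (P.integrable_kernel hbdd hpos) hv)]
  refine integral_congr_ae ?_
  filter_upwards [P.ae_phaseMeasure] with z hz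
  rw [integral_const_mul, P.integral_kernel_in hz.1 hz.2, mul_comm]

/-- Integrating out the state after scattering leaves the weight `β`. -/
theorem integral_kernel_before (hbdd : P.BoundedData) (hpos : P.Positivity)
    (hw : P.BoundedMeasurable w) :
    ∫ p, w p.1.1 p.2.2 p.2.1 * P.kernel p ∂P.scatterMeasure =
      ∫ z, P.β z.1 z.2.1 * w z.1 z.2.2 z.2.1 ∂P.phaseMeasure := by
  have hint := P.integrable_mul_before (P.integrable_kernel hbdd hpos) hw
  rw [← exchange_measurePreserving.integral_comp exchange_measurableEmbedding]
  have hint' := (exchange_measurePreserving.integrable_comp_emb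
    exchange_measurableEmbedding).2 hint
  rw [Problem.scatterMeasure]
  refine (integral_prod _ hint').trans ?_
  refine integral_congr_ae ?_
  filter_upwards [P.ae_phaseMeasure] with z hz
  change ∫ b, w z.1 z.2.2 z.2.1 * P.kernel (exchange (z, b)) ∂P.energyDirMeasure = _
  rw [integral_const_mul, P.integral_kernel_out hz.1 hz.2, mul_comm]

theorem integral_linear_combination {α : Type*} [MeasurableSpace α] {m : Measure α}
    {f g h : α → ℝ} (hf : Integrable f m) (hg : Integrable g m) (hh : Integrable h m) (a b : ℝ) :
    ∫ x, (a * f x + b * g x + h x) ∂m = a * ∫ x, f x ∂m + b * ∫ x, g x ∂m + ∫ x, h x ∂m := by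
  rw [integral_add (f := fun x => a * f x + b * g x) ((hf.const_mul a).add (hg.const_mul b)) hh,
    integral_add (hf.const_mul a) (hg.const_mul b), integral_const_mul, integral_const_mul]

/-- The quadratic polynomial behind the Cauchy-Schwarz inequality for the scattering form: the
integral of `kernel * (t w - v)²`. -/
theorem formS_quadratic_nonneg (hbdd : P.BoundedData) (hpos : P.Positivity)
    (hw : P.BoundedMeasurable w) (hv : P.BoundedMeasurable v) (t : ℝ) :
    0 ≤ weightedNorm P P.β w ^ 2 * (t * t) + (-2 * formS P w v) * t +
      weightedNorm P P.γ v ^ 2 := by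
  have hK := P.integrable_kernel hbdd hpos
  have hww := P.integrable_mul_before hK (hw.mul hw)
  have hvv := P.integrable_mul_after hK (hv.mul hv)
  have hwv := P.integrable_mul_after (P.integrable_mul_before hK hw) hv
  have hβ : weightedNorm P P.β w ^ 2 =
      ∫ p, w p.1.1 p.2.2 p.2.1 * w p.1.1 p.2.2 p.2.1 * P.kernel p ∂P.scatterMeasure := by
    rw [weightedNorm_sq (P.boundedMeasurable_β hbdd) hw fun x hx E hE => Problem.β_nonneg hx hE,
      integral_kernel_before hbdd hpos (hw.mul hw)]
    simp only [pow_two]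
  have hγ : weightedNorm P P.γ v ^ 2 =
      ∫ p, v p.1.1 p.1.2.2 p.1.2.1 * v p.1.1 p.1.2.2 p.1.2.1 * P.kernel p ∂P.scatterMeasure := by
    rw [weightedNorm_sq (P.boundedMeasurable_γ hbdd hpos) hv
        fun x hx E hE => Problem.γ_nonneg hx hE,
      integral_kernel_after hbdd hpos (hv.mul hv)]
    simp only [pow_two]
  have hcomb := integral_linear_combination hww hwv hvv (t * t) (-2 * t)
  have hnn : 0 ≤ ∫ p, (t * t * (w p.1.1 p.2.2 p.2.1 * w p.1.1 p.2.2 p.2.1 * P.kernel p) +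
      -2 * t * (v p.1.1 p.1.2.2 p.1.2.1 * (w p.1.1 p.2.2 p.2.1 * P.kernel p)) +
      v p.1.1 p.1.2.2 p.1.2.1 * v p.1.1 p.1.2.2 p.1.2.1 * P.kernel p) ∂P.scatterMeasure := by
    refine integral_nonneg_of_ae ?_
    filter_upwards [P.kernel_nonneg] with p hp
    have : 0 ≤ P.kernel p * (t * w p.1.1 p.2.2 p.2.1 - v p.1.1 p.1.2.2 p.1.2.1) ^ 2 := by
      positivity
    simp only [Pi.zero_apply]
    linarith
  rw [hcomb] at hnn
  rw [hβ, hγ, formS_eq_integral hbdd hpos hw hv]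
  linarith

/-- Cauchy-Schwarz inequality for the scattering form. -/
theorem formS_le (hbdd : P.BoundedData) (hpos : P.Positivity)
    (hw : P.BoundedMeasurable w) (hv : P.BoundedMeasurable v) :
    formS P w v ≤ weightedNorm P P.β w * weightedNorm P P.γ v := by
  have h := discrim_le_zero (formS_quadratic_nonneg hbdd hpos hw hv)
  rw [discrim] at h
  refine le_of_abs_le (abs_le_of_sq_le_sq ?_ (mul_nonneg (Real.sqrt_nonneg _) (Real.sqrt_nonneg _)))
  nlinarith

/-- Young's inequality for the scattering form. -/
theorem two_mul_formS_self_le (hbdd : P.BoundedData) (hpos : P.Positivity)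
    (hv : P.BoundedMeasurable v) :
    2 * formS P v v ≤ weightedNorm P P.β v ^ 2 + weightedNorm P P.γ v ^ 2 := by
  have h := formS_quadratic_nonneg hbdd hpos hv hv 1
  linarith

end

end Scattering

/-! ### Surface integrals over element boundaries -/

section Surface

variable {d : ℕ} {κ : Set (Space d)} {F G : ℝ → Space d → Dir d → ℝ → ℝ}

/-- A measurable integrand `F (μ·n) x μ E` that is bounded over the boundary of `κ`. -/
structure SurfaceIntegrand (κ : Set (Space d)) (F : ℝ → Space d → Dir d → ℝ → ℝ) : Prop where
  measurable : Measurable fun z : ℝ × Space d × Dir d × ℝ => F z.1 z.2.1 z.2.2.1 z.2.2.2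
  bounded : ∃ C, 0 ≤ C ∧ ∀ s, |s| ≤ 1 → ∀ x ∈ frontier κ, ∀ μ E, |F s x μ E| ≤ C

/-- The surface integral of `F (μ·n) x μ E` over the boundary of `κ`. -/
def surfaceIntegral (κ : Set (Space d)) (F : ℝ → Space d → Dir d → ℝ → ℝ) (μ : Dir d) (E : ℝ) : ℝ :=
  ∫ x in frontier κ, F ⟪(μ : Space d), outwardNormal κ x⟫ x μ E ∂surfaceMeasure d

namespace SurfaceIntegrand

theorem add (hF : SurfaceIntegrand κ F) (hG : SurfaceIntegrand κ G) :
    SurfaceIntegrand κ fun s x μ E => F s x μ E + G s x μ E := by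
  obtain ⟨C, hC0, hC⟩ := hF.bounded
  obtain ⟨D, hD0, hD⟩ := hG.bounded
  exact ⟨hF.measurable.add hG.measurable, C + D, by positivity, fun s hs x hx μ E =>
    (abs_add_le _ _).trans (add_le_add (hC s hs x hx μ E) (hD s hs x hx μ E))⟩

theorem sub (hF : SurfaceIntegrand κ F) (hG : SurfaceIntegrand κ G) :
    SurfaceIntegrand κ fun s x μ E => F s x μ E - G s x μ E := by
  obtain ⟨C, hC0, hC⟩ := hF.bounded
  obtain ⟨D, hD0, hD⟩ := hG.bounded
  exact ⟨hF.measurable.sub hG.measurable, C + D, by positivity, fun s hs x hx μ E =>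
    (abs_sub _ _).trans (add_le_add (hC s hs x hx μ E) (hD s hs x hx μ E))⟩

theorem mul (hF : SurfaceIntegrand κ F) (hG : SurfaceIntegrand κ G) :
    SurfaceIntegrand κ fun s x μ E => F s x μ E * G s x μ E := by
  obtain ⟨C, hC0, hC⟩ := hF.bounded
  obtain ⟨D, hD0, hD⟩ := hG.bounded
  exact ⟨hF.measurable.mul hG.measurable, C * D, by positivity, fun s hs x hx μ E => by
    rw [abs_mul]; exact mul_le_mul (hC s hs x hx μ E) (hD s hs x hx μ E) (abs_nonneg _) hC0⟩

theorem flux : SurfaceIntegrand κ fun s _ _ _ => s :=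
  ⟨measurable_fst, 1, zero_le_one, fun _ hs _ _ _ _ => hs⟩

theorem abs_flux : SurfaceIntegrand κ fun s _ _ _ => |s| :=
  ⟨measurable_fst.abs, 1, zero_le_one, fun s hs _ _ _ _ => by rwa [abs_abs]⟩

theorem posFlux : SurfaceIntegrand κ fun s _ _ _ => max s 0 := by
  refine ⟨measurable_fst.max measurable_const, 1, zero_le_one, fun s hs _ _ _ _ => ?_⟩
  rw [abs_of_nonneg (le_max_right _ _)]
  exact max_le ((le_abs_self s).trans hs) zero_le_one

theorem negFlux : SurfaceIntegrand κ fun s _ _ _ => max (-s) 0 := by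
  refine ⟨measurable_fst.neg.max measurable_const, 1, zero_le_one, fun s hs _ _ _ _ => ?_⟩
  rw [abs_of_nonneg (le_max_right _ _)]
  exact max_le ((neg_le_abs s).trans hs) zero_le_one

theorem indicator {A : Set (Space d)} (hA : MeasurableSet A) :
    SurfaceIntegrand κ fun _ x _ _ => A.indicator 1 x := by
  refine ⟨?_, 1, zero_le_one, fun _ _ x _ _ _ => ?_⟩
  · exact (measurable_one.indicator hA).comp (measurable_fst.comp measurable_snd)
  · by_cases hx : x ∈ A <;> simp [hx]

theorem measurable_section (hF : SurfaceIntegrand κ F) (hκ : IsLipschitzDomain κ) (μ : Dir d)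
    (E : ℝ) : AEStronglyMeasurable (fun x => F ⟪(μ : Space d), outwardNormal κ x⟫ x μ E)
      ((surfaceMeasure d).restrict (frontier κ)) := by
  have h1 : AEMeasurable (fun x => (⟪(μ : Space d), outwardNormal κ x⟫, x, μ, E))
      ((surfaceMeasure d).restrict (frontier κ)) :=
    (aemeasurable_const.inner hκ.aemeasurable_outwardNormal).prodMk
      (aemeasurable_id.prodMk aemeasurable_const)
  exact (hF.measurable.comp_aemeasurable h1).aestronglyMeasurable

theorem integrableOn (hF : SurfaceIntegrand κ F) (hκ : IsLipschitzDomain κ) (μ : Dir d) (E : ℝ) :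
    IntegrableOn (fun x => F ⟪(μ : Space d), outwardNormal κ x⟫ x μ E) (frontier κ)
      (surfaceMeasure d) := by
  have := hκ.isFiniteMeasure
  obtain ⟨C, hC0, hC⟩ := hF.bounded
  refine Integrable.of_bound (C := C) (hF.measurable_section hκ μ E) ?_
  exact (ae_restrict_iff' isClosed_frontier.measurableSet).2 (Eventually.of_forall fun x hx =>
    hC _ (abs_inner_outwardNormal_le κ x μ) x hx μ E)

theorem measurable_surfaceIntegral (hF : SurfaceIntegrand κ F) (hκ : IsLipschitzDomain κ) :
    Measurable fun z : ℝ × Dir d => surfaceIntegral κ F z.2 z.1 := by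
  have := hκ.isFiniteMeasure
  have hn := hκ.aemeasurable_outwardNormal
  -- The outward normal is replaced by a measurable version.
  have heq : (fun z : ℝ × Dir d => surfaceIntegral κ F z.2 z.1) = fun z : ℝ × Dir d =>
      ∫ x, F ⟪(z.2 : Space d), hn.mk _ x⟫ x z.2 z.1 ∂((surfaceMeasure d).restrict (frontier κ)) := by
    ext z
    refine integral_congr_ae ?_
    filter_upwards [hn.ae_eq_mk] with x hx
    rw [← hx]
  rw [heq]
  have h : Measurable fun z : (ℝ × Dir d) × Space d =>
      (⟪(z.1.2 : Space d), hn.mk _ z.2⟫, z.2, z.1.2, z.1.1) := by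
    have := hn.measurable_mk
    fun_prop
  exact ((hF.measurable.comp h).stronglyMeasurable.integral_prod_right').measurable

theorem integrable_surfaceIntegral (hF : SurfaceIntegrand κ F) (hκ : IsLipschitzDomain κ)
    {m : Measure (ℝ × Dir d)} [IsFiniteMeasure m] :
    Integrable (fun z => surfaceIntegral κ F z.2 z.1) m := by
  obtain ⟨C, hC0, hC⟩ := hF.bounded
  refine Integrable.of_bound (C := C * (surfaceMeasure d).real (frontier κ))
    (hF.measurable_surfaceIntegral hκ).aestronglyMeasurable (Eventually.of_forall fun z => ?_)
  exact norm_setIntegral_le_of_norm_le_const hκ.surfaceMeasure_frontier_lt_top fun x hx =>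
    hC _ (abs_inner_outwardNormal_le κ x _) x hx _ _

end SurfaceIntegrand

/-- Flux integrals over parts of the boundary of an element, as integrals over its whole
boundary. -/
theorem fluxIntegral_eq (hκ : IsLipschitzDomain κ) (μ : Dir d) {T : Set ℝ} (hT : MeasurableSet T)
    {A Γ : Set (Space d)} (hA : MeasurableSet A)
    (hΓ : Γ = {x | ⟪(μ : Space d), outwardNormal κ x⟫ ∈ T ∧ x ∈ A} ∩ frontier κ)
    {g h : Space d → ℝ}
    (hgh : ∀ᵐ x ∂surfaceMeasure d, x ∈ frontier κ →
      h x = {x | ⟪(μ : Space d), outwardNormal κ x⟫ ∈ T ∧ x ∈ A}.indicator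
        (fun x => |⟪(μ : Space d), outwardNormal κ x⟫| * g x) x) :
    fluxIntegral κ μ Γ g = ∫ x in frontier κ, h x ∂surfaceMeasure d := by
  have hs : NullMeasurableSet {x | ⟪(μ : Space d), outwardNormal κ x⟫ ∈ T ∧ x ∈ A}
      ((surfaceMeasure d).restrict (frontier κ)) :=
    ((aemeasurable_const.inner hκ.aemeasurable_outwardNormal).nullMeasurableSet_preimage hT).inter
      hA.nullMeasurableSet
  rw [fluxIntegral, hΓ, ← Measure.restrict_restrict₀ hs, ← integral_indicator₀ hs]
  refine integral_congr_ae ?_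
  filter_upwards [(ae_restrict_iff' isClosed_frontier.measurableSet).2 hgh] with x hx using hx.symm

theorem fluxIntegral_nonneg (κ : Set (Space d)) (μ : Dir d) (Γ : Set (Space d)) {g : Space d → ℝ}
    (hg : ∀ x, 0 ≤ g x) : 0 ≤ fluxIntegral κ μ Γ g :=
  integral_nonneg fun x => mul_nonneg (abs_nonneg _) (hg x)

end Surface

/-! ### Traces -/

section Traces

variable {d : ℕ} {P : Problem d} {M : SpaceMesh P.Ω} {V W : Fin M.card → Space d → Dir d → ℝ → ℝ}
  {v w : Space d → Dir d → ℝ → ℝ}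

theorem IsPiecewiseExtension.surfaceIntegrand (hV : IsPiecewiseExtension M V v)
    (i j : Fin M.card) : SurfaceIntegrand (M.elem i) fun _ x μ E => V j x μ E := by
  obtain ⟨C, hC⟩ := hV.bounded
  exact ⟨(hV.measurable j).comp measurable_snd, |C|, abs_nonneg _, fun _ _ x hx μ E =>
    (hC j x (M.frontier_subset i hx) μ E).trans (le_abs_self C)⟩

variable (V) in
/-- The exterior trace on the boundary of the `i`-th element, in terms of the extensions: at almost
every interface point exactly one summand is present. -/
def neighbourValue (i : Fin M.card) (x : Space d) (μ : Dir d) (E : ℝ) : ℝ :=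
  ∑ j ∈ Finset.univ.erase i, (frontier (M.elem j)).indicator (fun x => V j x μ E) x

theorem IsPiecewiseExtension.surfaceIntegrand_neighbourValue (hV : IsPiecewiseExtension M V v)
    (i : Fin M.card) : SurfaceIntegrand (M.elem i) fun _ x μ E => neighbourValue V i x μ E := by
  obtain ⟨C, hC⟩ := hV.bounded
  refine ⟨?_, ∑ j ∈ Finset.univ.erase i, |C|, Finset.sum_nonneg fun _ _ => abs_nonneg C,
    fun _ _ x hx μ E => ?_⟩
  · refine Finset.measurable_fun_sum _ fun j _ => ?_
    have h : Measurable fun z : ℝ × Space d × Dir d × ℝ => V j z.2.1 z.2.2.1 z.2.2.2 :=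
      (hV.measurable j).comp measurable_snd
    have hA : MeasurableSet {z : ℝ × Space d × Dir d × ℝ | z.2.1 ∈ frontier (M.elem j)} :=
      (measurable_fst.comp measurable_snd) isClosed_frontier.measurableSet
    exact h.indicator hA
  · refine (Finset.abs_sum_le_sum_abs _ _).trans (Finset.sum_le_sum fun j _ => ?_)
    by_cases hj : x ∈ frontier (M.elem j)
    · rw [indicator_of_mem hj]
      exact (hC j x (M.frontier_subset i hx) μ E).trans (le_abs_self C)
    · rw [indicator_of_notMem hj, abs_zero]; exact abs_nonneg _

theorem neighbourValue_eq {i j : Fin M.card} {x : Space d} (hji : j ≠ i)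
    (hj : x ∈ frontier (M.elem j)) (huniq : ∀ k, x ∈ frontier (M.elem k) → k = i ∨ k = j)
    (μ : Dir d) (E : ℝ) : neighbourValue V i x μ E = V j x μ E := by
  rw [neighbourValue, Finset.sum_eq_single j]
  · rw [indicator_of_mem hj]
  · intro k hk hkj
    refine indicator_of_notMem (fun h => ?_) _
    exact (huniq k h).elim (Finset.ne_of_mem_erase hk) hkj
  · intro h
    exact absurd (Finset.mem_erase.2 ⟨hji, Finset.mem_univ j⟩) h

theorem IsPiecewiseExtension.tendsto (hV : IsPiecewiseExtension M V v) (i : Fin M.card)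
    (x : Space d) (μ : Dir d) (E : ℝ) :
    Tendsto (fun y => v y μ E) (𝓝[M.elem i] x) (𝓝 (V i x μ E)) := by
  refine (((hV.contDiff i μ E).continuous.tendsto x).mono_left nhdsWithin_le_nhds).congr' ?_
  filter_upwards [self_mem_nhdsWithin] with y hy using (hV.eq_on i y hy μ E).symm

/-- The interior trace is a genuine limit, the value of the extension. -/
theorem IsPiecewiseExtension.intTrace_eq (hV : IsPiecewiseExtension M V v) {i : Fin M.card}
    {x : Space d} (hx : x ∈ frontier (M.elem i)) (μ : Dir d) (E : ℝ) :
    intTrace M i v μ E x = V i x μ E := by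
  have := mem_closure_iff_nhdsWithin_neBot.1 (frontier_subset_closure hx)
  exact (hV.tendsto i x μ E).limUnder_eq

/-- The exterior trace is a genuine limit at almost every interface point, as the other elements
reduce to a single neighbour there. -/
theorem IsPiecewiseExtension.extTrace_eq (hV : IsPiecewiseExtension M V v) :
    ∀ᵐ x ∂surfaceMeasure d, ∀ i, x ∈ frontier (M.elem i) → x ∉ frontier P.Ω → ∀ μ E,
      extTrace M i v μ E x = neighbourValue V i x μ E := by
  filter_upwards [M.ae_isOutwardNormal] with x hn i hx hxΩ μ E
  obtain ⟨j, hji, hj, -, huniq⟩ := M.exists_neighbour P.lipschitz.isOpen hx hxΩ hn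
  have := mem_closure_iff_nhdsWithin_neBot.1 (frontier_subset_closure hj)
  rw [neighbourValue_eq hji hj huniq, extTrace, M.nhdsWithin_others hx hji huniq]
  exact (hV.tendsto j x μ E).limUnder_eq

/-- Each interface carries outflow from one of its two elements and the same inflow into the
other. -/
theorem sum_surfaceIntegral_interface (hV : IsPiecewiseExtension M V v) (μ : Dir d) (E : ℝ) :
    ∑ i, surfaceIntegral (M.elem i) (fun s x μ E => (frontier P.Ω)ᶜ.indicator 1 x *
      (max s 0 * (V i x μ E * V i x μ E) -
        max (-s) 0 * (neighbourValue V i x μ E * neighbourValue V i x μ E))) μ E = 0 := by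
  have hSI : ∀ i, SurfaceIntegrand (M.elem i) fun s x μ E => (frontier P.Ω)ᶜ.indicator 1 x *
      (max s 0 * (V i x μ E * V i x μ E) -
        max (-s) 0 * (neighbourValue V i x μ E * neighbourValue V i x μ E)) := fun i =>
    (SurfaceIntegrand.indicator isClosed_frontier.measurableSet.compl).mul
      ((SurfaceIntegrand.posFlux.mul ((hV.surfaceIntegrand i i).mul (hV.surfaceIntegrand i i))).sub
        (SurfaceIntegrand.negFlux.mul ((hV.surfaceIntegrand_neighbourValue i).mul
          (hV.surfaceIntegrand_neighbourValue i))))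
  have hm : ∀ i, MeasurableSet (frontier (M.elem i)) := fun i => isClosed_frontier.measurableSet
  unfold surfaceIntegral
  simp_rw [← integral_indicator (hm _)]
  rw [← integral_finsetSum _ fun i _ =>
    (integrable_indicator_iff (hm i)).2 ((hSI i).integrableOn (M.lipschitz i) μ E)]
  refine integral_eq_zero_of_ae ?_
  filter_upwards [M.ae_isOutwardNormal] with x hn
  by_cases hxΩ : x ∈ frontier P.Ω
  · refine Finset.sum_eq_zero fun i _ => ?_
    by_cases hi : x ∈ frontier (M.elem i)
    · rw [indicator_of_mem hi, indicator_of_notMem (by simpa using hxΩ), zero_mul]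
    · rw [indicator_of_notMem hi]
  by_cases hex : ∃ i, x ∈ frontier (M.elem i)
  · obtain ⟨i, hi⟩ := hex
    obtain ⟨j, hji, hj, hnj, huniq⟩ := M.exists_neighbour P.lipschitz.isOpen hi hxΩ hn
    rw [Fintype.sum_eq_add i j hji.symm]
    · rw [indicator_of_mem hi, indicator_of_mem hj, neighbourValue_eq hji hj huniq,
        neighbourValue_eq hji.symm hi fun k hk => (huniq k hk).symm, hnj, inner_neg_right]
      simp only [Pi.zero_apply, neg_neg]
      ring
    · intro k hk
      exact indicator_of_notMem (fun h => (huniq k h).elim hk.1 hk.2) _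
  · push Not at hex
    exact Finset.sum_eq_zero fun i _ => indicator_of_notMem (hex i) _

end Traces

/-! ### The transport form -/

section TransportForm

variable {d : ℕ} [NeZero d] {P : Problem d} {M : SpaceMesh P.Ω}
  {V W : Fin M.card → Space d → Dir d → ℝ → ℝ} {v w : Space d → Dir d → ℝ → ℝ}

variable (P) in
/-- The volume integrand of the transport form on the `i`-th element. -/
def volumeTerm (V W : Fin M.card → Space d → Dir d → ℝ → ℝ) (i : Fin M.card) (x : Space d)
    (μ : Dir d) (E : ℝ) : ℝ :=
  -(V i x μ E * fderiv ℝ (fun y => W i y μ E) x (μ : Space d)) +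
    (P.α x E + P.β x E) * V i x μ E * W i x μ E

/-- The integrand of the transport form on the boundary of the `i`-th element. -/
def surfaceTerm (V W : Fin M.card → Space d → Dir d → ℝ → ℝ) (i : Fin M.card) (s : ℝ) (x : Space d)
    (μ : Dir d) (E : ℝ) : ℝ :=
  max s 0 * (V i x μ E * W i x μ E) -
    (frontier P.Ω)ᶜ.indicator 1 x * (max (-s) 0 * (neighbourValue V i x μ E * W i x μ E))

/-- The integrand of the jump term on the boundary of the `i`-th element. -/
def jumpIntegrand (V : Fin M.card → Space d → Dir d → ℝ → ℝ) (i : Fin M.card) (s : ℝ) (x : Space d)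
    (μ : Dir d) (E : ℝ) : ℝ :=
  (frontier P.Ω)ᶜ.indicator 1 x * (max (-s) 0 * ((V i x μ E - neighbourValue V i x μ E) *
    (V i x μ E - neighbourValue V i x μ E))) +
  (frontier P.Ω).indicator 1 x * (|s| * (V i x μ E * V i x μ E))

theorem boundedMeasurable_volumeTerm (hbdd : P.BoundedData) (hV : IsPiecewiseExtension M V v)
    (hW : IsPiecewiseExtension M W w) (i : Fin M.card) :
    P.BoundedMeasurable (volumeTerm P V W i) :=
  ((hV.boundedMeasurable i).mul (hW.boundedMeasurable_deriv i)).neg.add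
    ((((P.boundedMeasurable_α hbdd).add (P.boundedMeasurable_β hbdd)).mul
      (hV.boundedMeasurable i)).mul (hW.boundedMeasurable i))

theorem surfaceIntegrand_surfaceTerm (hV : IsPiecewiseExtension M V v)
    (hW : IsPiecewiseExtension M W w) (i : Fin M.card) :
    SurfaceIntegrand (M.elem i) (surfaceTerm V W i) :=
  (SurfaceIntegrand.posFlux.mul ((hV.surfaceIntegrand i i).mul (hW.surfaceIntegrand i i))).sub
    ((SurfaceIntegrand.indicator isClosed_frontier.measurableSet.compl).mul
      (SurfaceIntegrand.negFlux.mul ((hV.surfaceIntegrand_neighbourValue i).mul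
        (hW.surfaceIntegrand i i))))

theorem surfaceIntegrand_jumpIntegrand (hV : IsPiecewiseExtension M V v) (i : Fin M.card) :
    SurfaceIntegrand (M.elem i) (jumpIntegrand V i) := by
  have hd := (hV.surfaceIntegrand i i).sub (hV.surfaceIntegrand_neighbourValue i)
  exact ((SurfaceIntegrand.indicator isClosed_frontier.measurableSet.compl).mul
    (SurfaceIntegrand.negFlux.mul (hd.mul hd))).add
    ((SurfaceIntegrand.indicator isClosed_frontier.measurableSet).mul
      (SurfaceIntegrand.abs_flux.mul ((hV.surfaceIntegrand i i).mul (hV.surfaceIntegrand i i))))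

variable (P) in
/-- The energy-angle density of the transport form. -/
def transportDensity (V W : Fin M.card → Space d → Dir d → ℝ → ℝ) (μ : Dir d) (E : ℝ) : ℝ :=
  ∑ i, ((∫ x in M.elem i, volumeTerm P V W i x μ E) +
    surfaceIntegral (M.elem i) (surfaceTerm V W i) μ E)

theorem integrable_transportDensity (hbdd : P.BoundedData) (hV : IsPiecewiseExtension M V v)
    (hW : IsPiecewiseExtension M W w) :
    Integrable (fun z => transportDensity P V W z.2 z.1) P.energyDirMeasure :=
  integrable_finsetSum _ fun i _ =>
    ((boundedMeasurable_volumeTerm hbdd hV hW i).integrable_setIntegral (M.subset i)).add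
      ((surfaceIntegrand_surfaceTerm hV hW i).integrable_surfaceIntegral (M.lipschitz i))

theorem fluxIntegral_outflow (hV : IsPiecewiseExtension M V v) (hW : IsPiecewiseExtension M W w)
    (i : Fin M.card) (μ : Dir d) (E : ℝ) :
    fluxIntegral (M.elem i) μ (outflow (M.elem i) μ)
      (fun x => intTrace M i v μ E x * intTrace M i w μ E x) =
    surfaceIntegral (M.elem i) (fun s x μ E => max s 0 * (V i x μ E * W i x μ E)) μ E := by
  refine fluxIntegral_eq (M.lipschitz i) μ (T := Ici 0) measurableSet_Ici (A := univ)
    MeasurableSet.univ ?_ (Eventually.of_forall fun x hx => ?_)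
  · ext x; simp [outflow, and_comm]
  · classical
    simp only [indicator_apply, mem_ofPred_eq, mem_Ici, mem_univ, and_true]
    rw [hV.intTrace_eq hx, hW.intTrace_eq hx]
    split_ifs with hs
    · rw [max_eq_left hs, abs_of_nonneg hs]
    · rw [max_eq_right (not_le.1 hs).le, zero_mul]

theorem fluxIntegral_inflow {i : Fin M.card} {μ : Dir d} {E : ℝ} {g : Space d → ℝ}
    {G : Space d → Dir d → ℝ → ℝ}
    (hg : ∀ᵐ x ∂surfaceMeasure d, x ∈ frontier (M.elem i) → x ∉ frontier P.Ω → g x = G x μ E) :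
    fluxIntegral (M.elem i) μ (inflow (M.elem i) μ \ frontier P.Ω) g =
    surfaceIntegral (M.elem i)
      (fun s x μ E => (frontier P.Ω)ᶜ.indicator 1 x * (max (-s) 0 * G x μ E)) μ E := by
  refine fluxIntegral_eq (M.lipschitz i) μ (T := Iio 0) measurableSet_Iio (A := (frontier P.Ω)ᶜ)
    isClosed_frontier.measurableSet.compl ?_ ?_
  · ext x
    simp only [inflow, Set.mem_sdiff, mem_inter_iff, mem_ofPred_eq, mem_Iio, mem_compl_iff]
    tauto
  · filter_upwards [hg] with x hgx hx
    classical
    simp only [indicator_apply, mem_ofPred_eq, mem_Iio, mem_compl_iff, Pi.one_apply]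
    by_cases hxΩ : x ∈ frontier P.Ω
    · rw [if_neg (not_not.2 hxΩ), if_neg fun h => h.2 hxΩ, zero_mul]
    · rw [if_pos hxΩ, one_mul, ← hgx hx hxΩ]
      by_cases hs : ⟪(μ : Space d), outwardNormal (M.elem i) x⟫ < 0
      · rw [if_pos ⟨hs, hxΩ⟩, max_eq_left (by linarith), abs_of_neg hs]
      · rw [if_neg fun h => hs h.1, max_eq_right (by linarith), zero_mul]

theorem fluxIntegral_boundary (hV : IsPiecewiseExtension M V v) (i : Fin M.card) (μ : Dir d)
    (E : ℝ) :
    fluxIntegral (M.elem i) μ (frontier (M.elem i) ∩ frontier P.Ω)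
      (fun x => intTrace M i v μ E x ^ 2) =
    surfaceIntegral (M.elem i)
      (fun s x μ E => (frontier P.Ω).indicator 1 x * (|s| * (V i x μ E * V i x μ E))) μ E := by
  refine fluxIntegral_eq (M.lipschitz i) μ (T := univ) MeasurableSet.univ (A := frontier P.Ω)
    isClosed_frontier.measurableSet ?_ (Eventually.of_forall fun x hx => ?_)
  · ext x; simp [and_comm]
  · classical
    simp only [indicator_apply, mem_ofPred_eq, mem_univ, true_and, Pi.one_apply]
    rw [hV.intTrace_eq hx]
    split_ifs <;> ring

/-- The transport form in terms of the smooth extensions. -/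
theorem formA_eq_integral (hbdd : P.BoundedData) (hV : IsPiecewiseExtension M V v)
    (hW : IsPiecewiseExtension M W w) :
    formA P M v w = ∫ z, transportDensity P V W z.2 z.1 ∂P.energyDirMeasure := by
  rw [← P.integral_energy_dir (integrable_transportDensity hbdd hV hW), formA]
  congr 1; ext E; congr 1; ext μ
  refine Finset.sum_congr rfl fun i _ => ?_
  have hvol : ∫ x in M.elem i, (-(v x μ E * fderiv ℝ (fun y => w y μ E) x (μ : Space d))
      + (P.α x E + P.β x E) * v x μ E * w x μ E) = ∫ x in M.elem i, volumeTerm P V W i x μ E := by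
    refine setIntegral_congr_fun (M.lipschitz i).isOpen.measurableSet fun x hx => ?_
    have h1 : (fun y => w y μ E) =ᶠ[𝓝 x] fun y => W i y μ E := by
      filter_upwards [(M.lipschitz i).isOpen.mem_nhds hx] with y hy using hW.eq_on i y hy μ E
    simp only [volumeTerm, h1.fderiv_eq, hV.eq_on i x hx, hW.eq_on i x hx]
  have hin := fluxIntegral_inflow (P := P) (M := M) (i := i) (μ := μ) (E := E)
    (g := fun x => extTrace M i v μ E x * intTrace M i w μ E x)
    (G := fun x μ E => neighbourValue V i x μ E * W i x μ E) (by
      filter_upwards [hV.extTrace_eq] with x hx hxi hxΩ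
      rw [hx i hxi hxΩ, hW.intTrace_eq hxi])
  have hsurf : surfaceIntegral (M.elem i) (surfaceTerm V W i) μ E =
      surfaceIntegral (M.elem i) (fun s x μ E => max s 0 * (V i x μ E * W i x μ E)) μ E -
      surfaceIntegral (M.elem i) (fun s x μ E => (frontier P.Ω)ᶜ.indicator 1 x *
        (max (-s) 0 * (neighbourValue V i x μ E * W i x μ E))) μ E :=
    integral_sub
      ((SurfaceIntegrand.posFlux.mul ((hV.surfaceIntegrand i i).mul
        (hW.surfaceIntegrand i i))).integrableOn (M.lipschitz i) μ E)
      (((SurfaceIntegrand.indicator isClosed_frontier.measurableSet.compl).mul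
        (SurfaceIntegrand.negFlux.mul ((hV.surfaceIntegrand_neighbourValue i).mul
          (hW.surfaceIntegrand i i)))).integrableOn (M.lipschitz i) μ E)
  rw [hvol, fluxIntegral_outflow hV hW, hin, hsurf, add_sub_assoc]

theorem transportDensity_sub {V₁ V₂ : Fin M.card → Space d → Dir d → ℝ → ℝ}
    {v₁ v₂ : Space d → Dir d → ℝ → ℝ} (hbdd : P.BoundedData) (hV₁ : IsPiecewiseExtension M V₁ v₁)
    (hV₂ : IsPiecewiseExtension M V₂ v₂) (hW : IsPiecewiseExtension M W w) (μ : Dir d) {E : ℝ}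
    (hE : E ∈ P.energy) :
    transportDensity P (V₁ - V₂) W μ E =
      transportDensity P V₁ W μ E - transportDensity P V₂ W μ E := by
  unfold transportDensity
  rw [← Finset.sum_sub_distrib]
  refine Finset.sum_congr rfl fun i _ => ?_
  have h1 : ∫ x in M.elem i, volumeTerm P (V₁ - V₂) W i x μ E =
      (∫ x in M.elem i, volumeTerm P V₁ W i x μ E) - ∫ x in M.elem i, volumeTerm P V₂ W i x μ E := by
    rw [← integral_sub
      ((boundedMeasurable_volumeTerm hbdd hV₁ hW i).integrableOn (M.subset i)
        (M.lipschitz i).isOpen.measurableSet μ hE)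
      ((boundedMeasurable_volumeTerm hbdd hV₂ hW i).integrableOn (M.subset i)
        (M.lipschitz i).isOpen.measurableSet μ hE)]
    refine integral_congr_ae (Eventually.of_forall fun x => ?_)
    simp only [volumeTerm, Pi.sub_apply]
    ring
  have hnb : ∀ x, neighbourValue (V₁ - V₂) i x μ E =
      neighbourValue V₁ i x μ E - neighbourValue V₂ i x μ E := by
    intro x
    unfold neighbourValue
    rw [← Finset.sum_sub_distrib]
    refine Finset.sum_congr rfl fun j _ => ?_
    by_cases hj : x ∈ frontier (M.elem j)
    · simp only [indicator_of_mem hj, Pi.sub_apply]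
    · simp only [indicator_of_notMem hj, sub_zero]
  have h2 : surfaceIntegral (M.elem i) (surfaceTerm (V₁ - V₂) W i) μ E =
      surfaceIntegral (M.elem i) (surfaceTerm V₁ W i) μ E -
        surfaceIntegral (M.elem i) (surfaceTerm V₂ W i) μ E := by
    unfold surfaceIntegral
    rw [← integral_sub
      ((surfaceIntegrand_surfaceTerm hV₁ hW i).integrableOn (M.lipschitz i) μ E)
      ((surfaceIntegrand_surfaceTerm hV₂ hW i).integrableOn (M.lipschitz i) μ E)]
    refine integral_congr_ae (Eventually.of_forall fun x => ?_)
    simp only [surfaceTerm, hnb, Pi.sub_apply]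
    ring
  rw [h1, h2]
  ring

/-- Linearity of the transport form in its first argument. It is not formal: all integrals and
traces have to exist. -/
theorem formA_sub {v₁ v₂ : Space d → Dir d → ℝ → ℝ} {V₁ V₂ : Fin M.card → Space d → Dir d → ℝ → ℝ}
    (hbdd : P.BoundedData) (hV₁ : IsPiecewiseExtension M V₁ v₁)
    (hV₂ : IsPiecewiseExtension M V₂ v₂) (hW : IsPiecewiseExtension M W w) :
    formA P M (v₁ - v₂) w = formA P M v₁ w - formA P M v₂ w := by
  rw [formA_eq_integral hbdd (hV₁.sub hV₂) hW, formA_eq_integral hbdd hV₁ hW,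
    formA_eq_integral hbdd hV₂ hW, ← integral_sub (integrable_transportDensity hbdd hV₁ hW)
      (integrable_transportDensity hbdd hV₂ hW)]
  refine integral_congr_ae ?_
  filter_upwards [P.ae_energyDirMeasure] with z hz
  exact transportDensity_sub hbdd hV₁ hV₂ hW z.2 hz

theorem jumpTerm_eq_integral (hV : IsPiecewiseExtension M V v) :
    jumpTerm P M v = 1 / 2 * ∫ z, ∑ i, surfaceIntegral (M.elem i) (jumpIntegrand V i) z.2 z.1
      ∂P.energyDirMeasure := by
  have hint : Integrable (fun z : ℝ × Dir d =>
      ∑ i, surfaceIntegral (M.elem i) (jumpIntegrand V i) z.2 z.1) P.energyDirMeasure :=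
    integrable_finsetSum _ fun i _ =>
      (surfaceIntegrand_jumpIntegrand hV i).integrable_surfaceIntegral (M.lipschitz i)
  rw [← P.integral_energy_dir
    (F := fun μ E => ∑ i, surfaceIntegral (M.elem i) (jumpIntegrand V i) μ E) hint, jumpTerm]
  congr 2; ext E; congr 1; ext μ
  refine Finset.sum_congr rfl fun i _ => ?_
  have hin := fluxIntegral_inflow (P := P) (M := M) (i := i) (μ := μ) (E := E)
    (g := fun x => (intTrace M i v μ E x - extTrace M i v μ E x) ^ 2)
    (G := fun x μ E => (V i x μ E - neighbourValue V i x μ E) *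
      (V i x μ E - neighbourValue V i x μ E)) (by
      filter_upwards [hV.extTrace_eq] with x hx hxi hxΩ
      rw [hx i hxi hxΩ, hV.intTrace_eq hxi, pow_two])
  have hd := (hV.surfaceIntegrand i i).sub (hV.surfaceIntegrand_neighbourValue i)
  rw [hin, fluxIntegral_boundary hV]
  exact (integral_add
    (((SurfaceIntegrand.indicator isClosed_frontier.measurableSet.compl).mul
      (SurfaceIntegrand.negFlux.mul (hd.mul hd))).integrableOn (M.lipschitz i) μ E)
    (((SurfaceIntegrand.indicator isClosed_frontier.measurableSet).mul
      (SurfaceIntegrand.abs_flux.mul ((hV.surfaceIntegrand i i).mul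
        (hV.surfaceIntegrand i i)))).integrableOn (M.lipschitz i) μ E)).symm

theorem jumpTerm_nonneg (P : Problem d) (M : SpaceMesh P.Ω) (v : Space d → Dir d → ℝ → ℝ) :
    0 ≤ jumpTerm P M v :=
  mul_nonneg (by norm_num) (integral_nonneg fun E => integral_nonneg fun μ =>
    Finset.sum_nonneg fun i _ => add_nonneg
      (fluxIntegral_nonneg _ _ _ fun x => sq_nonneg _) (fluxIntegral_nonneg _ _ _ fun x => sq_nonneg _))

/-- Integration by parts on an element turns the streaming term into a surface integral. -/
theorem setIntegral_volumeTerm_self (hbdd : P.BoundedData) (hV : IsPiecewiseExtension M V v)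
    (i : Fin M.card) (μ : Dir d) {E : ℝ} (hE : E ∈ P.energy) :
    ∫ x in M.elem i, volumeTerm P V V i x μ E =
      (∫ x in M.elem i, (P.α x E + P.β x E) * (v x μ E * v x μ E)) -
        1 / 2 * surfaceIntegral (M.elem i) (fun s x μ E => s * (V i x μ E * V i x μ E)) μ E := by
  have hs : ContDiff ℝ 1 fun x => V i x μ E * V i x μ E :=
    (hV.contDiff i μ E).mul (hV.contDiff i μ E)
  have hdiv := (M.lipschitz i).setIntegral_fderiv hs (μ : Space d)
  have hI1 := ((hV.boundedMeasurable i).mul (hV.boundedMeasurable_deriv i)).integrableOn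
    (M.subset i) (M.lipschitz i).isOpen.measurableSet μ hE
  have hI2 := (((P.boundedMeasurable_α hbdd).add (P.boundedMeasurable_β hbdd)).mul
    (hV.boundedMeasurable_fun.mul hV.boundedMeasurable_fun)).integrableOn
    (M.subset i) (M.lipschitz i).isOpen.measurableSet μ hE
  have hder : ∀ x, fderiv ℝ (fun x => V i x μ E * V i x μ E) x (μ : Space d) =
      2 * (V i x μ E * fderiv ℝ (fun y => V i y μ E) x (μ : Space d)) := by
    intro x
    have hd := (hV.contDiff i μ E).differentiable one_ne_zero x
    rw [fderiv_fun_mul hd hd]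
    simp; ring
  simp_rw [hder] at hdiv
  rw [integral_const_mul] at hdiv
  have hsurf : surfaceIntegral (M.elem i) (fun s x μ E => s * (V i x μ E * V i x μ E)) μ E =
      2 * ∫ x in M.elem i, V i x μ E * fderiv ℝ (fun y => V i y μ E) x (μ : Space d) := hdiv.symm
  rw [hsurf, ← mul_assoc, one_div, inv_mul_cancel₀ two_ne_zero, one_mul, ← integral_sub hI2 hI1]
  refine setIntegral_congr_fun (M.lipschitz i).isOpen.measurableSet fun x hx => ?_
  simp only [volumeTerm, hV.eq_on i x hx]
  ring

theorem sum_setIntegral_elem (hbdd : P.BoundedData) (hV : IsPiecewiseExtension M V v)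
    (μ : Dir d) {E : ℝ} (hE : E ∈ P.energy) :
    ∑ i, ∫ x in M.elem i, (P.α x E + P.β x E) * (v x μ E * v x μ E) =
      ∫ x in P.Ω, (P.α x E + P.β x E) * (v x μ E * v x μ E) := by
  have hI := (((P.boundedMeasurable_α hbdd).add (P.boundedMeasurable_β hbdd)).mul
    (hV.boundedMeasurable_fun.mul hV.boundedMeasurable_fun))
  rw [← integral_iUnion_fintype (fun i => (M.lipschitz i).isOpen.measurableSet) M.disjoint
    fun i => hI.integrableOn (M.subset i) (M.lipschitz i).isOpen.measurableSet μ hE]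
  refine (setIntegral_eq_of_subset_of_forall_sdiff_eq_zero P.lipschitz.isOpen.measurableSet
    (iUnion_subset M.subset) fun x hx => ?_).symm
  -- Outside the elements, on their boundaries, finite element functions vanish by convention.
  rw [hV.eq_zero x hx.2]; ring

/-- The energy identity at fixed energy and direction: after integration by parts on the elements, the
surface terms combine to the jump terms, up to interface terms that cancel. -/
theorem transportDensity_self (hbdd : P.BoundedData) (hV : IsPiecewiseExtension M V v)
    (μ : Dir d) {E : ℝ} (hE : E ∈ P.energy) :
    transportDensity P V V μ E = (∫ x in P.Ω, (P.α x E + P.β x E) * (v x μ E * v x μ E)) +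
      1 / 2 * ∑ i, surfaceIntegral (M.elem i) (jumpIntegrand V i) μ E := by
  have hsurf : ∀ i, surfaceIntegral (M.elem i) (surfaceTerm V V i) μ E =
      1 / 2 * surfaceIntegral (M.elem i) (jumpIntegrand V i) μ E +
      1 / 2 * surfaceIntegral (M.elem i) (fun s x μ E => (frontier P.Ω)ᶜ.indicator 1 x *
        (max s 0 * (V i x μ E * V i x μ E) -
          max (-s) 0 * (neighbourValue V i x μ E * neighbourValue V i x μ E))) μ E +
      1 / 2 * surfaceIntegral (M.elem i) (fun s x μ E => s * (V i x μ E * V i x μ E)) μ E := by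
    intro i
    have h1 := (surfaceIntegrand_jumpIntegrand hV i).integrableOn (M.lipschitz i) μ E
    have h2 := ((SurfaceIntegrand.indicator (A := (frontier P.Ω)ᶜ)
      isClosed_frontier.measurableSet.compl).mul
      ((SurfaceIntegrand.posFlux.mul ((hV.surfaceIntegrand i i).mul (hV.surfaceIntegrand i i))).sub
        (SurfaceIntegrand.negFlux.mul ((hV.surfaceIntegrand_neighbourValue i).mul
          (hV.surfaceIntegrand_neighbourValue i))))).integrableOn (M.lipschitz i) μ E
    have h3 := (SurfaceIntegrand.flux.mul ((hV.surfaceIntegrand i i).mul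
      (hV.surfaceIntegrand i i))).integrableOn (M.lipschitz i) μ E
    unfold surfaceIntegral
    rw [← integral_const_mul (1 / 2 : ℝ) (fun x => ⟪(μ : Space d), outwardNormal (M.elem i) x⟫ *
        (V i x μ E * V i x μ E)),
      ← integral_linear_combination h1 h2 (h3.const_mul (1 / 2))]
    refine integral_congr_ae (Eventually.of_forall fun x => ?_)
    simp only [surfaceTerm, jumpIntegrand]
    -- Writing both fluxes through `|s|` and `s`, the identity becomes polynomial in the two traces.
    set s := ⟪(μ : Space d), outwardNormal (M.elem i) x⟫
    have hpos : max s 0 = (|s| + s) / 2 := by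
      rcases le_total 0 s with h | h
      · rw [max_eq_left h, abs_of_nonneg h]; ring
      · rw [max_eq_right h, abs_of_nonpos h]; ring
    have hneg : max (-s) 0 = (|s| - s) / 2 := by
      rcases le_total 0 s with h | h
      · rw [max_eq_right (by linarith), abs_of_nonneg h]; ring
      · rw [max_eq_left (by linarith), abs_of_nonpos h]; ring
    rw [hpos, hneg]
    by_cases hx : x ∈ frontier P.Ω
    · rw [indicator_of_mem hx, indicator_of_notMem (s := (frontier P.Ω)ᶜ) (by simpa using hx),
        Pi.one_apply]; ring
    · rw [indicator_of_notMem hx, indicator_of_mem (s := (frontier P.Ω)ᶜ) hx, Pi.one_apply]; ring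
  unfold transportDensity
  simp_rw [setIntegral_volumeTerm_self hbdd hV _ μ hE, hsurf]
  have hz := sum_surfaceIntegral_interface hV μ E
  rw [← sum_setIntegral_elem hbdd hV μ hE]
  simp only [Finset.sum_add_distrib, Finset.sum_sub_distrib, ← Finset.mul_sum]
  rw [hz]
  ring

/-- **Energy identity** of the transport form: the norm `|||·|||_a` is its energy norm, so that the
form is coercive. -/
theorem formA_self (hbdd : P.BoundedData) (hV : IsPiecewiseExtension M V v) :
    formA P M v v = weightedNorm P (fun x E => P.α x E + P.β x E) v ^ 2 + jumpTerm P M v := by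
  have hρ := (P.boundedMeasurable_α hbdd).add (P.boundedMeasurable_β hbdd)
  have hv := hV.boundedMeasurable_fun
  have hI := hρ.mul (hv.mul hv)
  rw [formA_eq_integral hbdd hV hV, jumpTerm_eq_integral hV, weightedNorm_sq hρ hv
    fun x hx E hE => add_nonneg (P.α_nonneg x hx E hE) (Problem.β_nonneg hx hE)]
  have hjump : Integrable (fun z : ℝ × Dir d =>
      ∑ i, surfaceIntegral (M.elem i) (jumpIntegrand V i) z.2 z.1) P.energyDirMeasure :=
    integrable_finsetSum _ fun i _ =>
      (surfaceIntegrand_jumpIntegrand hV i).integrable_surfaceIntegral (M.lipschitz i)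
  have hphase : ∫ z, (P.α z.1 z.2.1 + P.β z.1 z.2.1) * v z.1 z.2.2 z.2.1 ^ 2 ∂P.phaseMeasure =
      ∫ z, (∫ x in P.Ω, (P.α x z.1 + P.β x z.1) * (v x z.2 z.1 * v x z.2 z.1))
        ∂P.energyDirMeasure := by
    simp only [pow_two]
    exact integral_prod_symm _ hI.integrable
  rw [hphase, ← integral_const_mul, ← integral_add
    (hI.integrable_setIntegral Subset.rfl) (hjump.const_mul _)]
  refine integral_congr_ae ?_
  filter_upwards [P.ae_energyDirMeasure] with z hz
  exact transportDensity_self hbdd hV z.2 hz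

end TransportForm

/-! ### The energy norms and the contraction argument -/

section Convergence

variable {d : ℕ} [NeZero d] {P : Problem d} {M : SpaceMesh P.Ω} {v : Space d → Dir d → ℝ → ℝ}

theorem weightedNorm_nonneg (P : Problem d) (ρ : Space d → ℝ → ℝ) (v : Space d → Dir d → ℝ → ℝ) :
    0 ≤ weightedNorm P ρ v :=
  Real.sqrt_nonneg _

theorem weightedNorm_sub_comm (ρ : Space d → ℝ → ℝ) (v w : Space d → Dir d → ℝ → ℝ) :
    weightedNorm P ρ (v - w) = weightedNorm P ρ (w - v) := by
  simp only [weightedNorm, Pi.sub_apply, mul_pow]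
  simp only [sub_sq_comm]

/-- A pointwise comparison of weights on the phase space carries over to the weighted norms. -/
theorem weightedNorm_sq_le {ρ σ : Space d → ℝ → ℝ} {c : ℝ}
    (hρ : P.BoundedMeasurable fun x _ E => ρ x E) (hσ : P.BoundedMeasurable fun x _ E => σ x E)
    (hv : P.BoundedMeasurable v) (hρ0 : ∀ x ∈ P.Ω, ∀ E ∈ P.energy, 0 ≤ ρ x E)
    (hσ0 : ∀ x ∈ P.Ω, ∀ E ∈ P.energy, 0 ≤ σ x E)
    (h : ∀ x ∈ P.Ω, ∀ E ∈ P.energy, ρ x E ≤ c * σ x E) :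
    weightedNorm P ρ v ^ 2 ≤ c * weightedNorm P σ v ^ 2 := by
  rw [weightedNorm_sq hρ hv hρ0, weightedNorm_sq hσ hv hσ0, ← integral_const_mul]
  have hv2 := hv.mul hv
  simp only [sq]
  refine integral_mono_ae (hρ.mul hv2).integrable ((hσ.mul hv2).integrable.const_mul c) ?_
  filter_upwards [P.ae_phaseMeasure] with z hz
  rw [← mul_assoc c]
  exact mul_le_mul_of_nonneg_right (h _ hz.1 _ hz.2) (mul_self_nonneg _)

theorem boundedMeasurable_α_add_β (hbdd : P.BoundedData) :
    P.BoundedMeasurable fun x _ E => P.α x E + P.β x E :=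
  (P.boundedMeasurable_α hbdd).add (P.boundedMeasurable_β hbdd)

theorem boundedMeasurable_αbar (hbdd : P.BoundedData) (hpos : P.Positivity) :
    P.BoundedMeasurable fun x _ E => P.αbar x E := by
  have hm : Measurable fun z : Space d × ℝ => P.αbar z.1 z.2 :=
    P.α_measurable.add ((P.β_measurable.sub P.γ_measurable).const_mul _)
  obtain ⟨C, hC⟩ := hbdd
  refine P.boundedMeasurable_of_le (C := C + 1 / 2 * C) hm
    (fun x hx E hE => (P.αbar_pos hpos hx hE).le) fun x hx E hE => ?_
  have h1 := hC x hx E hE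
  have h2 := P.γ_nonneg hx hE
  rw [Problem.αbar]
  linarith

/-- Since `ᾱ = α + β - ½ (β + γ)`, the `ᾱ`-weighted norm is the `(α + β)`-weighted one minus
what bounds the scattering form on the diagonal. -/
theorem weightedNorm_αbar_sq (hbdd : P.BoundedData) (hpos : P.Positivity)
    (hv : P.BoundedMeasurable v) :
    weightedNorm P P.αbar v ^ 2 = weightedNorm P (fun x E => P.α x E + P.β x E) v ^ 2 -
      1 / 2 * (weightedNorm P P.β v ^ 2 + weightedNorm P P.γ v ^ 2) := by
  have hv2 := hv.mul hv
  rw [weightedNorm_sq (boundedMeasurable_αbar hbdd hpos) hv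
      fun x hx E hE => (P.αbar_pos hpos hx hE).le,
    weightedNorm_sq (boundedMeasurable_α_add_β hbdd) hv
      fun x hx E hE => (P.α_add_β_pos hpos hx hE).le,
    weightedNorm_sq (P.boundedMeasurable_β hbdd) hv fun x hx E hE => P.β_nonneg hx hE,
    weightedNorm_sq (P.boundedMeasurable_γ hbdd hpos) hv fun x hx E hE => P.γ_nonneg hx hE]
  have h1 := ((boundedMeasurable_α_add_β hbdd).mul hv2).integrable
  have h2 := ((P.boundedMeasurable_β hbdd).mul hv2).integrable
  have h3 := ((P.boundedMeasurable_γ hbdd hpos).mul hv2).integrable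
  simp only [sq, Problem.αbar]
  rw [mul_add, sub_add_eq_sub_sub, sub_eq_add_neg, sub_eq_add_neg, ← neg_mul, add_assoc,
    add_comm (∫ z, _ ∂P.phaseMeasure), ← neg_mul, ← integral_linear_combination h2 h3 h1]
  congr 1; ext z; ring

theorem normA_sq (hbdd : P.BoundedData) {V : Fin M.card → Space d → Dir d → ℝ → ℝ}
    (hV : IsPiecewiseExtension M V v) : normA P M v ^ 2 = formA P M v v := by
  rw [normA, Real.sq_sqrt (add_nonneg (sq_nonneg _) (jumpTerm_nonneg P M v)), formA_self hbdd hV]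

theorem normDG_sq (P : Problem d) (M : SpaceMesh P.Ω) (v : Space d → Dir d → ℝ → ℝ) :
    normDG P M v ^ 2 = weightedNorm P P.αbar v ^ 2 + jumpTerm P M v := by
  rw [normDG, Real.sq_sqrt (add_nonneg (sq_nonneg _) (jumpTerm_nonneg P M v))]

/-- Coercivity of the full transport form in the DG energy norm. -/
theorem normDG_sq_le (hbdd : P.BoundedData) (hpos : P.Positivity)
    {V : Fin M.card → Space d → Dir d → ℝ → ℝ} (hV : IsPiecewiseExtension M V v) :
    normDG P M v ^ 2 ≤ formA P M v v - formS P v v := by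
  have hv := hV.boundedMeasurable_fun
  rw [normDG_sq, weightedNorm_αbar_sq hbdd hpos hv, formA_self hbdd hV]
  linarith [two_mul_formS_self_le hbdd hpos hv]

theorem weightedNorm_β_le_normA (hbdd : P.BoundedData) (hpos : P.Positivity)
    (hv : P.BoundedMeasurable v) : weightedNorm P P.β v ≤ √P.qβ * normA P M v := by
  have hJ := jumpTerm_nonneg P M v
  rw [normA, ← Real.sqrt_mul (P.qβ_nonneg hpos)]
  refine Real.le_sqrt_of_sq_le ((weightedNorm_sq_le (P.boundedMeasurable_β hbdd)
    (boundedMeasurable_α_add_β hbdd) hv (fun x hx E hE => P.β_nonneg hx hE)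
    (fun x hx E hE => (P.α_add_β_pos hpos hx hE).le)
    fun x hx E hE => P.β_le_qβ hpos hx hE).trans ?_)
  exact mul_le_mul_of_nonneg_left (le_add_of_nonneg_right hJ) (P.qβ_nonneg hpos)

theorem weightedNorm_γ_le_normA (hbdd : P.BoundedData) (hpos : P.Positivity)
    (hv : P.BoundedMeasurable v) : weightedNorm P P.γ v ≤ √P.qγ * normA P M v := by
  have hJ := jumpTerm_nonneg P M v
  rw [normA, ← Real.sqrt_mul (P.qγ_nonneg hpos)]
  refine Real.le_sqrt_of_sq_le ((weightedNorm_sq_le (P.boundedMeasurable_γ hbdd hpos)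
    (boundedMeasurable_α_add_β hbdd) hv (fun x hx E hE => P.γ_nonneg hx hE)
    (fun x hx E hE => (P.α_add_β_pos hpos hx hE).le)
    fun x hx E hE => P.γ_le_qγ hpos hx hE).trans ?_)
  exact mul_le_mul_of_nonneg_left (le_add_of_nonneg_right hJ) (P.qγ_nonneg hpos)

theorem weightedNorm_γ_le_normDG (hbdd : P.BoundedData) (hpos : P.Positivity)
    (hv : P.BoundedMeasurable v) : weightedNorm P P.γ v ≤ √P.rγ * normDG P M v := by
  have hJ := jumpTerm_nonneg P M v
  rw [normDG, ← Real.sqrt_mul (P.rγ_nonneg hpos)]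
  refine Real.le_sqrt_of_sq_le ((weightedNorm_sq_le (P.boundedMeasurable_γ hbdd hpos)
    (boundedMeasurable_αbar hbdd hpos) hv (fun x hx E hE => P.γ_nonneg hx hE)
    (fun x hx E hE => (P.αbar_pos hpos hx hE).le)
    fun x hx E hE => P.γ_le_rγ hbdd hpos hx hE).trans ?_)
  exact mul_le_mul_of_nonneg_left (le_add_of_nonneg_right hJ) (P.rγ_nonneg hpos)

theorem le_of_sq_le_mul_self {a b : ℝ} (ha : 0 ≤ a) (hb : 0 ≤ b) (h : a ^ 2 ≤ b * a) : a ≤ b := by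
  rcases ha.eq_or_lt with rfl | ha
  · exact hb
  · exact le_of_mul_le_mul_right (by rwa [← sq]) ha

/-- The error equation of source iteration, tested with the new error. -/
theorem formA_error {V : Submodule ℝ (Space d → Dir d → ℝ → ℝ)} (hbdd : P.BoundedData)
    (hpos : P.Positivity) (hV : ∀ v ∈ V, ∃ W, IsPiecewiseExtension M W v)
    {uh : Space d → Dir d → ℝ → ℝ} (huh : IsDGSolution P M V uh)
    {u : ℕ → Space d → Dir d → ℝ → ℝ} (hu : IsSourceIteration P M V u) (n : ℕ) :
    formA P M (uh - u (n + 1)) (uh - u (n + 1)) = formS P (uh - u n) (uh - u (n + 1)) := by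
  have he := V.sub_mem huh.1 (hu.1 (n + 1))
  obtain ⟨W, hW⟩ := hV _ he
  obtain ⟨W₀, hW₀⟩ := hV _ huh.1
  obtain ⟨W₁, hW₁⟩ := hV _ (hu.1 (n + 1))
  obtain ⟨W₂, hW₂⟩ := hV _ (hu.1 n)
  rw [formA_sub hbdd hW₀ hW₁ hW, huh.2 _ he, hu.2 n _ he,
    formS_sub hbdd hpos hW₀.boundedMeasurable_fun hW₂.boundedMeasurable_fun
      (hW₀.sub hW₂).boundedMeasurable_fun hW.boundedMeasurable_fun]
  ring

/-- Contraction of source iteration in the norm `|||·|||_a`. -/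
theorem normA_error_le {V : Submodule ℝ (Space d → Dir d → ℝ → ℝ)} (hbdd : P.BoundedData)
    (hpos : P.Positivity) (hV : ∀ v ∈ V, ∃ W, IsPiecewiseExtension M W v)
    {uh : Space d → Dir d → ℝ → ℝ} (huh : IsDGSolution P M V uh)
    {u : ℕ → Space d → Dir d → ℝ → ℝ} (hu : IsSourceIteration P M V u) (n : ℕ) :
    normA P M (uh - u (n + 1)) ≤ √(P.qβ * P.qγ) * normA P M (uh - u n) := by
  obtain ⟨W, hW⟩ := hV _ (V.sub_mem huh.1 (hu.1 (n + 1)))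
  obtain ⟨W', hW'⟩ := hV _ (V.sub_mem huh.1 (hu.1 n))
  have hv := hW.boundedMeasurable_fun
  have hw := hW'.boundedMeasurable_fun
  refine le_of_sq_le_mul_self (Real.sqrt_nonneg _)
    (mul_nonneg (Real.sqrt_nonneg _) (Real.sqrt_nonneg _)) ?_
  calc normA P M (uh - u (n + 1)) ^ 2
      = formS P (uh - u n) (uh - u (n + 1)) := by
        rw [normA_sq hbdd hW, formA_error hbdd hpos hV huh hu]
    _ ≤ weightedNorm P P.β (uh - u n) * weightedNorm P P.γ (uh - u (n + 1)) :=
        formS_le hbdd hpos hw hv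
    _ ≤ (√P.qβ * normA P M (uh - u n)) * (√P.qγ * normA P M (uh - u (n + 1))) :=
        mul_le_mul (weightedNorm_β_le_normA hbdd hpos hw) (weightedNorm_γ_le_normA hbdd hpos hv)
          (weightedNorm_nonneg _ _ _) (mul_nonneg (Real.sqrt_nonneg _) (Real.sqrt_nonneg _))
    _ = √(P.qβ * P.qγ) * normA P M (uh - u n) * normA P M (uh - u (n + 1)) := by
        rw [Real.sqrt_mul (P.qβ_nonneg hpos)]; ring

/-- The error of source iteration in the DG energy norm, bounded by the last increment. -/
theorem normDG_error_le {V : Submodule ℝ (Space d → Dir d → ℝ → ℝ)} (hbdd : P.BoundedData)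
    (hpos : P.Positivity) (hV : ∀ v ∈ V, ∃ W, IsPiecewiseExtension M W v)
    {uh : Space d → Dir d → ℝ → ℝ} (huh : IsDGSolution P M V uh)
    {u : ℕ → Space d → Dir d → ℝ → ℝ} (hu : IsSourceIteration P M V u) (n : ℕ) :
    normDG P M (uh - u (n + 1)) ≤ √P.rγ * weightedNorm P P.β (u n - u (n + 1)) := by
  obtain ⟨W, hW⟩ := hV _ (V.sub_mem huh.1 (hu.1 (n + 1)))
  obtain ⟨W', hW'⟩ := hV _ (V.sub_mem huh.1 (hu.1 n))
  obtain ⟨D, hD⟩ := hV _ (V.sub_mem (hu.1 (n + 1)) (hu.1 n))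
  have hv := hW.boundedMeasurable_fun
  have hdiff : uh - u n - (uh - u (n + 1)) = u (n + 1) - u n := by abel
  refine le_of_sq_le_mul_self (Real.sqrt_nonneg _)
    (mul_nonneg (Real.sqrt_nonneg _) (Real.sqrt_nonneg _)) ?_
  calc normDG P M (uh - u (n + 1)) ^ 2
      ≤ formS P (uh - u n) (uh - u (n + 1)) - formS P (uh - u (n + 1)) (uh - u (n + 1)) := by
        rw [← formA_error hbdd hpos hV huh hu]; exact normDG_sq_le hbdd hpos hW
    _ = formS P (u (n + 1) - u n) (uh - u (n + 1)) := by
        rw [← formS_sub hbdd hpos hW'.boundedMeasurable_fun hv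
          (hW'.sub hW).boundedMeasurable_fun hv, hdiff]
    _ ≤ weightedNorm P P.β (u (n + 1) - u n) * weightedNorm P P.γ (uh - u (n + 1)) :=
        formS_le hbdd hpos hD.boundedMeasurable_fun hv
    _ ≤ weightedNorm P P.β (u n - u (n + 1)) * (√P.rγ * normDG P M (uh - u (n + 1))) := by
        rw [weightedNorm_sub_comm]
        exact mul_le_mul_of_nonneg_left (weightedNorm_γ_le_normDG hbdd hpos hv)
          (weightedNorm_nonneg _ _ _)
    _ = √P.rγ * weightedNorm P P.β (u n - u (n + 1)) * normDG P M (uh - u (n + 1)) := by ring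

end Convergence

end Transport

end

open Transport

theorem mainTheorem1 {d : ℕ} [NeZero d] (hd : d = 2 ∨ d = 3)
    (P : Problem d) (hbdd : P.BoundedData) (hpos : P.Positivity)
    (MX : SpaceMesh P.Ω) (MA : CubeMesh d) (ME : EnergyMesh P.Emin P.Emax) (p q r : ℕ)
    (uh : Space d → Dir d → ℝ → ℝ)
    (huh : IsDGSolution P MX (feSpace MX MA ME p q r) uh)
    (u : ℕ → Space d → Dir d → ℝ → ℝ)
    (hu : IsSourceIteration P MX (feSpace MX MA ME p q r) u) :
    (∀ n, normA P MX (uh - u (n + 1)) ≤ √(P.qβ * P.qγ) * normA P MX (uh - u n)) ∧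
    (∀ n, normDG P MX (uh - u (n + 1)) ≤
      √P.rγ * weightedNorm P P.β (u n - u (n + 1))) := by
  have hV : ∀ v ∈ feSpace MX MA ME p q r, ∃ W, IsPiecewiseExtension MX W v :=
    fun _ hv => exists_isPiecewiseExtension P.lipschitz.isBounded hv
  exact ⟨fun n => normA_error_le hbdd hpos hV huh hu n,
    fun n => normDG_error_le hbdd hpos hV huh hu n⟩
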